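/- Conventions: the metric is $\eta=\mathrm{diag}(1,-1,-1,-1)$, $\omega_m(\vec p)=\sqrt{|\vec p|^2+m^2}$, $p=(\omega_m(\vec p),\vec p)$, $d\mu_m=\frac{d^3p}{(2\pi)^3 2\omega_m(\vec p)}$, $X\overset{\leftrightarrow}{\partial}Y=X\,\partial Y-(\partial X)\,Y$, and $\times$ denotes contracted indices. Let $s\ge 0$ be an integer and $m\ge 0$. One-particle states are wave functions $\psi(\vec p)$ with values in the symmetric traceless rank-$s$ tensors over $\mathbb C^3$, with scalar product $\int d\mu_m\,\overline{\psi}\cdot\psi'$. The $(m,s)$ Wigner representation of the Poincaré group acts on them (for $m=0$: its massless limit, the direct sum of the representations with helicities $-s,\dots,s$). Let $P_\sigma$ and $M_{\sigma\tau}$ be the second quantizations of its generators $p_\sigma$ and $i(p_\sigma\partial_{p^\tau}-p_\tau\partial_{p^\sigma})+{}$(spin part) on the symmetric Fock space. For $m>0$ let $A^{\mathrm P}_{\mu_1\dots\mu_s}(x)$ be the free hermitian Proca field of spin $s$, i.e. $(\Omega,A^{\mathrm P}(x)\psi)=\int d\mu_m\,e^{-ipx}\,u(p)\psi(\vec p)$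 with $u(p)$ the $s$-fold tensor power of the standard boost, and let $F_{[\mu_1\nu_1]\dots[\mu_s\nu_s]}$ be its curl in all indices. For a vector $e$ with $e^2=-1$ let $(I_ef)(x)=\int_0^\infty f(x+ue)\,du$ (understood with a convergence factor $e^{-\varepsilon u}$, $\varepsilon\downarrow0$), and put $$a^{(s)}_{\mu_1\dots\mu_s}(x,e)=(I_e^sF_{[\mu_1\nu_1]\dots[\mu_s\nu_s]})(x)\,e^{\nu_1}\cdots e^{\nu_s},\qquad a^{(r)}_{\mu_1\dots\mu_r}(x,e)=-m^{-1}\partial^\mu a^{(r+1)}_{\mu_1\dots\mu_r\mu}(x,e)\quad(0\le r<s).$$ For $m=0$ let $a^{(r)}$ be the limit $m\downarrow0$ of these fields, taken in the matrix elements $(\Omega,a^{(r)}_{\mu_1\dots\mu_r}(x,e)\psi)$ with $\psi$ fixed. **Proposition.** Let $e,e'$ be any two vectors with $e^2=e'^2=-1$. At $m=0$ the limits defining $a^{(r)}(x,e)$ and $a^{(r)}(x,e')$ exist. For every $m\ge0$ and every time $t=x^0$ one has, with Wick ordered products, $$P_\sigma=\sum_{r=0}^s\binom sr(-1)^r\int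 d^3\vec x\,\Big[-\tfrac14\,a^{(r)}_{\mu_1\dots\mu_r}(x,e)\overset{\leftrightarrow}{\partial_0}\overset{\leftrightarrow}{\partial_\sigma}a^{(r)\mu_1\dots\mu_r}(x,e')\Big],$$ $$M_{\sigma\tau}=\sum_{r=0}^s\binom sr(-1)^r\int d^3\vec x\,\Big[-\tfrac14\,x_\sigma\,a^{(r)}_{\mu\times}(x,e)\overset{\leftrightarrow}{\partial_0}\overset{\leftrightarrow}{\partial_\tau}a^{(r)\mu\times}(x,e')-\tfrac r2\,a^{(r)}_{\sigma\times}(x,e)\overset{\leftrightarrow}{\partial_0}a^{(r)}_\tau{}^{\times}(x,e')\Big]-(\sigma\leftrightarrow\tau).$$ For $m>0$ these operators also coincide with the expressions in the Proca field $$P_\sigma=(-1)^s\int d^3\vec x\,\Big[-\tfrac14A^{\mathrm P}_{\mu_1\dots\mu_s}\overset{\leftrightarrow}{\partial_0}\overset{\leftrightarrow}{\partial_\sigma}A^{\mathrm P\,\mu_1\dots\mu_s}\Big],$$ $$M_{\sigma\tau}=(-1)^s\int d^3\vec x\,\Big[-\tfrac14\big(x_\sigma A^{\mathrm P}_{\mu\times}\overset{\leftrightarrow}{\partial_0}\overset{\leftrightarrow}{\partial_\tau}A^{\mathrm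 P\,\mu\times}-(\sigma\leftrightarrow\tau)\big)-s\,A^{\mathrm P}_{\sigma\times}\overset{\leftrightarrow}{\partial_0}A^{\mathrm P}_\tau{}^{\times}\Big].$$ All identities, including the absolute convergence of the spatial integrals, hold for matrix elements between the finite-particle vectors generated by one-particle states $\psi$ that are smooth, compactly supported in $\vec p$, and vanish in a neighbourhood of $\{p\cdot e=0\}\cup\{p\cdot e'=0\}$ (a dense set of vectors, on which all fields decay rapidly in spatial directions). -/

import Mathlib

open Real Set Filter Topology MeasureTheory
open scoped ContDiff ComplexConjugate

noncomputable section

namespace StringQFT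

/-! ### Minkowski space and momenta -/

/-- Spatial vectors (positions or momenta). -/
abbrev E3 := EuclideanSpace ℝ (Fin 3)

/-- Spacetime points and four-vectors, by their contravariant components. -/
abbrev M4 := Fin 4 → ℝ

/-- Diagonal entries of the Minkowski metric, signature `(+,-,-,-)`. -/
def eta (μ : Fin 4) : ℝ := if μ = 0 then 1 else -1

/-- Minkowski product of two four-vectors. -/
def mdot (x y : M4) : ℝ := ∑ μ, eta μ * x μ * y μ

/-- The four-vector with time component `t` and spatial part `x`. -/
def fourVec (t : ℝ) (x : E3) : M4 := Fin.cons t (fun i => x i)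

/-- The energy `ω_m(p) = √(|p|² + m²)`. -/
def omega (m : ℝ) (p : E3) : ℝ := √(‖p‖ ^ 2 + m ^ 2)

/-- The point `(ω_m(p), p)` of the mass shell. -/
def onShell (m : ℝ) (p : E3) : M4 := fourVec (omega m p) p

/-- Density of the invariant measure `dμ_m = d³p / ((2π)³ 2 ω_m(p))` on the mass shell. -/
def shellDensity (m : ℝ) (p : E3) : ℝ := 1 / ((2 * π) ^ 3 * (2 * omega m p))

/-! ### One-particle states

A one-particle state of mass `m ≥ 0` and spin `s` is described by its Wigner wave function
`ψ(p)` with values in the symmetric traceless tensors of rank `s` over `ℂ³`, the spin-`s`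
representation of the rotation group. -/

/-- Wave functions, with rank `s` tensor index. -/
abbrev Wave (s : ℕ) := E3 → (Fin s → Fin 3) → ℂ

/-- Scalar product `∫ dμ_m(p) ∑_I conj (ψ_I(p)) φ_I(p)` of one-particle states. -/
def waveInner {s : ℕ} (m : ℝ) (ψ φ : Wave s) : ℂ :=
  ∫ p : E3, (shellDensity m p : ℂ) * ∑ I : Fin s → Fin 3, conj (ψ p I) * φ p I

/-- Symmetric and traceless tensors of rank `s` over `ℂ³`. -/
def IsSpinTensor {s : ℕ} (v : (Fin s → Fin 3) → ℂ) : Prop :=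
  (∀ (g : Equiv.Perm (Fin s)) (I : Fin s → Fin 3), v (I ∘ g) = v I) ∧
  (∀ (i j : Fin s), i ≠ j → ∀ I : Fin s → Fin 3,
    ∑ k : Fin 3, v (Function.update (Function.update I i k) j k) = 0)

/-- The wave functions used as one-particle states: smooth, compactly supported, with values
in the spin-`s` tensors, and supported away from the zeros of `p·e` and of `p·e'` on the mass
shell. They are dense in the one-particle space, and on the corresponding states the fields
localized on strings in the directions `e`, `e'` decay rapidly in spatial directions. -/
def admissible (s : ℕ) (m : ℝ) (e e' : M4) : Set (Wave s) :=
  {ψ | ContDiff ℝ ∞ ψ ∧ HasCompactSupport ψ ∧ (∀ p, IsSpinTensor (ψ p)) ∧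
    ∀ p ∈ tsupport ψ, mdot (onShell m p) e ≠ 0 ∧ mdot (onShell m p) e' ≠ 0}

/-! ### The Poincaré generators on one-particle states -/

/-- Covariant component `p_σ` of the on-shell momentum. -/
def lowMom (m : ℝ) (σ : Fin 4) (p : E3) : ℝ := eta σ * onShell m p σ

/-- Derivative `∂/∂p^σ` of a wave function in the coordinates `p ∈ ℝ³` of the mass shell:
`∂/∂p^0` is absent. -/
def momDeriv {s : ℕ} (σ : Fin 4) (ψ : Wave s) : Wave s := fun p I =>
  Fin.cases (motive := fun _ => ℂ) 0
    (fun i => lineDeriv ℝ (fun q : E3 => ψ q I) p (EuclideanSpace.single i 1)) σ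

/-- The vectors `β_0(p) = -p/(ω_m(p)+m)` and `β_i` = standard basis of `ℝ³`. -/
def spinVec (m : ℝ) (p : E3) (σ : Fin 4) (k : Fin 3) : ℝ :=
  Fin.cases (motive := fun _ => ℝ) (-(p k) / (omega m p + m))
    (fun i => if k = i then 1 else 0) σ

/-- Spin part (on one tensor index) of the Lorentz generator, a `3 × 3` matrix: an
infinitesimal rotation. For `σ`, `τ` spatial it is the rotation in the `(σ,τ)` plane, for
`σ = 0` it is the infinitesimal Wigner rotation of the boost in the direction `τ`. -/
def spinMat (m : ℝ) (p : E3) (σ τ : Fin 4) (k l : Fin 3) : ℝ :=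
  spinVec m p τ k * spinVec m p σ l - spinVec m p σ k * spinVec m p τ l

/-- One-particle momentum operators: multiplication by `p_σ`. -/
def oneP {s : ℕ} (m : ℝ) (σ : Fin 4) (ψ : Wave s) : Wave s := fun p I =>
  (lowMom m σ p : ℂ) * ψ p I

/-- One-particle Lorentz generators
`i (p_σ ∂/∂p^τ - p_τ ∂/∂p^σ) + i (spin part acting on each tensor index)` of the `(m,s)`
Wigner representation (for `m = 0`: of its massless limit, the direct sum of the
representations of helicities `-s, ..., s`). -/
def oneM {s : ℕ} (m : ℝ) (σ τ : Fin 4) (ψ : Wave s) : Wave s := fun p I =>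
  Complex.I * ((lowMom m σ p : ℂ) * momDeriv τ ψ p I - (lowMom m τ p : ℂ) * momDeriv σ ψ p I) +
  Complex.I * ∑ a : Fin s, ∑ l : Fin 3,
    (spinMat m p σ τ (I a) l : ℂ) * ψ p (Function.update I a l)

/-! ### Fock space

Finite particle vectors are written as polynomials in creation operators `a*(ψ)` applied to the
vacuum vector: the variable `X ψ` stands for `a*(ψ)` and `1` for the vacuum. (Linear relations
`a*(ψ + φ) = a*(ψ) + a*(φ)` hold modulo null vectors of the scalar product.) -/

/-- Finite particle vectors. -/
abbrev Fock (s : ℕ) := MvPolynomial (Wave s) ℂ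

/-- The annihilation operator attached to a functional `α` on one-particle states: it kills the
vacuum and satisfies `[annih α, a*(φ)] = α φ`. -/
def annih {s : ℕ} (α : Wave s → ℂ) : Fock s → Fock s :=
  MvPolynomial.mkDerivation ℂ (fun φ => MvPolynomial.C (α φ))

/-- The Fock space scalar product:
`(a*(ψ₁)⋯a*(ψₙ)Ω, Φ)` is the vacuum component of `a(ψ₁)⋯a(ψₙ)Φ`. -/
def fockInner {s : ℕ} (m : ℝ) (Ψ Φ : Fock s) : ℂ :=
  ∑ n ∈ Ψ.support, conj (Ψ.coeff n) *
    MvPolynomial.constantCoeff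
      ((Finsupp.toMultiset n).toList.foldr (fun ψ Θ => annih (waveInner m ψ) Θ) Φ)

/-- Second quantization of a one-particle operator `K`: `[dGamma K, a*(φ)] = a*(K φ)`. -/
def dGamma {s : ℕ} (K : Wave s → Wave s) : Fock s → Fock s :=
  MvPolynomial.mkDerivation ℂ (fun φ => MvPolynomial.X (K φ))

/-- Hermitian free fields (components) on the Fock space, at a point given by the matrix elements
`α φ = (Ω, A φ)` between the vacuum and one-particle states, i.e. `A` is the sum of `annih α` and
its adjoint. This is the matrix element `(Ψ, :A B: Φ)` of the Wick product of the field `A` given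
by `α` and the field `B` given by `β`. -/
def wick {s : ℕ} (m : ℝ) (α β : Wave s → ℂ) (Ψ Φ : Fock s) : ℂ :=
  fockInner m Ψ (annih α (annih β Φ)) + fockInner m (annih α Ψ) (annih β Φ)
    + fockInner m (annih β Ψ) (annih α Φ) + fockInner m (annih α (annih β Ψ)) Φ

/-! ### Tensor fields -/

/-- Complex tensor fields of rank `r` on Minkowski space, by their covariant components. -/
abbrev Ten (r : ℕ) := M4 → (Fin r → Fin 4) → ℂ

/-- Partial derivative `∂_μ`. -/
def pd (μ : Fin 4) (f : M4 → ℂ) : M4 → ℂ := fun x => lineDeriv ℝ f x (Pi.single μ 1)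

/-- Iterated partial derivative. -/
def pdList (L : List (Fin 4)) (f : M4 → ℂ) : M4 → ℂ := L.foldr pd f

/-- Divergence `∂^μ T_{μ₁…μ_r μ}`. -/
def divergence {r : ℕ} (T : Ten (r + 1)) : Ten r := fun x M =>
  ∑ μ, (eta μ : ℂ) * pd μ (fun y => T y (Fin.snoc M μ)) x

/-- Curl in all indices, `F_{[μ₁ν₁]…[μ_sν_s]}`: for each `k` one antisymmetrizes
`∂_{μ_k} A_{…ν_k…} - ∂_{ν_k} A_{…μ_k…}`. -/
def fieldStrength {s : ℕ} (A : Ten s) (M N : Fin s → Fin 4) : M4 → ℂ := fun x =>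
  ∑ S : Finset (Fin s), (-1 : ℂ) ^ S.card *
    pdList (List.ofFn fun k => if k ∈ S then N k else M k)
      (fun y => A y (fun k => if k ∈ S then M k else N k)) x

/-- String integration `(I_e f)(x) = ∫₀^∞ f(x + u e) du`, with the usual convergence factor
`exp(-ε u)`, `ε ↓ 0` (which turns plane waves into plane waves with the factor `1/(pe + i0)`
or its conjugate). -/
def stringInt (e : M4) (f : M4 → ℂ) : M4 → ℂ := fun x =>
  limUnder (𝓝[>] (0 : ℝ)) fun ε : ℝ => ∫ u in Ioi (0 : ℝ), (rexp (-ε * u) : ℂ) * f (x + u • e)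

/-- Quantized tensor fields of rank `r`, by their matrix elements `(Ω, X_{μ₁…μ_r}(x) φ)`. -/
abbrev QTen (s r : ℕ) := Wave s → Ten r

/-! ### The massive Proca field and its string-localized escort fields -/

/-- The standard boost, restricted to `ℝ³`: it maps the rest space of `(m,0,0,0)` isometrically
onto the orthogonal complement of `p`. Contravariant components. -/
def stdBoost (m : ℝ) (p : E3) (μ : Fin 4) (k : Fin 3) : ℝ :=
  Fin.cases (motive := fun _ => ℝ) (p k / m)
    (fun i => (if i = k then 1 else 0) + p i * p k / (m * (omega m p + m))) μ

/-- The massive Proca field of spin `s`: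
`(Ω, A_{μ₁…μ_s}(x) ψ) = ∫ dμ_m(p) e^{-ipx} (u(p) ψ(p))_{μ₁…μ_s}`, where the intertwiner `u(p)` is
the `s`-fold tensor power of the standard boost. -/
def proca (s : ℕ) (m : ℝ) : QTen s s := fun ψ x M =>
  ∫ p : E3, (shellDensity m p : ℂ) * Complex.exp (-Complex.I * (mdot (onShell m p) x : ℂ)) *
    ∑ I : Fin s → Fin 3, (∏ k, ((eta (M k) * stdBoost m p (M k) (I k) : ℝ) : ℂ)) * ψ p I

/-- The massive string-localized potential
`a^{(s)}_{μ₁…μ_s}(x,e) = (I_e^s F_{[μ₁ν₁]…[μ_sν_s]})(x) e^{ν₁}⋯e^{ν_s}`. -/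
def stringPot (s : ℕ) (m : ℝ) (e : M4) : QTen s s := fun ψ x M =>
  ∑ N : Fin s → Fin 4, (∏ k, (e (N k) : ℂ)) *
    ((stringInt e)^[s] (fieldStrength (proca s m ψ) M N)) x

/-- `k`-fold application of `T ↦ -m⁻¹ ∂·T` to a tensor field of rank `s = r + k`. -/
def descend {s : ℕ} (m : ℝ) (T : Ten s) : (k r : ℕ) → r + k = s → Ten r
  | 0, _, h => fun x M => T x (fun i => M (Fin.cast h.symm i))
  | k + 1, r, h => fun x M =>
      -(m⁻¹ : ℂ) * divergence (descend m T k (r + 1) (by omega)) x M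

/-- The massive escort fields: `a^{(r)}_{μ₁…μ_r} = -m⁻¹ ∂^μ a^{(r+1)}_{μ₁…μ_r μ}` for `r < s`.
(Zero by convention for `r > s`.) -/
def massiveEscort (s : ℕ) (m : ℝ) (e : M4) (r : ℕ) : QTen s r := fun ψ =>
  if h : r ≤ s then descend m (stringPot s m e ψ) (s - r) r (by omega) else 0

/-- The fields `a^{(r)}(x,e)` for all masses `m ≥ 0`: at `m = 0` they are the limits `m ↓ 0` of
the massive ones. -/
def escort (s : ℕ) (m : ℝ) (e : M4) (r : ℕ) : QTen s r := fun ψ x M =>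
  if 0 < m then massiveEscort s m e r ψ x M
  else limUnder (𝓝[>] (0 : ℝ)) fun m' : ℝ => massiveEscort s m' e r ψ x M

/-! ### Quadratic densities

All products of fields are Wick products, given by their matrix elements between `Ψ` and `Φ`. -/

/-- `X ∂_μ↔ Y = X ∂_μ Y - (∂_μ X) Y` at the point `x`, for scalar (component) fields. -/
def lr1 {s : ℕ} (m : ℝ) (X Y : Wave s → M4 → ℂ) (μ : Fin 4) (x : M4) (Ψ Φ : Fock s) : ℂ :=
  wick m (fun φ => X φ x) (fun φ => pd μ (Y φ) x) Ψ Φ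
    - wick m (fun φ => pd μ (X φ) x) (fun φ => Y φ x) Ψ Φ

/-- `X ∂_μ↔ ∂_ν↔ Y = X ∂_μ∂_ν Y - ∂_μ X ∂_ν Y - ∂_ν X ∂_μ Y + (∂_μ∂_ν X) Y`. -/
def lr2 {s : ℕ} (m : ℝ) (X Y : Wave s → M4 → ℂ) (μ ν : Fin 4) (x : M4) (Ψ Φ : Fock s) : ℂ :=
  wick m (fun φ => X φ x) (fun φ => pd μ (pd ν (Y φ)) x) Ψ Φ
    - wick m (fun φ => pd μ (X φ) x) (fun φ => pd ν (Y φ) x) Ψ Φ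
    - wick m (fun φ => pd ν (X φ) x) (fun φ => pd μ (Y φ) x) Ψ Φ
    + wick m (fun φ => pd μ (pd ν (X φ)) x) (fun φ => Y φ x) Ψ Φ

/-- `X_{μ₁…μ_r} ∂_0↔ ∂_σ↔ Y^{μ₁…μ_r}`. -/
def contrDensity {s r : ℕ} (m : ℝ) (X Y : QTen s r) (σ : Fin 4) (x : M4) (Ψ Φ : Fock s) : ℂ :=
  ∑ M : Fin r → Fin 4, (∏ k, (eta (M k) : ℂ)) *
    lr2 m (fun φ y => X φ y M) (fun φ y => Y φ y M) 0 σ x Ψ Φ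

/-- `X_{σ×} ∂_0↔ Y_τ^×`, where `×` stands for `r - 1` contracted indices (zero if `r = 0`). -/
def spinDensity {s : ℕ} (m : ℝ) : {r : ℕ} → (X Y : QTen s r) → (σ τ : Fin 4) → M4 →
    (Ψ Φ : Fock s) → ℂ
  | 0, _, _, _, _, _, _, _ => 0
  | r + 1, X, Y, σ, τ, x, Ψ, Φ =>
      ∑ N : Fin r → Fin 4, (∏ k, (eta (N k) : ℂ)) *
        lr1 m (fun φ y => X φ y (Fin.cons σ N)) (fun φ y => Y φ y (Fin.cons τ N)) 0 x Ψ Φ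

/-- Covariant component `x_σ`. -/
def lowPos (σ : Fin 4) (x : M4) : ℝ := eta σ * x σ

/-- Momentum density `-¼ X_{μ₁…μ_r} ∂_0↔ ∂_σ↔ Y^{μ₁…μ_r}`. -/
def momDensity {s r : ℕ} (m : ℝ) (X Y : QTen s r) (σ : Fin 4) (x : M4) (Ψ Φ : Fock s) : ℂ :=
  -(1 / 4 : ℂ) * contrDensity m X Y σ x Ψ Φ

/-- `-¼ x_σ X_{μ×} ∂_0↔ ∂_τ↔ Y^{μ×} - (r/2) X_{σ×} ∂_0↔ Y_τ^×`. -/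
def lorDensity {s r : ℕ} (m : ℝ) (X Y : QTen s r) (σ τ : Fin 4) (x : M4) (Ψ Φ : Fock s) : ℂ :=
  -(1 / 4 : ℂ) * (lowPos σ x : ℂ) * contrDensity m X Y τ x Ψ Φ
    - (r / 2 : ℂ) * spinDensity m X Y σ τ x Ψ Φ

/-- The density of the Lorentz generators in terms of the Proca field:
`-¼ (x_σ A_{μ×} ∂_0↔ ∂_τ↔ A^{μ×} - (σ ↔ τ)) - s A_{σ×} ∂_0↔ A_τ^×`. -/
def procaLorDensity (s : ℕ) (m : ℝ) (σ τ : Fin 4) (x : M4) (Ψ Φ : Fock s) : ℂ :=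
  -(1 / 4 : ℂ) * ((lowPos σ x : ℂ) * contrDensity m (proca s m) (proca s m) τ x Ψ Φ
      - (lowPos τ x : ℂ) * contrDensity m (proca s m) (proca s m) σ x Ψ Φ)
    - (s : ℂ) * spinDensity m (proca s m) (proca s m) σ τ x Ψ Φ

end StringQFT

end

/-! On the admissible states every field is `field m a` for a smooth amplitude `a` compactly
supported in momentum space. In each tensor index its intertwiner is c_k - p y_k. Here c_k has time
component p_k/(ω+m) and the k-th unit vector as spatial part, so it stays regular at m = 0 away from
p = 0, and y is a real function of p. The Proca field has y_k = -p_k/(m(ω+m)). The string-localized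
potential has y_k = (c_k e)/(pe), because the curl removes whatever is parallel to p and each string
integration divides by i(pe). Applying -m⁻¹∂ to a Lorentz index turns it, by p² = m², into a scalar
"escort" index with intertwiner -i(m y_k + p_k/(ω+m)). No inverse power of m is left in the string
fields. Hence the massless limit exists by dominated convergence, and a single computation with
arbitrary y and y' covers all masses, both strings, and the Proca field, whose escort vanishes.

The algebraic core is a completeness relation: contracting potential and escort with the metric (-η,
1) on ℂ⁴ ⊕ ℂ gives δ_kl for any two functions y, y' (`mdot_potVec_potVec`). Its s-fold tensor power
is a sum over multi-indices in ℂ⁴ ⊕ ℂ. Sorting these by the number r of Lorentz indices produces the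
weights binom(s,r)(-1)^r (`sum_choose_neg_one_pow`). This settles the momenta. For the Lorentz
generators the relation is differentiated in the momentum of the right-hand field only. The
derivative of y' drops out (`shellDeriv_contraction`), and antisymmetrizing what remains together
with the spin density yields the infinitesimal Wigner rotation (`spinMat_eq`).

The analytic part is Plancherel: at fixed time a field is an inverse Fourier transform, so spatial
integrals of products become momentum integrals (`integral_conj_field_mul_field`), and x_σ acts on
amplitudes as the first-order operator `posOp`. Terms with one creation and one annihilation
operator give the generators. Terms with two of the same kind integrate to zero or, when weighted
with x_σ, are symmetric in σ and τ and disappear from M. On Fock space both sides reduce to double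
sums over finitely many wave functions with coefficients (∂_ψ Ψ, ∂_φ Φ) (`fockInner_dGamma`,
`wick_eq_sum`). The two orders of e and e' contribute one half each. -/

noncomputable section

namespace StringQFT

/-! ### Combinatorics of the Fock space -/

section FockSpace

variable {s : ℕ}

lemma annih_add (α : Wave s → ℂ) (Φ Φ' : Fock s) :
    annih α (Φ + Φ') = annih α Φ + annih α Φ' := map_add _ _ _

lemma annih_smul (α : Wave s → ℂ) (c : ℂ) (Φ : Fock s) : annih α (c • Φ) = c • annih α Φ :=
  Derivation.map_smul _ _ _

lemma annih_sum {ι : Type*} (α : Wave s → ℂ) (S : Finset ι) (Φ : ι → Fock s) :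
    annih α (∑ i ∈ S, Φ i) = ∑ i ∈ S, annih α (Φ i) := map_sum _ _ _

lemma annih_X (α : Wave s → ℂ) (φ : Wave s) :
    annih α (MvPolynomial.X φ) = MvPolynomial.C (α φ) := MvPolynomial.mkDerivation_X _ _ _

lemma annih_C (α : Wave s → ℂ) (c : ℂ) : annih α (MvPolynomial.C c : Fock s) = 0 :=
  Derivation.map_algebraMap _ _

lemma annih_mul (α : Wave s → ℂ) (Φ Φ' : Fock s) :
    annih α (Φ * Φ') = Φ * annih α Φ' + Φ' * annih α Φ := Derivation.leibniz _ _ _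

/-- The commutator of two derivations is a derivation, and it kills every generator because each
`annih` sends generators to constants. -/
lemma annih_comm (α β : Wave s → ℂ) (Φ : Fock s) :
    annih α (annih β Φ) = annih β (annih α Φ) := by
  have h : ⁅MvPolynomial.mkDerivation ℂ (fun φ : Wave s => (MvPolynomial.C (α φ) : Fock s)),
      MvPolynomial.mkDerivation ℂ (fun φ : Wave s => (MvPolynomial.C (β φ) : Fock s))⁆ = 0 := by
    apply MvPolynomial.derivation_ext
    intro i
    simp [Derivation.commutator_apply]
  have h2 := DFunLike.congr_fun h Φ
  rw [Derivation.commutator_apply] at h2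
  exact sub_eq_zero.1 h2

lemma derivation_sum_apply {ι : Type*} (S : Finset ι)
    (D : ι → Derivation ℂ (Fock s) (Fock s)) (Φ : Fock s) :
    (∑ i ∈ S, D i) Φ = ∑ i ∈ S, D i Φ := by
  classical
  induction S using Finset.induction_on with
  | empty => simp
  | insert a S ha ih => rw [Finset.sum_insert ha, Finset.sum_insert ha, Derivation.add_apply, ih]

-- A derivation is determined by its values on generators. On vectors built from finitely many wave
-- functions the functional α therefore enters only through finitely many numbers, and matrix
-- elements become finite sums of scalar functions of x.
open Classical in
lemma annih_eq_sum (α : Wave s → ℂ) (S : Finset (Wave s)) (Φ : Fock s)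
    (hΦ : Φ ∈ MvPolynomial.supported ℂ (S : Set (Wave s))) :
    annih α Φ = ∑ φ ∈ S, α φ • MvPolynomial.pderiv φ Φ := by
  have h := MvPolynomial.derivation_eqOn_supported
    (D₁ := MvPolynomial.mkDerivation ℂ (fun φ : Wave s => (MvPolynomial.C (α φ) : Fock s)))
    (D₂ := ∑ φ ∈ S, α φ • MvPolynomial.pderiv φ) (s := (S : Set (Wave s))) ?_ hΦ
  · rw [annih, h, derivation_sum_apply]
    rfl
  · intro ψ hψ
    have hψ' : ψ ∈ S := hψ
    simp [derivation_sum_apply, MvPolynomial.pderiv_X, Pi.single_apply,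
      hψ', MvPolynomial.smul_eq_C_mul]

open Classical in
lemma dGamma_eq_sum (K : Wave s → Wave s) (S : Finset (Wave s)) (Φ : Fock s)
    (hΦ : Φ ∈ MvPolynomial.supported ℂ (S : Set (Wave s))) :
    dGamma K Φ = ∑ φ ∈ S, MvPolynomial.X (K φ) * MvPolynomial.pderiv φ Φ := by
  have h := MvPolynomial.derivation_eqOn_supported
    (D₁ := MvPolynomial.mkDerivation ℂ (fun φ : Wave s => (MvPolynomial.X (K φ) : Fock s)))
    (D₂ := ∑ φ ∈ S, (MvPolynomial.X (K φ) : Fock s) • MvPolynomial.pderiv φ)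
    (s := (S : Set (Wave s))) ?_ hΦ
  · rw [dGamma, h, derivation_sum_apply]
    rfl
  · intro ψ hψ
    have hψ' : ψ ∈ S := hψ
    simp [derivation_sum_apply, MvPolynomial.pderiv_X, Pi.single_apply, hψ']

lemma pderiv_mem_supported (S : Set (Wave s)) (φ : Wave s) (Φ : Fock s)
    (hΦ : Φ ∈ MvPolynomial.supported ℂ S) :
    MvPolynomial.pderiv φ Φ ∈ MvPolynomial.supported ℂ S := by
  classical
  induction hΦ using Algebra.adjoin_induction with
  | mem x hx =>
    obtain ⟨ψ, hψ, rfl⟩ := hx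
    rw [MvPolynomial.pderiv_X, Pi.single_apply]
    split_ifs
    · exact one_mem _
    · exact zero_mem _
  | algebraMap r =>
    have : MvPolynomial.pderiv φ (algebraMap ℂ (Fock s) r) = 0 := Derivation.map_algebraMap _ _
    rw [this]
    exact zero_mem _
  | add x y _ _ hx hy => rw [map_add]; exact add_mem hx hy
  | mul x y hx hy hx' hy' =>
    rw [Derivation.leibniz]
    exact add_mem (mul_mem hx hy') (mul_mem hy hx')

/-- `Φ ↦ (a*(ψ₁)⋯a*(ψₙ)Ω, Φ)`. -/
def annihSeq (m : ℝ) (l : List (Wave s)) (Φ : Fock s) : ℂ :=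
  MvPolynomial.constantCoeff (l.foldr (fun ψ Θ => annih (waveInner m ψ) Θ) Φ)

lemma annihSeq_add (m : ℝ) (l : List (Wave s)) (Φ Φ' : Fock s) :
    annihSeq m l (Φ + Φ') = annihSeq m l Φ + annihSeq m l Φ' := by
  unfold annihSeq
  rw [← map_add]
  congr 1
  induction l with
  | nil => rfl
  | cons a l ih => simp only [List.foldr_cons, ih, annih_add]

lemma annihSeq_smul (m : ℝ) (l : List (Wave s)) (c : ℂ) (Φ : Fock s) :
    annihSeq m l (c • Φ) = c * annihSeq m l Φ := by
  unfold annihSeq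
  have : l.foldr (fun ψ Θ => annih (waveInner m ψ) Θ) (c • Φ)
      = c • l.foldr (fun ψ Θ => annih (waveInner m ψ) Θ) Φ := by
    induction l with
    | nil => rfl
    | cons a l ih => simp only [List.foldr_cons, ih, annih_smul]
  rw [this, MvPolynomial.smul_eq_C_mul, map_mul, MvPolynomial.constantCoeff_C]

lemma annihSeq_perm (m : ℝ) {l l' : List (Wave s)} (h : l.Perm l') (Φ : Fock s) :
    annihSeq m l Φ = annihSeq m l' Φ := by
  unfold annihSeq
  congr 1
  have : LeftCommutative (fun (ψ : Wave s) (Θ : Fock s) => annih (waveInner m ψ) Θ) :=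
    ⟨fun a b c => annih_comm _ _ _⟩
  exact h.foldr_eq _

lemma fockInner_eq_sum_of_subset (m : ℝ) (Ψ Φ : Fock s) (T : Finset (Wave s →₀ ℕ))
    (hT : Ψ.support ⊆ T) :
    fockInner m Ψ Φ
      = ∑ n ∈ T, conj (Ψ.coeff n) * annihSeq m (Finsupp.toMultiset n).toList Φ := by
  refine Finset.sum_subset hT fun n _ hn => ?_
  rw [MvPolynomial.notMem_support_iff.1 hn, map_zero, zero_mul]

lemma fockInner_add_left (m : ℝ) (Ψ Ψ' Φ : Fock s) :
    fockInner m (Ψ + Ψ') Φ = fockInner m Ψ Φ + fockInner m Ψ' Φ := by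
  classical
  rw [fockInner_eq_sum_of_subset m (Ψ + Ψ') Φ (Ψ.support ∪ Ψ'.support) MvPolynomial.support_add,
    fockInner_eq_sum_of_subset m Ψ Φ (Ψ.support ∪ Ψ'.support) Finset.subset_union_left,
    fockInner_eq_sum_of_subset m Ψ' Φ (Ψ.support ∪ Ψ'.support) Finset.subset_union_right,
    ← Finset.sum_add_distrib]
  simp [add_mul]

lemma fockInner_smul_left (m : ℝ) (c : ℂ) (Ψ Φ : Fock s) :
    fockInner m (c • Ψ) Φ = conj c * fockInner m Ψ Φ := by
  rw [fockInner_eq_sum_of_subset m (c • Ψ) Φ Ψ.support MvPolynomial.support_smul,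
    fockInner_eq_sum_of_subset m Ψ Φ Ψ.support subset_rfl, Finset.mul_sum]
  simp [mul_assoc]

lemma fockInner_zero_left (m : ℝ) (Φ : Fock s) : fockInner m 0 Φ = 0 := by
  simp [fockInner]

lemma fockInner_add_right (m : ℝ) (Ψ Φ Φ' : Fock s) :
    fockInner m Ψ (Φ + Φ') = fockInner m Ψ Φ + fockInner m Ψ Φ' := by
  simp only [fockInner_eq_sum_of_subset m Ψ _ Ψ.support subset_rfl, annihSeq_add, mul_add,
    Finset.sum_add_distrib]

lemma fockInner_smul_right (m : ℝ) (c : ℂ) (Ψ Φ : Fock s) :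
    fockInner m Ψ (c • Φ) = c * fockInner m Ψ Φ := by
  simp only [fockInner_eq_sum_of_subset m Ψ _ Ψ.support subset_rfl, annihSeq_smul,
    Finset.mul_sum]
  exact Finset.sum_congr rfl fun _ _ => by ring

lemma fockInner_zero_right (m : ℝ) (Ψ : Fock s) : fockInner m Ψ 0 = 0 := by
  simpa using fockInner_smul_right m 0 Ψ 0

lemma fockInner_sum_left {ι : Type*} (m : ℝ) (S : Finset ι) (Ψ : ι → Fock s) (Φ : Fock s) :
    fockInner m (∑ i ∈ S, Ψ i) Φ = ∑ i ∈ S, fockInner m (Ψ i) Φ := by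
  classical
  induction S using Finset.induction_on with
  | empty => simp [fockInner_zero_left]
  | insert a S ha ih => rw [Finset.sum_insert ha, Finset.sum_insert ha, fockInner_add_left, ih]

lemma fockInner_sum_right {ι : Type*} (m : ℝ) (S : Finset ι) (Ψ : Fock s) (Φ : ι → Fock s) :
    fockInner m Ψ (∑ i ∈ S, Φ i) = ∑ i ∈ S, fockInner m Ψ (Φ i) := by
  classical
  induction S using Finset.induction_on with
  | empty => simp [fockInner_zero_right]
  | insert a S ha ih => rw [Finset.sum_insert ha, Finset.sum_insert ha, fockInner_add_right, ih]

lemma fockInner_monomial (m : ℝ) (n : Wave s →₀ ℕ) (c : ℂ) (Φ : Fock s) :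
    fockInner m (MvPolynomial.monomial n c) Φ
      = conj c * annihSeq m (Finsupp.toMultiset n).toList Φ := by
  classical
  rw [fockInner_eq_sum_of_subset m _ Φ {n} MvPolynomial.support_monomial_subset]
  simp

lemma fockInner_mul_X (m : ℝ) (Ψ Φ : Fock s) (ψ : Wave s) :
    fockInner m (Ψ * MvPolynomial.X ψ) Φ = fockInner m Ψ (annih (waveInner m ψ) Φ) := by
  induction Ψ using MvPolynomial.induction_on' with
  | monomial n c =>
    rw [MvPolynomial.X, MvPolynomial.monomial_mul, mul_one, fockInner_monomial,
      fockInner_monomial]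
    congr 1
    -- The new factor may be placed last in the list, so that its annihilation operator is the first
    -- to act on Φ. The order chosen by `toList` is irrelevant since annihilation operators commute.
    have hp : (Finsupp.toMultiset (n + Finsupp.single ψ 1)).toList.Perm
        ((Finsupp.toMultiset n).toList ++ [ψ]) := by
      rw [← Multiset.coe_eq_coe, Multiset.coe_toList, ← Multiset.coe_add, Multiset.coe_toList]
      simp
    rw [annihSeq_perm m hp]
    simp [annihSeq, List.foldr_append]
  | add p q hp hq => rw [add_mul, fockInner_add_left, hp, hq, fockInner_add_left]

/-- Creation operators are adjoint to annihilation operators. -/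
lemma fockInner_X_mul (m : ℝ) (Ψ Φ : Fock s) (χ : Wave s) :
    fockInner m Ψ (MvPolynomial.X χ * Φ)
      = fockInner m (annih (fun ψ => conj (waveInner m ψ χ)) Ψ) Φ := by
  induction Ψ using MvPolynomial.induction_on generalizing Φ with
  | C a =>
    rw [annih_C, fockInner_zero_left, ← MvPolynomial.monomial_zero', fockInner_monomial]
    simp [annihSeq]
  | add p q hp hq => rw [fockInner_add_left, annih_add, fockInner_add_left, hp, hq]
  | mul_X p ψ hp =>
    rw [fockInner_mul_X, annih_mul, annih_X, annih_mul, annih_X, fockInner_add_right,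
      fockInner_add_left, hp, mul_comm Φ, mul_comm p (MvPolynomial.C _),
      ← MvPolynomial.smul_eq_C_mul, ← MvPolynomial.smul_eq_C_mul, fockInner_smul_right,
      fockInner_smul_left, mul_comm (MvPolynomial.X ψ), fockInner_mul_X]
    simp [add_comm]

-- The created particle K φ is moved to the left vector by adjointness. This is the normal form
-- against which the integrated Wick products are compared: one-particle matrix elements, weighted
-- by (∂_ψ Ψ, ∂_φ Φ).
open Classical in
lemma fockInner_dGamma (m : ℝ) (K : Wave s → Wave s) (S : Finset (Wave s)) (Ψ Φ : Fock s)
    (hΨ : Ψ ∈ MvPolynomial.supported ℂ (S : Set (Wave s)))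
    (hΦ : Φ ∈ MvPolynomial.supported ℂ (S : Set (Wave s))) :
    fockInner m Ψ (dGamma K Φ) = ∑ ψ ∈ S, ∑ φ ∈ S, waveInner m ψ (K φ) *
      fockInner m (MvPolynomial.pderiv ψ Ψ) (MvPolynomial.pderiv φ Φ) := by
  rw [dGamma_eq_sum K S Φ hΦ, fockInner_sum_right, Finset.sum_comm]
  refine Finset.sum_congr rfl fun φ _ => ?_
  rw [fockInner_X_mul, annih_eq_sum _ S Ψ hΨ, fockInner_sum_left]
  simp [fockInner_smul_left]

/-- Coefficients of a Wick product: matrix elements with two, one and no annihilated particles in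
the right vector. -/
lemma wick_eq_sum (m : ℝ) (α β : Wave s → ℂ) (S : Finset (Wave s)) (Ψ Φ : Fock s)
    (hΨ : Ψ ∈ MvPolynomial.supported ℂ (S : Set (Wave s)))
    (hΦ : Φ ∈ MvPolynomial.supported ℂ (S : Set (Wave s))) :
    wick m α β Ψ Φ = ∑ ψ ∈ S, ∑ φ ∈ S,
      (α ψ * β φ * fockInner m Ψ (MvPolynomial.pderiv ψ (MvPolynomial.pderiv φ Φ))
      + (conj (α ψ) * β φ + conj (β ψ) * α φ) *
        fockInner m (MvPolynomial.pderiv ψ Ψ) (MvPolynomial.pderiv φ Φ)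
      + conj (α ψ * β φ) * fockInner m (MvPolynomial.pderiv ψ (MvPolynomial.pderiv φ Ψ)) Φ) := by
  classical
  have two : ∀ Θ : Fock s, Θ ∈ MvPolynomial.supported ℂ (S : Set (Wave s)) →
      annih α (annih β Θ) = ∑ ψ ∈ S, ∑ φ ∈ S,
        (α ψ * β φ) • MvPolynomial.pderiv ψ (MvPolynomial.pderiv φ Θ) := by
    intro Θ hΘ
    rw [annih_eq_sum β S Θ hΘ, annih_sum, Finset.sum_comm]
    refine Finset.sum_congr rfl fun φ _ => ?_
    rw [annih_smul, annih_eq_sum α S _ (pderiv_mem_supported _ _ _ hΘ), Finset.smul_sum]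
    exact Finset.sum_congr rfl fun ψ _ => by rw [smul_smul, mul_comm]
  have mixed : ∀ γ δ : Wave s → ℂ, fockInner m (annih γ Ψ) (annih δ Φ)
      = ∑ ψ ∈ S, ∑ φ ∈ S, conj (γ ψ) * δ φ *
        fockInner m (MvPolynomial.pderiv ψ Ψ) (MvPolynomial.pderiv φ Φ) := by
    intro γ δ
    rw [annih_eq_sum γ S Ψ hΨ, annih_eq_sum δ S Φ hΦ, fockInner_sum_left]
    refine Finset.sum_congr rfl fun ψ _ => ?_
    rw [fockInner_sum_right]
    refine Finset.sum_congr rfl fun φ _ => ?_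
    rw [fockInner_smul_left, fockInner_smul_right, mul_assoc]
  rw [wick, two Φ hΦ, two Ψ hΨ, mixed, mixed]
  simp only [fockInner_sum_left, fockInner_sum_right, fockInner_smul_left, fockInner_smul_right,
    ← Finset.sum_add_distrib]
  refine Finset.sum_congr rfl fun ψ _ => Finset.sum_congr rfl fun φ _ => ?_
  ring

lemma wick_comm (m : ℝ) (α β : Wave s → ℂ) (Ψ Φ : Fock s) :
    wick m α β Ψ Φ = wick m β α Ψ Φ := by
  rw [wick, wick, annih_comm α β Φ, annih_comm α β Ψ]
  ring

end FockSpace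

/-! ### Smooth amplitudes on the mass shell -/

/-- Smooth compactly supported amplitudes, supported where the energy is smooth. -/
structure IsAmp (m : ℝ) (a : E3 → ℂ) : Prop where
  smooth : ContDiff ℝ ∞ a
  compact : HasCompactSupport a
  omega_ne : ∀ p ∈ tsupport a, omega m p ≠ 0

/-- The unit vectors `∂/∂p^σ` in `ℝ³`; `∂/∂p^0` is absent. -/
def dirVec (σ : Fin 4) : E3 :=
  Fin.cases (motive := fun _ => E3) 0 (fun i => EuclideanSpace.single i 1) σ

/-- `∂/∂p^σ` in the coordinates `p ∈ ℝ³` of the mass shell. -/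
def shellDeriv {F : Type*} [NormedAddCommGroup F] [NormedSpace ℝ F] (σ : Fin 4) (f : E3 → F)
    (p : E3) : F := lineDeriv ℝ f p (dirVec σ)

@[simp] lemma dirVec_zero : dirVec 0 = 0 := rfl

@[simp] lemma dirVec_succ (i : Fin 3) : dirVec i.succ = EuclideanSpace.single i 1 := rfl

lemma momDeriv_eq_shellDeriv {s : ℕ} (σ : Fin 4) (ψ : Wave s) (p : E3) (I : Fin s → Fin 3) :
    momDeriv σ ψ p I = shellDeriv σ (fun q => ψ q I) p := by
  cases σ using Fin.cases with
  | zero => simp [momDeriv, shellDeriv, lineDeriv_zero]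
  | succ i => simp [momDeriv, shellDeriv]

section ShellDeriv

variable {f : E3 → ℂ} {p : E3} (σ : Fin 4)

lemma shellDeriv_eq_fderiv {F : Type*} [NormedAddCommGroup F] [NormedSpace ℝ F] {f : E3 → F}
    (hf : DifferentiableAt ℝ f p) : shellDeriv σ f p = fderiv ℝ f p (dirVec σ) :=
  hf.lineDeriv_eq_fderiv

lemma shellDeriv_mul {A : Type*} [NormedCommRing A] [NormedAlgebra ℝ A] {f g : E3 → A}
    (hf : DifferentiableAt ℝ f p) (hg : DifferentiableAt ℝ g p) :
    shellDeriv σ (fun q => f q * g q) p = f p * shellDeriv σ g p + shellDeriv σ f p * g p := by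
  rw [shellDeriv_eq_fderiv σ (hf.fun_mul hg), shellDeriv_eq_fderiv σ hf, shellDeriv_eq_fderiv σ hg,
    fderiv_fun_mul hf hg]
  simp [mul_comm]

lemma shellDeriv_sum {F : Type*} [NormedAddCommGroup F] [NormedSpace ℝ F] {ι : Type*}
    (S : Finset ι) {f : ι → E3 → F}
    (hf : ∀ i ∈ S, DifferentiableAt ℝ (f i) p) :
    shellDeriv σ (fun q => ∑ i ∈ S, f i q) p = ∑ i ∈ S, shellDeriv σ (f i) p := by
  rw [shellDeriv_eq_fderiv σ (DifferentiableAt.fun_sum hf), fderiv_fun_sum hf,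
    _root_.sum_apply]
  exact Finset.sum_congr rfl fun i hi => (shellDeriv_eq_fderiv σ (hf i hi)).symm

lemma shellDeriv_const_mul (c : ℂ) (hf : DifferentiableAt ℝ f p) :
    shellDeriv σ (fun q => c * f q) p = c * shellDeriv σ f p := by
  rw [shellDeriv_eq_fderiv σ (hf.const_mul c), shellDeriv_eq_fderiv σ hf, fderiv_const_mul hf]
  rfl

lemma shellDeriv_ofReal {h : E3 → ℝ} (hh : DifferentiableAt ℝ h p) :
    shellDeriv σ (fun q => (h q : ℂ)) p = ((shellDeriv σ h p : ℝ) : ℂ) := by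
  have h1 : HasFDerivAt (fun q => (h q : ℂ)) (Complex.ofRealCLM.comp (fderiv ℝ h p)) p :=
    Complex.ofRealCLM.hasFDerivAt.comp p hh.hasFDerivAt
  rw [shellDeriv_eq_fderiv σ h1.differentiableAt, shellDeriv_eq_fderiv σ hh, h1.fderiv]
  rfl

lemma shellDeriv_congr {F : Type*} [NormedAddCommGroup F] [NormedSpace ℝ F] {f g : E3 → F}
    (h : f =ᶠ[𝓝 p] g) : shellDeriv σ f p = shellDeriv σ g p := h.lineDeriv_eq

lemma shellDeriv_of_notMem_tsupport {f : E3 → ℂ} (h : p ∉ tsupport f) :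
    shellDeriv σ f p = 0 := by
  have h0 : f =ᶠ[𝓝 p] fun _ => (0 : ℂ) := notMem_tsupport_iff_eventuallyEq.1 h
  rw [shellDeriv_congr σ h0, shellDeriv_eq_fderiv σ (differentiableAt_const _)]
  simp

end ShellDeriv

lemma contDiff_of_contDiffAt_tsupport {F : Type*} [NormedAddCommGroup F] [NormedSpace ℝ F]
    {f : E3 → F} (h : ∀ p ∈ tsupport f, ContDiffAt ℝ ∞ f p) : ContDiff ℝ ∞ f := by
  rw [contDiff_iff_contDiffAt]
  intro p
  by_cases hp : p ∈ tsupport f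
  · exact h p hp
  · have h0 : f =ᶠ[𝓝 p] fun _ => (0 : F) := notMem_tsupport_iff_eventuallyEq.1 hp
    exact contDiffAt_const.congr_of_eventuallyEq h0

namespace IsAmp

variable {m : ℝ} {a b : E3 → ℂ}

lemma zero : IsAmp m (fun _ => 0) where
  smooth := contDiff_const
  compact := HasCompactSupport.zero
  omega_ne := fun p hp => by
    have : tsupport (fun _ : E3 => (0 : ℂ)) = ∅ := tsupport_eq_empty_iff.2 rfl
    simp [this] at hp

lemma mul (ha : IsAmp m a) {f : E3 → ℂ} (hf : ∀ p ∈ tsupport a, ContDiffAt ℝ ∞ f p) :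
    IsAmp m (fun p => f p * a p) where
  smooth := contDiff_of_contDiffAt_tsupport fun p hp =>
    (hf p (tsupport_mul_subset_right hp)).mul ha.smooth.contDiffAt
  compact := ha.compact.mul_left
  omega_ne := fun p hp => ha.omega_ne p (tsupport_mul_subset_right hp)

lemma const_mul (ha : IsAmp m a) (c : ℂ) : IsAmp m (fun p => c * a p) :=
  ha.mul fun _ _ => contDiffAt_const

lemma add (ha : IsAmp m a) (hb : IsAmp m b) : IsAmp m (fun p => a p + b p) where
  smooth := ha.smooth.add hb.smooth
  compact := ha.compact.add hb.compact
  omega_ne := fun p hp => by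
    rcases tsupport_add a b hp with h | h
    · exact ha.omega_ne p h
    · exact hb.omega_ne p h

lemma sum {ι : Type*} (S : Finset ι) {f : ι → E3 → ℂ} (h : ∀ i ∈ S, IsAmp m (f i)) :
    IsAmp m (fun p => ∑ i ∈ S, f i p) := by
  classical
  induction S using Finset.induction_on with
  | empty => simpa using zero
  | insert i S hi ih =>
    simp only [Finset.sum_insert hi]
    exact (h i (Finset.mem_insert_self _ _)).add
      (ih fun j hj => h j (Finset.mem_insert_of_mem hj))

lemma shellDeriv (ha : IsAmp m a) (σ : Fin 4) : IsAmp m (shellDeriv σ a) := by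
  have h : StringQFT.shellDeriv σ a = fun p => fderiv ℝ a p (dirVec σ) :=
    funext fun p => shellDeriv_eq_fderiv σ (ha.smooth.differentiable (by simp) p)
  have hs : tsupport (fun p => fderiv ℝ a p (dirVec σ)) ⊆ tsupport a := by
    refine closure_minimal (fun p hp => ?_) isClosed_closure
    refine support_fderiv_subset ℝ fun h0 => hp ?_
    change fderiv ℝ a p (dirVec σ) = 0
    rw [h0]
    rfl
  rw [h]
  exact ⟨(ha.smooth.fderiv_right (m := ∞) (by simp)).clm_apply contDiff_const,
    ha.compact.fderiv_apply ℝ _, fun p hp => ha.omega_ne p (hs hp)⟩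

lemma conj_amp (ha : IsAmp m a) : IsAmp m (fun p => conj (a p)) where
  smooth := Complex.conjCLE.contDiff.comp ha.smooth
  compact := ha.compact.comp_left (g := fun z : ℂ => starRingEnd ℂ z) (map_zero _)
  omega_ne := fun p hp => ha.omega_ne p (closure_mono (fun q hq => by
    simp only [Function.mem_support, ne_eq, map_eq_zero] at hq ⊢
    exact hq) hp)

lemma differentiableAt (ha : IsAmp m a) (p : E3) : DifferentiableAt ℝ a p :=
  ha.smooth.differentiable (by simp) p

end IsAmp

/-! ### Smooth functions of the momentum -/

lemma omega_nonneg (m : ℝ) (p : E3) : 0 ≤ omega m p := Real.sqrt_nonneg _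

lemma omega_sq (m : ℝ) (p : E3) : omega m p ^ 2 = ‖p‖ ^ 2 + m ^ 2 :=
  Real.sq_sqrt (by positivity)

lemma omega_pos_of_ne {m : ℝ} {p : E3} (h : omega m p ≠ 0) : 0 < omega m p :=
  lt_of_le_of_ne (omega_nonneg m p) h.symm

lemma omega_neg (m : ℝ) (p : E3) : omega m (-p) = omega m p := by simp [omega]

lemma norm_sq_eq_sum (p : E3) : ‖p‖ ^ 2 = ∑ i, p i ^ 2 := by
  rw [EuclideanSpace.norm_sq_eq]
  simp

@[simp] lemma onShell_zero (m : ℝ) (p : E3) : onShell m p 0 = omega m p := rfl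

@[simp] lemma onShell_succ (m : ℝ) (p : E3) (i : Fin 3) : onShell m p i.succ = p i := rfl

@[simp] lemma eta_zero : eta 0 = 1 := rfl

@[simp] lemma eta_succ (i : Fin 3) : eta i.succ = -1 := by simp [eta]

lemma eta_mul_self (μ : Fin 4) : eta μ * eta μ = 1 := by
  unfold eta
  split_ifs <;> norm_num

section Smoothness

variable {m : ℝ} {p : E3}

lemma omega_sq_ne (h : omega m p ≠ 0) : ‖p‖ ^ 2 + m ^ 2 ≠ 0 := by
  rw [← omega_sq]
  exact pow_ne_zero 2 h

lemma contDiffAt_omega (h : omega m p ≠ 0) : ContDiffAt ℝ ∞ (omega m) p :=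
  ContDiffAt.sqrt (((contDiff_norm_sq ℝ).add contDiff_const).contDiffAt) (omega_sq_ne h)

lemma contDiff_coord (i : Fin 3) : ContDiff ℝ ∞ (fun p : E3 => p i) :=
  (EuclideanSpace.proj i : E3 →L[ℝ] ℝ).contDiff

lemma contDiffAt_onShell (h : omega m p ≠ 0) (μ : Fin 4) :
    ContDiffAt ℝ ∞ (fun q => onShell m q μ) p := by
  cases μ using Fin.cases with
  | zero => exact contDiffAt_omega h
  | succ i => exact (contDiff_coord i).contDiffAt

lemma contDiffAt_lowMom (h : omega m p ≠ 0) (μ : Fin 4) :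
    ContDiffAt ℝ ∞ (lowMom m μ) p :=
  contDiffAt_const.mul (contDiffAt_onShell h μ)

lemma contDiffAt_shellDensity (h : omega m p ≠ 0) : ContDiffAt ℝ ∞ (shellDensity m) p := by
  refine contDiffAt_const.div (contDiffAt_const.mul (contDiffAt_const.mul (contDiffAt_omega h))) ?_
  positivity

lemma contDiffAt_mdot_onShell (h : omega m p ≠ 0) (x : M4) :
    ContDiffAt ℝ ∞ (fun q => mdot (onShell m q) x) p := by
  unfold mdot
  exact ContDiffAt.sum fun μ _ =>
    (contDiffAt_const.mul (contDiffAt_onShell h μ)).mul contDiffAt_const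

lemma contDiffAt_ofReal {f : E3 → ℝ} (h : ContDiffAt ℝ ∞ f p) :
    ContDiffAt ℝ ∞ (fun q => (f q : ℂ)) p :=
  Complex.ofRealCLM.contDiff.contDiffAt.comp p h

lemma contDiffAt_cexp {f : E3 → ℂ} (h : ContDiffAt ℝ ∞ f p) :
    ContDiffAt ℝ ∞ (fun q => Complex.exp (f q)) p := h.cexp

end Smoothness

/-! ### Free fields with a given amplitude -/

/-- The field `∫ dμ_m(p) e^{-ipx} a(p)`. -/
def field (m : ℝ) (a : E3 → ℂ) (x : M4) : ℂ :=
  ∫ p : E3, (shellDensity m p : ℂ) * Complex.exp (-Complex.I * (mdot (onShell m p) x : ℂ)) * a p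

/-- The plane wave `e^{-ipx}`. -/
def planeWave (m : ℝ) (x : M4) (p : E3) : ℂ :=
  Complex.exp (-Complex.I * (mdot (onShell m p) x : ℂ))

lemma norm_planeWave (m : ℝ) (x : M4) (p : E3) : ‖planeWave m x p‖ = 1 := by
  rw [planeWave, Complex.norm_exp]
  simp

lemma field_eq (m : ℝ) (a : E3 → ℂ) (x : M4) :
    field m a x = ∫ p : E3, (shellDensity m p : ℂ) * planeWave m x p * a p := rfl

lemma contDiffAt_planeWave {m : ℝ} {p : E3} (h : omega m p ≠ 0) (x : M4) :
    ContDiffAt ℝ ∞ (planeWave m x) p :=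
  contDiffAt_cexp (contDiffAt_const.mul (contDiffAt_ofReal (contDiffAt_mdot_onShell h x)))

namespace IsAmp

variable {m : ℝ} {a b : E3 → ℂ}

lemma mul_density (ha : IsAmp m a) : IsAmp m (fun p => (shellDensity m p : ℂ) * a p) :=
  ha.mul fun p hp => contDiffAt_ofReal (contDiffAt_shellDensity (ha.omega_ne p hp))

lemma mul_planeWave (ha : IsAmp m a) (x : M4) : IsAmp m (fun p => planeWave m x p * a p) :=
  ha.mul fun p hp => contDiffAt_planeWave (ha.omega_ne p hp) x

lemma mul_lowMom (ha : IsAmp m a) (μ : Fin 4) :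
    IsAmp m (fun p => -Complex.I * (lowMom m μ p : ℂ) * a p) :=
  ha.mul fun p hp => contDiffAt_const.mul
    (contDiffAt_ofReal (contDiffAt_lowMom (ha.omega_ne p hp) μ))

lemma integrable (ha : IsAmp m a) : Integrable a :=
  ha.smooth.continuous.integrable_of_hasCompactSupport ha.compact

lemma integrable_field (ha : IsAmp m a) (x : M4) :
    Integrable (fun p => (shellDensity m p : ℂ) * planeWave m x p * a p) := by
  simpa only [mul_assoc] using (ha.mul_planeWave x).mul_density.integrable

end IsAmp

lemma field_sum {ι : Type*} (m : ℝ) (S : Finset ι) {f : ι → E3 → ℂ}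
    (h : ∀ i ∈ S, IsAmp m (f i)) (x : M4) :
    field m (fun p => ∑ i ∈ S, f i p) x = ∑ i ∈ S, field m (f i) x := by
  simp only [field_eq, Finset.mul_sum]
  exact integral_finsetSum _ fun i hi => (h i hi).integrable_field x

lemma field_const_mul (m : ℝ) (c : ℂ) (a : E3 → ℂ) (x : M4) :
    field m (fun p => c * a p) x = c * field m a x := by
  simp only [field_eq, ← integral_const_mul]
  exact integral_congr_ae (Eventually.of_forall fun p => by ring)

lemma mdot_add_smul_single (m : ℝ) (p : E3) (x : M4) (t : ℝ) (μ : Fin 4) :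
    mdot (onShell m p) (x + t • Pi.single μ 1) = mdot (onShell m p) x + t * lowMom m μ p := by
  simp only [mdot, lowMom, Pi.add_apply, Pi.smul_apply, smul_eq_mul, mul_add,
    Finset.sum_add_distrib]
  congr 1
  rw [Finset.sum_eq_single μ]
  · simp
    ring
  · intro ν _ hν
    simp [hν]
  · simp

lemma hasDerivAt_planeWave (m : ℝ) (x : M4) (μ : Fin 4) (p : E3) (t : ℝ) :
    HasDerivAt (fun t : ℝ => planeWave m (x + t • Pi.single μ 1) p)
      (planeWave m (x + t • Pi.single μ 1) p * (-Complex.I * (lowMom m μ p : ℂ))) t := by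
  have h2 : HasDerivAt (fun t : ℝ => mdot (onShell m p) (x + t • Pi.single μ 1))
      (lowMom m μ p) t := by
    simp only [mdot_add_smul_single]
    simpa using ((hasDerivAt_id t).mul_const (lowMom m μ p)).const_add (mdot (onShell m p) x)
  exact (h2.ofReal_comp.const_mul (-Complex.I)).cexp

/-- Differentiation under the integral: plane waves have modulus one, so the differentiated
integrand is dominated uniformly along the line by an integrable amplitude. -/
lemma pd_field {m : ℝ} {a : E3 → ℂ} (ha : IsAmp m a) (μ : Fin 4) :
    pd μ (field m a) = field m (fun p => -Complex.I * (lowMom m μ p : ℂ) * a p) := by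
  funext x
  let F : ℝ → E3 → ℂ := fun t p =>
    (shellDensity m p : ℂ) * planeWave m (x + t • Pi.single μ 1) p * a p
  let F' : ℝ → E3 → ℂ := fun t p =>
    (shellDensity m p : ℂ) * planeWave m (x + t • Pi.single μ 1) p *
      (-Complex.I * (lowMom m μ p : ℂ) * a p)
  have hF : ∀ t, Integrable (F t) := fun t => ha.integrable_field _
  have hF' : ∀ t, Integrable (F' t) := fun t => (ha.mul_lowMom μ).integrable_field _
  have hb : ∀ p t, ‖F' t p‖
      ≤ ‖(shellDensity m p : ℂ) * (-Complex.I * (lowMom m μ p : ℂ) * a p)‖ := fun p t => by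
    simp only [F']
    rw [norm_mul, norm_mul, norm_planeWave, mul_one, norm_mul (shellDensity m p : ℂ)]
  have hd : ∀ p t, HasDerivAt (F · p) (F' t p) t := fun p t => by
    have h3 := ((hasDerivAt_planeWave m x μ p t).const_mul (shellDensity m p : ℂ)).mul_const (a p)
    have e : F' t p = (shellDensity m p : ℂ) * (planeWave m (x + t • Pi.single μ 1) p *
        (-Complex.I * (lowMom m μ p : ℂ))) * a p := by
      simp only [F']
      ring
    rw [e]
    exact h3
  have key := hasDerivAt_integral_of_dominated_loc_of_deriv_le (x₀ := (0 : ℝ)) univ_mem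
    (Eventually.of_forall fun t => (hF t).aestronglyMeasurable) (hF 0)
    (hF' 0).aestronglyMeasurable (Eventually.of_forall fun p t _ => hb p t)
    (ha.mul_lowMom μ).mul_density.integrable.norm (Eventually.of_forall fun p t _ => hd p t)
  have h0 := key.2.deriv
  simp only [F', zero_smul, add_zero] at h0
  exact h0

lemma pd_conj (f : M4 → ℂ) (μ : Fin 4) :
    pd μ (fun x => conj (f x)) = fun x => conj (pd μ f x) := by
  funext x
  simp only [pd, lineDeriv]
  exact deriv.star

/-! ### Spatial integrals of products of fields -/

section Pairing

open scoped FourierTransform LineDeriv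

lemma schwartz_integrable_conj_mul (f g : SchwartzMap E3 ℂ) :
    Integrable (fun x => conj (f x) * g x) := by
  have h1 : MemLp (fun x => conj (f x)) 2 (volume : Measure E3) := by
    exact (f.memLp 2 volume).star
  exact h1.integrable_mul (g.memLp 2)

lemma fourierInv_pairing (f g : SchwartzMap E3 ℂ) :
    ∫ x : E3, conj ((𝓕⁻ f) x) * (𝓕⁻ g) x = ∫ p : E3, conj (f p) * g p := by
  have h := SchwartzMap.integral_inner_fourier_fourier (𝓕⁻ f) (𝓕⁻ g)
  simp only [FourierTransform.fourier_fourierInv_eq, RCLike.inner_apply] at h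
  simpa only [mul_comm] using h.symm

/-- Amplitude of the field at a given time as a function on `ℝ³`. -/
def slice (m t : ℝ) (a : E3 → ℂ) (p : E3) : ℂ :=
  Complex.exp (-Complex.I * (t * omega m p : ℝ)) * ((shellDensity m p : ℂ) * a p)

variable {m : ℝ} {a b : E3 → ℂ}

lemma IsAmp.slice (ha : IsAmp m a) (t : ℝ) : IsAmp m (slice m t a) :=
  ha.mul_density.mul fun p hp => contDiffAt_cexp (contDiffAt_const.mul (contDiffAt_ofReal
    (contDiffAt_const.mul (contDiffAt_omega (ha.mul_density.omega_ne p hp)))))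

/-- A smooth amplitude as a Schwartz function. -/
def IsAmp.schwartz (ha : IsAmp m a) : SchwartzMap E3 ℂ := ha.compact.toSchwartzMap ha.smooth

@[simp] lemma IsAmp.schwartz_apply (ha : IsAmp m a) (p : E3) : ha.schwartz p = a p := rfl

lemma mdot_onShell_fourVec (m t : ℝ) (p x : E3) :
    mdot (onShell m p) (fourVec t x) = omega m p * t - inner ℝ p x := by
  rw [mdot, Fin.sum_univ_succ]
  simp only [onShell_zero, onShell_succ, eta_zero, eta_succ, fourVec, Fin.cons_zero,
    Fin.cons_succ, PiLp.inner_apply]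
  simp [Finset.sum_neg_distrib, sub_eq_add_neg, mul_comm]

/-- The time-dependent phase and the measure are absorbed into the amplitude. The rescaling by
(2π)⁻¹ converts the phase e^{ipx} to the convention e^{2πi⟨p,ξ⟩}. -/
lemma field_fourVec (ha : IsAmp m a) (t : ℝ) (x : E3) :
    field m a (fourVec t x) = (𝓕⁻ (ha.slice t).schwartz) ((2 * π)⁻¹ • x) := by
  rw [SchwartzMap.fourierInv_coe, Real.fourierInv_eq', field_eq]
  congr 1
  funext p
  simp only [IsAmp.schwartz_apply, StringQFT.slice, planeWave, mdot_onShell_fourVec, smul_eq_mul,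
    inner_smul_right]
  have e : 2 * π * ((2 * π)⁻¹ * inner ℝ p x) = inner ℝ p x := by
    field_simp
  rw [e, ← mul_assoc (Complex.exp _) (Complex.exp _), ← Complex.exp_add, mul_comm (Complex.ofReal _)
    (Complex.exp _), mul_assoc]
  congr 2
  push_cast
  ring

/-- A product of two fields carries the density twice, and the rescaling of position contributes the
Jacobian (2π)³. One invariant density and a factor 1/(2ω) remain. At ω = 0 both sides vanish, since
division by zero gives zero. -/
lemma two_pi_cube_mul_density_sq (m : ℝ) (p : E3) :
    (2 * π) ^ 3 * (shellDensity m p * shellDensity m p) = shellDensity m p / (2 * omega m p) := by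
  unfold shellDensity
  by_cases h : omega m p = 0
  · simp [h]
  · have := Real.pi_ne_zero
    field_simp

lemma integrable_conj_field_mul_field (ha : IsAmp m a) (hb : IsAmp m b) (t : ℝ) :
    Integrable (fun x : E3 => conj (field m a (fourVec t x)) * field m b (fourVec t x)) := by
  simp only [field_fourVec ha, field_fourVec hb]
  exact (schwartz_integrable_conj_mul (𝓕⁻ (ha.slice t).schwartz)
    (𝓕⁻ (hb.slice t).schwartz)).comp_smul (R := (2 * π)⁻¹) (by positivity)

lemma conj_exp_mul_exp (u : ℝ) :
    conj (Complex.exp (-Complex.I * (u : ℂ))) * Complex.exp (-Complex.I * (u : ℂ)) = 1 := by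
  rw [← Complex.exp_conj, ← Complex.exp_add]
  simp

/-- Equal-time pairing of the negative frequency part of one field with another field. -/
lemma integral_conj_field_mul_field (ha : IsAmp m a) (hb : IsAmp m b) (t : ℝ) :
    ∫ x : E3, conj (field m a (fourVec t x)) * field m b (fourVec t x)
      = ∫ p : E3, ((shellDensity m p / (2 * omega m p) : ℝ) : ℂ) * (conj (a p) * b p) := by
  simp only [field_fourVec ha, field_fourVec hb]
  refine (Measure.integral_comp_smul (volume : Measure E3)
    (fun ξ => conj ((𝓕⁻ (ha.slice t).schwartz) ξ) * (𝓕⁻ (hb.slice t).schwartz) ξ)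
    (2 * π)⁻¹).trans ?_
  rw [fourierInv_pairing, ← integral_smul]
  congr 1
  funext p
  have h3 : |(((2 * π)⁻¹ : ℝ) ^ Module.finrank ℝ E3)⁻¹| = (2 * π) ^ 3 := by
    rw [finrank_euclideanSpace_fin, inv_pow, inv_inv, abs_of_pos (by positivity)]
  rw [h3, IsAmp.schwartz_apply, IsAmp.schwartz_apply, ← two_pi_cube_mul_density_sq]
  simp only [StringQFT.slice, map_mul, Complex.conj_ofReal, Complex.real_smul]
  have h1 := conj_exp_mul_exp (t * omega m p)
  push_cast at h1 ⊢
  linear_combination ((2 * (π : ℂ)) ^ 3 * (shellDensity m p) ^ 2 * conj (a p) * b p) * h1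

/-- At a fixed time, the positive frequency part of a field is the conjugate of a field. -/
def reflect (m t : ℝ) (a : E3 → ℂ) (p : E3) : ℂ :=
  Complex.exp (2 * Complex.I * (t * omega m p : ℝ)) * conj (a (-p))

lemma IsAmp.reflect (ha : IsAmp m a) (t : ℝ) : IsAmp m (reflect m t a) := by
  have h1 : IsAmp m (fun p => a (-p)) := by
    refine ⟨ha.smooth.comp contDiff_neg, ha.compact.comp_homeomorph (Homeomorph.neg E3), ?_⟩
    intro p hp
    have : -p ∈ tsupport a := tsupport_comp_subset_preimage (f := fun q : E3 => -q) a
      continuous_neg hp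
    rw [← omega_neg]
    exact ha.omega_ne _ this
  exact h1.conj_amp.mul fun p hp => contDiffAt_cexp (contDiffAt_const.mul (contDiffAt_ofReal
    (contDiffAt_const.mul (contDiffAt_omega (h1.conj_amp.omega_ne p hp)))))

/-- Substituting p → -p, under which ω is even, reverses the spatial phase; the factor e^{2itω}
corrects the time phase. Products of two annihilation parts are thereby reduced to the same
Plancherel pairing as the mixed products. -/
lemma field_eq_conj_field_reflect (m t : ℝ) (a : E3 → ℂ) (x : E3) :
    field m a (fourVec t x) = conj (field m (reflect m t a) (fourVec t x)) := by
  rw [field_eq, field_eq, ← integral_conj, ← integral_neg_eq_self]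
  congr 1
  funext p
  simp only [planeWave, mdot_onShell_fourVec, reflect, map_mul, Complex.conj_ofReal,
    ← Complex.exp_conj, omega_neg, inner_neg_left, Complex.conj_I, map_neg, Complex.conj_conj,
    map_ofNat]
  have hs : shellDensity m (-p) = shellDensity m p := by simp [shellDensity, omega_neg]
  rw [hs, mul_assoc, mul_assoc, ← mul_assoc (Complex.exp _) (Complex.exp _), ← Complex.exp_add]
  congr 3
  push_cast
  ring

end Pairing

/-! ### Multiplication by the coordinates -/

/-- `D_σ ω`. -/
def dOmega (m : ℝ) (σ : Fin 4) (p : E3) : ℝ :=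
  (if σ = 0 then 1 else 0) - lowMom m σ p / omega m p

/-- `D_σ p^τ`. -/
def dMom (m : ℝ) (σ τ : Fin 4) (p : E3) : ℝ :=
  (if σ = τ then 1 else 0) - (if τ = 0 then 1 else 0) * lowMom m σ p / omega m p

section Position

variable {m : ℝ} {p : E3}

lemma shellDeriv_coord (σ : Fin 4) (i : Fin 3) (p : E3) :
    shellDeriv σ (fun q : E3 => q i) p = if σ = i.succ then 1 else 0 := by
  have h : HasFDerivAt (fun q : E3 => q i) (EuclideanSpace.proj i : E3 →L[ℝ] ℝ) p :=
    (EuclideanSpace.proj i : E3 →L[ℝ] ℝ).hasFDerivAt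
  rw [shellDeriv_eq_fderiv σ h.differentiableAt, h.fderiv]
  cases σ using Fin.cases with
  | zero => simp [(Fin.succ_ne_zero i).symm]
  | succ j => simp [eq_comm]

lemma shellDeriv_omega (h : omega m p ≠ 0) (σ : Fin 4) :
    shellDeriv σ (omega m) p = dOmega m σ p := by
  have h1 : HasFDerivAt (fun q : E3 => ‖q‖ ^ 2 + m ^ 2) (2 • (innerSL ℝ p)) p :=
    (hasStrictFDerivAt_norm_sq p).hasFDerivAt.add_const _
  have h2 : HasFDerivAt (omega m) _ p := h1.sqrt (omega_sq_ne h)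
  rw [shellDeriv_eq_fderiv σ h2.differentiableAt, h2.fderiv, dOmega]
  cases σ using Fin.cases with
  | zero =>
    simp [lowMom, div_self h]
  | succ j =>
    have e : √(‖p‖ ^ 2 + m ^ 2) = omega m p := rfl
    simp [lowMom, e, Fin.succ_ne_zero, EuclideanSpace.inner_single_right]
    field_simp

lemma shellDeriv_onShell (h : omega m p ≠ 0) (σ τ : Fin 4) :
    shellDeriv σ (fun q => onShell m q τ) p = dMom m σ τ p := by
  cases τ using Fin.cases with
  | zero => simpa [dMom, dOmega] using shellDeriv_omega h σ
  | succ i => simpa [dMom, Fin.succ_ne_zero] using shellDeriv_coord σ i p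

lemma shellDeriv_lowMom (h : omega m p ≠ 0) (σ τ : Fin 4) :
    shellDeriv σ (lowMom m τ) p = eta τ * dMom m σ τ p := by
  have h1 : DifferentiableAt ℝ (fun q => onShell m q τ) p :=
    (contDiffAt_onShell h τ).differentiableAt (by simp)
  have h2 : DifferentiableAt ℝ (lowMom m τ) p :=
    (contDiffAt_lowMom h τ).differentiableAt (by simp)
  rw [← shellDeriv_onShell h, shellDeriv_eq_fderiv _ h1, shellDeriv_eq_fderiv _ h2]
  have : lowMom m τ = fun q => eta τ * onShell m q τ := rfl
  rw [this, fderiv_const_mul h1]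
  rfl

/-- Written out, the left side is ω η_τ δ_στ - δ_τ0 p_σ - δ_σ0 p_τ + p_σ p_τ / ω, which is visibly
symmetric. This symmetry is what removes the non-derivative terms from M. -/
lemma dMom_symm (h : omega m p ≠ 0) (σ τ : Fin 4) :
    omega m p * (eta τ * dMom m σ τ p) - lowMom m τ p * dOmega m σ p
      = omega m p * (eta σ * dMom m τ σ p) - lowMom m σ p * dOmega m τ p := by
  simp only [dMom, dOmega]
  by_cases h0 : σ = τ
  · rw [h0]
  · have h1 : τ ≠ σ := Ne.symm h0
    simp only [h0, h1, if_false]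
    split_ifs with h2 h3 h3
    · exact absurd (h2.trans h3.symm) h1
    · subst h2
      simp only [eta_zero]
      field_simp
      ring
    · subst h3
      simp only [eta_zero]
      field_simp
      ring
    · field_simp
      ring

/-- The action of the covariant coordinate `x_σ` at time `t` on amplitudes. -/
def posOp (m t : ℝ) (σ : Fin 4) (b : E3 → ℂ) (p : E3) : ℂ :=
  -Complex.I * shellDeriv σ b p + Complex.I * ((dOmega m σ p / omega m p : ℝ) : ℂ) * b p
    + ((t * lowMom m σ p / omega m p : ℝ) : ℂ) * b p

lemma shellDeriv_shellDensity (h : omega m p ≠ 0) (σ : Fin 4) :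
    shellDeriv σ (shellDensity m) p = -(shellDensity m p * dOmega m σ p / omega m p) := by
  have h1 : DifferentiableAt ℝ (omega m) p := (contDiffAt_omega h).differentiableAt (by simp)
  have h2 : HasFDerivAt (shellDensity m)
      ((1 / (2 * (2 * π) ^ 3)) • (-(omega m p ^ 2)⁻¹) • fderiv ℝ (omega m) p) p := by
    have h3 := ((hasDerivAt_inv h).comp_hasFDerivAt p h1.hasFDerivAt).const_mul (1 / (2 * (2 * π) ^ 3))
    refine h3.congr_of_eventuallyEq (Eventually.of_forall fun q => ?_)
    simp only [shellDensity, Function.comp_apply]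
    field_simp
  rw [shellDeriv_eq_fderiv σ h2.differentiableAt, h2.fderiv, ← shellDeriv_omega h,
    shellDeriv_eq_fderiv σ h1]
  simp only [shellDensity, _root_.smul_apply, smul_eq_mul]
  field_simp

lemma contDiffAt_dOmega (h : omega m p ≠ 0) (σ : Fin 4) : ContDiffAt ℝ ∞ (dOmega m σ) p :=
  contDiffAt_const.sub ((contDiffAt_lowMom h σ).div (contDiffAt_omega h) h)

lemma IsAmp.posOp {b : E3 → ℂ} (hb : IsAmp m b) (t : ℝ) (σ : Fin 4) :
    IsAmp m (posOp m t σ b) :=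
  (((hb.shellDeriv σ).const_mul _).add (hb.mul fun p hp => contDiffAt_const.mul
    (contDiffAt_ofReal ((contDiffAt_dOmega (hb.omega_ne p hp) σ).div
      (contDiffAt_omega (hb.omega_ne p hp)) (hb.omega_ne p hp))))).add
    (hb.mul fun p hp => contDiffAt_ofReal ((contDiffAt_const.mul
      (contDiffAt_lowMom (hb.omega_ne p hp) σ)).div
      (contDiffAt_omega (hb.omega_ne p hp)) (hb.omega_ne p hp)))

/-- The correction terms of `posOp` are exactly those produced when -i∂_j passes the phase e^{-itω}
and the density 1/ω. -/
lemma slice_posOp {b : E3 → ℂ} (hb : IsAmp m b) (t : ℝ) (j : Fin 3) (p : E3) :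
    slice m t (posOp m t j.succ b) p = -Complex.I * shellDeriv j.succ (slice m t b) p := by
  by_cases hp : p ∈ tsupport b
  · have h := hb.omega_ne p hp
    have h1 : DifferentiableAt ℝ (omega m) p := (contDiffAt_omega h).differentiableAt (by simp)
    have h2 : DifferentiableAt ℝ (shellDensity m) p :=
      (contDiffAt_shellDensity h).differentiableAt (by simp)
    have h3 : DifferentiableAt ℝ (fun q => (shellDensity m q : ℂ)) p :=
      (contDiffAt_ofReal (contDiffAt_shellDensity h)).differentiableAt (by simp)
    have h4 : HasFDerivAt (fun q => Complex.exp (-Complex.I * (t * omega m q : ℝ)))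
        (Complex.exp (-Complex.I * (t * omega m p : ℝ)) • (-Complex.I) •
          (Complex.ofRealCLM.comp (t • fderiv ℝ (omega m) p))) p :=
      ((Complex.ofRealCLM.hasFDerivAt.comp p
        (h1.hasFDerivAt.const_mul t)).const_mul (-Complex.I)).cexp
    have h5 : slice m t b = fun q => Complex.exp (-Complex.I * (t * omega m q : ℝ)) *
        ((shellDensity m q : ℂ) * b q) := rfl
    rw [h5, shellDeriv_mul _ h4.differentiableAt (h3.fun_mul (hb.differentiableAt p)),
      shellDeriv_mul _ h3 (hb.differentiableAt p), shellDeriv_ofReal _ h2,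
      shellDeriv_shellDensity h, shellDeriv_eq_fderiv _ h4.differentiableAt, h4.fderiv]
    simp only [_root_.smul_apply, ContinuousLinearMap.comp_apply,
      ← shellDeriv_eq_fderiv _ h1, shellDeriv_omega h, slice, posOp, smul_eq_mul,
      Complex.ofRealCLM_apply]
    have e : dOmega m j.succ p = -(lowMom m j.succ p / omega m p) := by
      simp [dOmega, Fin.succ_ne_zero]
    rw [e]
    push_cast
    linear_combination (Complex.exp (-Complex.I * (t * omega m p)) * (shellDensity m p : ℂ) * t *
      lowMom m j.succ p / omega m p * b p) * Complex.I_mul_I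
  · have h1 : p ∉ tsupport (slice m t b) := fun h => hp (by
      exact tsupport_mul_subset_right (tsupport_mul_subset_right h))
    rw [shellDeriv_of_notMem_tsupport _ h1]
    simp only [slice, posOp, shellDeriv_of_notMem_tsupport _ hp,
      image_eq_zero_of_notMem_tsupport hp]
    simp

open scoped FourierTransform LineDeriv in
lemma field_posOp {b : E3 → ℂ} (hb : IsAmp m b) (t : ℝ) (σ : Fin 4) (x : E3) :
    field m (posOp m t σ b) (fourVec t x)
      = (lowPos σ (fourVec t x) : ℂ) * field m b (fourVec t x) := by
  cases σ using Fin.cases with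
  -- On the mass shell D_0 ω = 0 and p_0/ω = 1, so the operator reduces to multiplication by t.
  | zero =>
    rw [← field_const_mul]
    congr 1
    funext p
    by_cases hp : p ∈ tsupport b
    · have h := hb.omega_ne p hp
      simp [posOp, dOmega, lowMom, lowPos, fourVec, shellDeriv, lineDeriv_zero, h]
    · simp [posOp, shellDeriv_of_notMem_tsupport _ hp, image_eq_zero_of_notMem_tsupport hp]
  | succ j =>
    rw [field_fourVec (hb.posOp t _), field_fourVec hb]
    -- The inverse Fourier transform takes this derivative to multiplication by the coordinate. The
    -- covariant component x_j = -x^j accounts for the sign.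
    have h1 : ((hb.posOp t j.succ).slice t).schwartz = (-Complex.I) •
        ∂_{(EuclideanSpace.single j 1 : E3)} (hb.slice t).schwartz := by
      ext p
      rw [IsAmp.schwartz_apply, slice_posOp hb, _root_.smul_apply, SchwartzMap.lineDerivOp_apply]
      rfl
    have h2 : (fun x : E3 => inner ℝ x (EuclideanSpace.single j (1 : ℝ))).HasTemperateGrowth := by
      fun_prop
    rw [h1, FourierTransform.fourierInv_smul, SchwartzMap.fourierInv_lineDerivOp_eq,
      _root_.smul_apply, _root_.smul_apply, SchwartzMap.smulLeftCLM_apply_apply h2]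
    simp only [lowPos, fourVec, Fin.cons_succ, eta_succ, PiLp.smul_apply,
      EuclideanSpace.inner_single_right, smul_eq_mul, Complex.real_smul]
    have hpi : (π : ℂ) ≠ 0 := Complex.ofReal_ne_zero.2 Real.pi_ne_zero
    push_cast
    generalize (𝓕⁻ (hb.slice t).schwartz) ((2 * π)⁻¹ • x) = G
    simp only [conj_trivial]
    push_cast
    field_simp
    linear_combination ((x j : ℂ) * G) * Complex.I_mul_I

end Position

/-! ### Quadratic densities of plane wave fields -/

/-- `f ∂_μ↔ g`. -/
def diff1 (μ : Fin 4) (f g : M4 → ℂ) (x : M4) : ℂ := f x * pd μ g x - pd μ f x * g x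

/-- `f ∂_μ↔ ∂_ν↔ g`. -/
def diff2 (μ ν : Fin 4) (f g : M4 → ℂ) (x : M4) : ℂ :=
  f x * pd μ (pd ν g) x - pd μ f x * pd ν g x - pd ν f x * pd μ g x + pd μ (pd ν f) x * g x

/-- The action of `∂_μ` on amplitudes. -/
def momOp (m : ℝ) (μ : Fin 4) (a : E3 → ℂ) (p : E3) : ℂ := -Complex.I * (lowMom m μ p : ℂ) * a p

section Densities

variable {m : ℝ} {a b : E3 → ℂ}

lemma IsAmp.momOp (ha : IsAmp m a) (μ : Fin 4) : IsAmp m (momOp m μ a) := ha.mul_lowMom μ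

lemma pd_field_eq_momOp (ha : IsAmp m a) (μ : Fin 4) :
    pd μ (field m a) = field m (momOp m μ a) := pd_field ha μ

lemma pd_conj_field (ha : IsAmp m a) (μ : Fin 4) :
    pd μ (fun x => conj (field m a x)) = fun x => conj (field m (momOp m μ a) x) := by
  rw [pd_conj, pd_field_eq_momOp ha]

lemma integrable_pairing (ha : IsAmp m a) (hb : IsAmp m b) :
    Integrable (fun p => ((shellDensity m p / (2 * omega m p) : ℝ) : ℂ) * (conj (a p) * b p)) := by
  refine IsAmp.integrable (m := m) (IsAmp.mul (a := fun p => conj (a p) * b p)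
    (hb.mul fun _ _ => ha.conj_amp.smooth.contDiffAt) fun p hp => contDiffAt_ofReal ?_)
  have h := hb.omega_ne p (tsupport_mul_subset_right hp)
  exact (contDiffAt_shellDensity h).div (contDiffAt_const.mul (contDiffAt_omega h)) (by positivity)

lemma integral_sub_sub_add {f₁ f₂ f₃ f₄ : E3 → ℂ} (h₁ : Integrable f₁) (h₂ : Integrable f₂)
    (h₃ : Integrable f₃) (h₄ : Integrable f₄) :
    ∫ x, (f₁ x - f₂ x - f₃ x + f₄ x) = (∫ x, f₁ x) - (∫ x, f₂ x) - (∫ x, f₃ x) + ∫ x, f₄ x := by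
  have h₁₂ : Integrable (fun x => f₁ x - f₂ x) := h₁.sub h₂
  have h₁₂₃ : Integrable (fun x => f₁ x - f₂ x - f₃ x) := h₁₂.sub h₃
  rw [integral_add h₁₂₃ h₄, integral_sub h₁₂ h₃, integral_sub h₁ h₂]

/-- Four equal-time pairings, as they occur in `∂_μ↔ ∂_ν↔`. -/
lemma integral_four_pairings {a₁ a₂ a₃ a₄ b₁ b₂ b₃ b₄ : E3 → ℂ}
    (ha₁ : IsAmp m a₁) (ha₂ : IsAmp m a₂) (ha₃ : IsAmp m a₃) (ha₄ : IsAmp m a₄)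
    (hb₁ : IsAmp m b₁) (hb₂ : IsAmp m b₂) (hb₃ : IsAmp m b₃) (hb₄ : IsAmp m b₄) (t : ℝ) :
    let f := fun x : E3 =>
      conj (field m a₁ (fourVec t x)) * field m b₁ (fourVec t x)
      - conj (field m a₂ (fourVec t x)) * field m b₂ (fourVec t x)
      - conj (field m a₃ (fourVec t x)) * field m b₃ (fourVec t x)
      + conj (field m a₄ (fourVec t x)) * field m b₄ (fourVec t x)
    Integrable f ∧ ∫ x, f x = ∫ p : E3, ((shellDensity m p / (2 * omega m p) : ℝ) : ℂ) *
      (conj (a₁ p) * b₁ p - conj (a₂ p) * b₂ p - conj (a₃ p) * b₃ p + conj (a₄ p) * b₄ p) := by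
  intro f
  have i₁ := integrable_conj_field_mul_field ha₁ hb₁ t
  have i₂ := integrable_conj_field_mul_field ha₂ hb₂ t
  have i₃ := integrable_conj_field_mul_field ha₃ hb₃ t
  have i₄ := integrable_conj_field_mul_field ha₄ hb₄ t
  refine ⟨((i₁.sub i₂).sub i₃).add i₄, ?_⟩
  have j₁ := integrable_pairing ha₁ hb₁
  have j₂ := integrable_pairing ha₂ hb₂
  have j₃ := integrable_pairing ha₃ hb₃
  have j₄ := integrable_pairing ha₄ hb₄
  simp only [mul_sub, mul_add]
  rw [integral_sub_sub_add i₁ i₂ i₃ i₄, integral_sub_sub_add j₁ j₂ j₃ j₄,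
    integral_conj_field_mul_field ha₁ hb₁, integral_conj_field_mul_field ha₂ hb₂,
    integral_conj_field_mul_field ha₃ hb₃, integral_conj_field_mul_field ha₄ hb₄]

/-- The pairing of fields has a surplus 1/(2ω), which the arrow derivative in time compensates by a
factor 2ω. At ω = 0 nothing needs proof, because `shellDensity` is then zero by convention. -/
lemma density_div_mul (m : ℝ) (p : E3) (z w : ℂ) (h : omega m p ≠ 0 → z = 2 * omega m p * w) :
    ((shellDensity m p / (2 * omega m p) : ℝ) : ℂ) * z = (shellDensity m p : ℂ) * w := by
  by_cases h0 : omega m p = 0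
  · simp [shellDensity, h0]
  · rw [h h0]
    have : (omega m p : ℂ) ≠ 0 := Complex.ofReal_ne_zero.2 h0
    push_cast
    field_simp

lemma lowMom_zero (m : ℝ) (p : E3) : lowMom m 0 p = omega m p := by simp [lowMom]

lemma diff2_conj_field (ha : IsAmp m a) (hb : IsAmp m b) (σ : Fin 4) (x : M4) :
    diff2 0 σ (fun y => conj (field m a y)) (field m b) x =
      conj (field m a x) * field m (momOp m 0 (momOp m σ b)) x
      - conj (field m (momOp m 0 a) x) * field m (momOp m σ b) x
      - conj (field m (momOp m σ a) x) * field m (momOp m 0 b) x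
      + conj (field m (momOp m 0 (momOp m σ a)) x) * field m b x := by
  simp only [diff2, pd_conj_field ha, pd_conj_field (ha.momOp σ), pd_field_eq_momOp hb,
    pd_field_eq_momOp (hb.momOp σ)]

lemma diff2_field (ha : IsAmp m a) (hb : IsAmp m b) (σ : Fin 4) (x : M4) :
    diff2 0 σ (field m a) (field m b) x =
      field m a x * field m (momOp m 0 (momOp m σ b)) x
      - field m (momOp m 0 a) x * field m (momOp m σ b) x
      - field m (momOp m σ a) x * field m (momOp m 0 b) x
      + field m (momOp m 0 (momOp m σ a)) x * field m b x := by
  simp only [diff2, pd_field_eq_momOp ha, pd_field_eq_momOp (ha.momOp σ), pd_field_eq_momOp hb,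
    pd_field_eq_momOp (hb.momOp σ)]

lemma conj_momOp (m : ℝ) (μ : Fin 4) (a : E3 → ℂ) (p : E3) :
    conj (momOp m μ a p) = Complex.I * lowMom m μ p * conj (a p) := by
  simp [momOp]

lemma conj_reflect (m t : ℝ) (a : E3 → ℂ) (p : E3) :
    conj (reflect m t a p) = Complex.exp (-2 * Complex.I * (t * omega m p : ℝ)) * a (-p) := by
  simp only [reflect, map_mul, ← Complex.exp_conj, Complex.conj_conj, Complex.conj_ofReal,
    Complex.conj_I, map_ofNat]
  congr 2
  ring

lemma momOp_neg (m : ℝ) (μ : Fin 4) (a : E3 → ℂ) (p : E3) :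
    momOp m μ a (-p) = -Complex.I * lowMom m μ (-p) * a (-p) := rfl

/-- For opposite frequencies all four terms of the double arrow have the same sign, each equal to -ω
p_σ, and the total -4ω p_σ cancels the factor 1/(2ω). -/
theorem integral_diff2_conj_field (ha : IsAmp m a) (hb : IsAmp m b) (σ : Fin 4) (t : ℝ) :
    Integrable (fun x : E3 =>
      diff2 0 σ (fun y => conj (field m a y)) (field m b) (fourVec t x)) ∧
    ∫ x : E3, diff2 0 σ (fun y => conj (field m a y)) (field m b) (fourVec t x)
      = ∫ p : E3, (shellDensity m p : ℂ) * (-2 * lowMom m σ p * (conj (a p) * b p)) := by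
  have h := integral_four_pairings ha (ha.momOp 0) (ha.momOp σ) ((ha.momOp σ).momOp 0)
    ((hb.momOp σ).momOp 0) (hb.momOp σ) (hb.momOp 0) hb t
  simp only [diff2_conj_field ha hb]
  refine ⟨h.1, h.2.trans (integral_congr_ae (Eventually.of_forall fun p => ?_))⟩
  refine density_div_mul m p _ _ fun _ => ?_
  simp only [conj_momOp]
  simp only [momOp, lowMom_zero]
  linear_combination (4 * omega m p * lowMom m σ p * conj (a p) * b p) * Complex.I_mul_I

/-- For equal frequencies the momenta at p and -p have the same energy, so the four terms cancel in
pairs. -/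
theorem integral_diff2_field (ha : IsAmp m a) (hb : IsAmp m b) (σ : Fin 4) (t : ℝ) :
    Integrable (fun x : E3 => diff2 0 σ (field m a) (field m b) (fourVec t x)) ∧
    ∫ x : E3, diff2 0 σ (field m a) (field m b) (fourVec t x) = 0 := by
  have h := integral_four_pairings (ha.reflect t) ((ha.momOp 0).reflect t)
    ((ha.momOp σ).reflect t) (((ha.momOp σ).momOp 0).reflect t)
    ((hb.momOp σ).momOp 0) (hb.momOp σ) (hb.momOp 0) hb t
  simp only [← field_eq_conj_field_reflect] at h
  simp only [diff2_field ha hb]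
  refine ⟨h.1, h.2.trans ?_⟩
  rw [← integral_zero E3 ℂ]
  refine integral_congr_ae (Eventually.of_forall fun p => ?_)
  simp only [conj_reflect, momOp_neg]
  simp only [momOp, lowMom_zero, omega_neg]
  ring

/-- The part of `∫ x_σ (f ∂_0↔ ∂_τ↔ g)` that is symmetric in `σ`, `τ`. -/
def symCoeff (m t : ℝ) (σ τ : Fin 4) (p : E3) : ℂ :=
  Complex.I * ((eta τ * dMom m σ τ p - lowMom m τ p * dOmega m σ p / omega m p : ℝ) : ℂ)
    - ((2 * t * lowMom m τ p * lowMom m σ p / omega m p : ℝ) : ℂ)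

lemma symCoeff_symm {p : E3} (h : omega m p ≠ 0) (t : ℝ) (σ τ : Fin 4) :
    symCoeff m t σ τ p = symCoeff m t τ σ p := by
  have h1 := dMom_symm h σ τ
  have h2 : eta τ * dMom m σ τ p - lowMom m τ p * dOmega m σ p / omega m p
      = eta σ * dMom m τ σ p - lowMom m σ p * dOmega m τ p / omega m p := by
    field_simp
    linarith
  rw [symCoeff, symCoeff, h2]
  congr 3
  ring

lemma posOp_real_mul (hb : IsAmp m b) {g : E3 → ℝ} {p : E3} (hg : DifferentiableAt ℝ g p)
    (t : ℝ) (σ : Fin 4) (c : ℂ) :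
    posOp m t σ (fun q => c * (g q : ℂ) * b q) p
      = c * (g p : ℂ) * posOp m t σ b p - Complex.I * c * (shellDeriv σ g p : ℝ) * b p := by
  have h1 : DifferentiableAt ℝ (fun q => (g q : ℂ)) p :=
    (Complex.ofRealCLM.hasFDerivAt.comp p hg.hasFDerivAt).differentiableAt
  simp only [posOp]
  rw [shellDeriv_mul σ (h1.const_mul c) (hb.differentiableAt p), shellDeriv_const_mul σ c h1,
    shellDeriv_ofReal σ hg]
  ring

lemma posOp_momOp (hb : IsAmp m b) {p : E3} (h : omega m p ≠ 0) (t : ℝ) (σ τ : Fin 4) :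
    posOp m t σ (momOp m τ b) p
      = -Complex.I * lowMom m τ p * posOp m t σ b p - (eta τ * dMom m σ τ p : ℝ) * b p := by
  have h1 := posOp_real_mul hb (g := lowMom m τ) (p := p)
    ((contDiffAt_lowMom h τ).differentiableAt (by simp)) t σ (-Complex.I)
  rw [shellDeriv_lowMom h] at h1
  refine h1.trans ?_
  linear_combination ((eta τ * dMom m σ τ p : ℝ) * b p) * Complex.I_mul_I

lemma posOp_momOp_momOp (hb : IsAmp m b) {p : E3} (h : omega m p ≠ 0) (t : ℝ) (σ τ : Fin 4) :
    posOp m t σ (momOp m 0 (momOp m τ b)) p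
      = -(omega m p * lowMom m τ p * posOp m t σ b p)
        + Complex.I * (omega m p * (eta τ * dMom m σ τ p) + dOmega m σ p * lowMom m τ p : ℝ) *
          b p := by
  rw [posOp_momOp (hb.momOp τ) h, posOp_momOp hb h]
  have e : eta 0 * dMom m σ 0 p = dOmega m σ p := by simp [dMom, dOmega]
  rw [e, lowMom_zero]
  simp only [momOp]
  push_cast
  linear_combination (omega m p * lowMom m τ p * posOp m t σ b p) * Complex.I_mul_I

/-- The factor x_σ is shifted onto the right field by `field_posOp`. Commuting it through the
momenta leaves one genuine derivative of b; everything else collects in `symCoeff`, which is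
symmetric in σ, τ by `symCoeff_symm` and so does not contribute to M. -/
theorem integral_pos_mul_diff2_conj_field (ha : IsAmp m a) (hb : IsAmp m b) (σ τ : Fin 4)
    (t : ℝ) :
    Integrable (fun x : E3 => (lowPos σ (fourVec t x) : ℂ) *
      diff2 0 τ (fun y => conj (field m a y)) (field m b) (fourVec t x)) ∧
    ∫ x : E3, (lowPos σ (fourVec t x) : ℂ) *
        diff2 0 τ (fun y => conj (field m a y)) (field m b) (fourVec t x)
      = ∫ p : E3, (shellDensity m p : ℂ) * (conj (a p) *
        (2 * Complex.I * lowMom m τ p * shellDeriv σ b p + symCoeff m t σ τ p * b p)) := by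
  have h := integral_four_pairings ha (ha.momOp 0) (ha.momOp τ) ((ha.momOp τ).momOp 0)
    (((hb.momOp τ).momOp 0).posOp t σ) ((hb.momOp τ).posOp t σ) ((hb.momOp 0).posOp t σ)
    (hb.posOp t σ) t
  simp only [field_posOp ((hb.momOp τ).momOp 0), field_posOp (hb.momOp τ),
    field_posOp (hb.momOp 0), field_posOp hb] at h
  refine ⟨h.1.congr (Eventually.of_forall fun x => ?_),
    (integral_congr_ae (Eventually.of_forall fun x => ?_)).trans
      (h.2.trans (integral_congr_ae (Eventually.of_forall fun p => ?_)))⟩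
  · simp only [diff2_conj_field ha hb]
    ring
  · simp only [diff2_conj_field ha hb]
    ring
  refine density_div_mul m p _ _ fun h0 => ?_
  simp only [conj_momOp, posOp_momOp_momOp hb h0, posOp_momOp hb h0]
  have e : eta 0 * dMom m σ 0 p = dOmega m σ p := by simp [dMom, dOmega]
  have hc : (omega m p : ℂ) ≠ 0 := Complex.ofReal_ne_zero.2 h0
  rw [e]
  simp only [lowMom_zero, posOp, symCoeff]
  push_cast
  field_simp
  ring_nf
  simp only [Complex.I_sq, Complex.I_pow_three]
  ring

/-- Because of x_σ the cancellation in pairs is incomplete. The remainder is governed by p_τ(-p) -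
p_τ(p) = 2ω D_τ ω, which makes it proportional to the symmetric product D_σ ω D_τ ω. -/
theorem integral_pos_mul_diff2_field (ha : IsAmp m a) (hb : IsAmp m b) (σ τ : Fin 4) (t : ℝ) :
    Integrable (fun x : E3 => (lowPos σ (fourVec t x) : ℂ) *
      diff2 0 τ (field m a) (field m b) (fourVec t x)) ∧
    ∫ x : E3, (lowPos σ (fourVec t x) : ℂ) * diff2 0 τ (field m a) (field m b) (fourVec t x)
      = ∫ p : E3, (shellDensity m p : ℂ) * (-Complex.I * dOmega m σ p * dOmega m τ p *
        (Complex.exp (-2 * Complex.I * (t * omega m p : ℝ)) * a (-p) * b p)) := by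
  have h := integral_four_pairings (ha.reflect t) ((ha.momOp 0).reflect t)
    ((ha.momOp τ).reflect t) (((ha.momOp τ).momOp 0).reflect t)
    (((hb.momOp τ).momOp 0).posOp t σ) ((hb.momOp τ).posOp t σ) ((hb.momOp 0).posOp t σ)
    (hb.posOp t σ) t
  simp only [field_posOp ((hb.momOp τ).momOp 0), field_posOp (hb.momOp τ),
    field_posOp (hb.momOp 0), field_posOp hb, ← field_eq_conj_field_reflect] at h
  refine ⟨h.1.congr (Eventually.of_forall fun x => ?_),
    (integral_congr_ae (Eventually.of_forall fun x => ?_)).trans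
      (h.2.trans (integral_congr_ae (Eventually.of_forall fun p => ?_)))⟩
  · simp only [diff2_field ha hb]
    ring
  · simp only [diff2_field ha hb]
    ring
  refine density_div_mul m p _ _ fun h0 => ?_
  have e : eta 0 * dMom m σ 0 p = dOmega m σ p := by simp [dMom, dOmega]
  have hc : (omega m p : ℂ) ≠ 0 := Complex.ofReal_ne_zero.2 h0
  have hq : lowMom m τ (-p) = lowMom m τ p + 2 * omega m p * dOmega m τ p := by
    cases τ using Fin.cases with
    | zero => simp [lowMom, dOmega, omega_neg, h0]
    | succ j =>
      simp only [lowMom, dOmega, onShell_succ, eta_succ, Fin.succ_ne_zero, if_false, PiLp.neg_apply]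
      field_simp
      ring
  simp only [conj_reflect, momOp_neg, posOp_momOp_momOp hb h0, posOp_momOp hb h0, hq, e,
    lowMom_zero, omega_neg]
  push_cast
  ring_nf
  simp only [Complex.I_sq]
  ring

lemma integral_two_pairings {a₁ a₂ b₁ b₂ : E3 → ℂ} (ha₁ : IsAmp m a₁) (ha₂ : IsAmp m a₂)
    (hb₁ : IsAmp m b₁) (hb₂ : IsAmp m b₂) (t : ℝ) :
    let f := fun x : E3 =>
      conj (field m a₁ (fourVec t x)) * field m b₁ (fourVec t x)
      - conj (field m a₂ (fourVec t x)) * field m b₂ (fourVec t x)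
    Integrable f ∧ ∫ x, f x = ∫ p : E3, ((shellDensity m p / (2 * omega m p) : ℝ) : ℂ) *
      (conj (a₁ p) * b₁ p - conj (a₂ p) * b₂ p) := by
  intro f
  have i₁ := integrable_conj_field_mul_field ha₁ hb₁ t
  have i₂ := integrable_conj_field_mul_field ha₂ hb₂ t
  refine ⟨i₁.sub i₂, ?_⟩
  simp only [mul_sub]
  rw [integral_sub i₁ i₂, integral_sub (integrable_pairing ha₁ hb₁) (integrable_pairing ha₂ hb₂),
    integral_conj_field_mul_field ha₁ hb₁, integral_conj_field_mul_field ha₂ hb₂]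

theorem integral_diff1_conj_field (ha : IsAmp m a) (hb : IsAmp m b) (t : ℝ) :
    Integrable (fun x : E3 =>
      diff1 0 (fun y => conj (field m a y)) (field m b) (fourVec t x)) ∧
    ∫ x : E3, diff1 0 (fun y => conj (field m a y)) (field m b) (fourVec t x)
      = ∫ p : E3, (shellDensity m p : ℂ) * (-Complex.I * (conj (a p) * b p)) := by
  have h := integral_two_pairings ha (ha.momOp 0) (hb.momOp 0) hb t
  simp only [diff1, pd_conj_field ha, pd_field_eq_momOp hb]
  refine ⟨h.1, h.2.trans (integral_congr_ae (Eventually.of_forall fun p => ?_))⟩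
  refine density_div_mul m p _ _ fun _ => ?_
  simp only [conj_momOp]
  simp only [momOp, lowMom_zero]
  ring

theorem integral_diff1_field (ha : IsAmp m a) (hb : IsAmp m b) (t : ℝ) :
    Integrable (fun x : E3 => diff1 0 (field m a) (field m b) (fourVec t x)) ∧
    ∫ x : E3, diff1 0 (field m a) (field m b) (fourVec t x) = 0 := by
  have h := integral_two_pairings (ha.reflect t) ((ha.momOp 0).reflect t) (hb.momOp 0) hb t
  simp only [← field_eq_conj_field_reflect] at h
  simp only [diff1, pd_field_eq_momOp ha, pd_field_eq_momOp hb]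
  refine ⟨h.1, h.2.trans ?_⟩
  rw [← integral_zero E3 ℂ]
  refine integral_congr_ae (Eventually.of_forall fun p => ?_)
  simp only [conj_reflect, momOp_neg]
  simp only [momOp, lowMom_zero, omega_neg]
  ring

end Densities

/-! ### Intertwiners

All intertwiners are of the form `c_k - p y_k` with the regular vectors `c_k` below and a real
function `y`: the Proca field has `y_k = -p_k / (m (ω + m))`, string-localized potentials have
`y_k = (c_k e) / (p e)`. The scalar escort components are `m y_k + p_k / (ω + m)`. -/

/-- `p_k / (ω + m)`. -/
def velVec (m : ℝ) (p : E3) (k : Fin 3) : ℝ := p k / (omega m p + m)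

/-- The four-vectors `c_k`, with time component `p_k / (ω + m)` and spatial part the `k`-th
standard basis vector. -/
def regVec (m : ℝ) (p : E3) (k : Fin 3) : M4 :=
  Fin.cons (velVec m p k) (fun i => if i = k then 1 else 0)

/-- `c_k - p y_k`. -/
def potVec (m : ℝ) (y : E3 → Fin 3 → ℝ) (p : E3) (k : Fin 3) (μ : Fin 4) : ℝ :=
  regVec m p k μ - onShell m p μ * y p k

/-- `m y_k + p_k / (ω + m)`. -/
def escVec (m : ℝ) (y : E3 → Fin 3 → ℝ) (p : E3) (k : Fin 3) : ℝ :=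
  m * y p k + velVec m p k

section Algebra

variable {m : ℝ} {p : E3}

lemma omega_add_pos (hm : 0 ≤ m) (h : omega m p ≠ 0) : 0 < omega m p + m :=
  add_pos_of_pos_of_nonneg (omega_pos_of_ne h) hm

lemma mdot_eq (x y : M4) : mdot x y = x 0 * y 0 - ∑ i : Fin 3, x i.succ * y i.succ := by
  rw [mdot, Fin.sum_univ_succ]
  simp [Finset.sum_neg_distrib, sub_eq_add_neg]

lemma mdot_onShell_self (m : ℝ) (p : E3) : mdot (onShell m p) (onShell m p) = m ^ 2 := by
  have h1 := omega_sq m p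
  have h2 := norm_sq_eq_sum p
  rw [mdot_eq]
  simp only [onShell_zero, onShell_succ, ← sq]
  linarith

lemma mdot_regVec_onShell (hm : 0 ≤ m) (h : omega m p ≠ 0) (k : Fin 3) :
    mdot (regVec m p k) (onShell m p) = -(m * velVec m p k) := by
  have h1 := (omega_add_pos hm h).ne'
  rw [mdot_eq]
  simp only [regVec, Fin.cons_zero, Fin.cons_succ, onShell_zero, onShell_succ, velVec]
  simp only [ite_mul, one_mul, zero_mul, Finset.sum_ite_eq', Finset.mem_univ, if_true]
  field_simp
  ring

lemma mdot_regVec_regVec (k l : Fin 3) :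
    mdot (regVec m p k) (regVec m p l)
      = velVec m p k * velVec m p l - if k = l then 1 else 0 := by
  rw [mdot_eq]
  simp [regVec, eq_comm]

lemma mdot_comm (x y : M4) : mdot x y = mdot y x := by
  simp only [mdot]
  exact Finset.sum_congr rfl fun _ _ => by ring

lemma mdot_sub_mul_left (x y z : M4) (c : ℝ) :
    mdot (fun μ => x μ - y μ * c) z = mdot x z - c * mdot y z := by
  simp only [mdot, Finset.mul_sum, ← Finset.sum_sub_distrib]
  exact Finset.sum_congr rfl fun _ _ => by ring

lemma mdot_sub_mul_right (x y z : M4) (c : ℝ) :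
    mdot z (fun μ => x μ - y μ * c) = mdot z x - c * mdot z y := by
  rw [mdot_comm, mdot_sub_mul_left, mdot_comm x, mdot_comm y]

/-- By p² = m² the divergence of the potential is m times its escort up to sign. This explains the
definition of the escort and its finiteness after division by m. -/
lemma mdot_potVec_onShell (hm : 0 ≤ m) (h : omega m p ≠ 0) (y : E3 → Fin 3 → ℝ) (k : Fin 3) :
    mdot (potVec m y p k) (onShell m p) = -(m * escVec m y p k) := by
  have : potVec m y p k = fun μ => regVec m p k μ - onShell m p μ * y p k := rfl
  rw [this, mdot_sub_mul_left, mdot_regVec_onShell hm h, mdot_onShell_self, escVec]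
  ring

/-- Completeness of the potential and its escort. -/
lemma mdot_potVec_potVec (hm : 0 ≤ m) (h : omega m p ≠ 0) (y y' : E3 → Fin 3 → ℝ)
    (k l : Fin 3) :
    -mdot (potVec m y p k) (potVec m y' p l) + escVec m y p k * escVec m y' p l
      = if k = l then 1 else 0 := by
  have h1 : potVec m y' p l = fun μ => regVec m p l μ - onShell m p μ * y' p l := rfl
  have h2 : potVec m y p k = fun μ => regVec m p k μ - onShell m p μ * y p k := rfl
  rw [h1, mdot_sub_mul_right, mdot_potVec_onShell hm h, h2, mdot_sub_mul_left,
    mdot_regVec_regVec, mdot_comm (onShell m p), mdot_regVec_onShell hm h]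
  simp only [escVec]
  ring

lemma contDiffAt_velVec (hm : 0 ≤ m) (h : omega m p ≠ 0) (k : Fin 3) :
    ContDiffAt ℝ ∞ (fun q => velVec m q k) p :=
  (contDiff_coord k).contDiffAt.div ((contDiffAt_omega h).add contDiffAt_const)
    (omega_add_pos hm h).ne'

lemma contDiffAt_regVec (hm : 0 ≤ m) (h : omega m p ≠ 0) (k : Fin 3) (μ : Fin 4) :
    ContDiffAt ℝ ∞ (fun q => regVec m q k μ) p := by
  cases μ using Fin.cases with
  | zero => exact contDiffAt_velVec hm h k
  | succ i => exact contDiffAt_const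

lemma contDiffAt_potVec (hm : 0 ≤ m) (h : omega m p ≠ 0) {y : E3 → Fin 3 → ℝ} {k : Fin 3}
    (hy : ContDiffAt ℝ ∞ (fun q => y q k) p) (μ : Fin 4) :
    ContDiffAt ℝ ∞ (fun q => potVec m y q k μ) p :=
  (contDiffAt_regVec hm h k μ).sub ((contDiffAt_onShell h μ).mul hy)

lemma contDiffAt_escVec (hm : 0 ≤ m) (h : omega m p ≠ 0) {y : E3 → Fin 3 → ℝ} {k : Fin 3}
    (hy : ContDiffAt ℝ ∞ (fun q => y q k) p) :
    ContDiffAt ℝ ∞ (fun q => escVec m y q k) p :=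
  (contDiffAt_const.mul hy).add (contDiffAt_velVec hm h k)

lemma shellDeriv_add {f g : E3 → ℝ} (σ : Fin 4) (hf : DifferentiableAt ℝ f p)
    (hg : DifferentiableAt ℝ g p) :
    shellDeriv σ (fun q => f q + g q) p = shellDeriv σ f p + shellDeriv σ g p := by
  rw [shellDeriv_eq_fderiv σ (hf.fun_add hg), shellDeriv_eq_fderiv σ hf,
    shellDeriv_eq_fderiv σ hg, fderiv_fun_add hf hg]
  rfl

lemma shellDeriv_const {F : Type*} [NormedAddCommGroup F] [NormedSpace ℝ F] (σ : Fin 4) (c : F) :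
    shellDeriv σ (fun _ : E3 => c) p = 0 := by
  rw [shellDeriv_eq_fderiv σ (differentiableAt_const _)]
  simp

/-- `c_{σ k}`, covariant index. -/
def lowReg (m : ℝ) (p : E3) (σ : Fin 4) (k : Fin 3) : ℝ := eta σ * regVec m p k σ

/-- Obtained by differentiating (ω + m) v_l = p_l, with the factor ω + m kept on the left: in
`shellDeriv_contraction` this derivative occurs with the coefficient (ω + m) y_k. -/
lemma shellDeriv_velVec (hm : 0 ≤ m) (h : omega m p ≠ 0) (σ : Fin 4) (l : Fin 3) :
    (omega m p + m) * shellDeriv σ (fun q => velVec m q l) p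
      = -lowReg m p σ l + velVec m p l * lowMom m σ p / omega m p := by
  have h1 := (omega_add_pos hm h).ne'
  have d1 : DifferentiableAt ℝ (fun q => velVec m q l) p :=
    (contDiffAt_velVec hm h l).differentiableAt (by simp)
  have d2 : DifferentiableAt ℝ (omega m) p := (contDiffAt_omega h).differentiableAt (by simp)
  have d3 : DifferentiableAt ℝ (fun q => omega m q + m) p := d2.add_const m
  have e1 : shellDeriv σ (fun q => omega m q + m) p = dOmega m σ p := by
    rw [shellDeriv_add σ d2 (differentiableAt_const m), shellDeriv_omega h, shellDeriv_const,
      add_zero]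
  have e2 : (fun q : E3 => (omega m q + m) * velVec m q l) =ᶠ[𝓝 p] fun q => q l := by
    have h4 : ∀ᶠ q in 𝓝 p, omega m q + m ≠ 0 := d3.continuousAt.eventually_ne h1
    filter_upwards [h4] with q hq
    simp only [velVec]
    field_simp
  have e3 := shellDeriv_congr σ e2
  rw [shellDeriv_mul σ d3 d1, e1, shellDeriv_coord] at e3
  have e4 : (if σ = l.succ then (1 : ℝ) else 0) - dOmega m σ p * velVec m p l
      = -lowReg m p σ l + velVec m p l * lowMom m σ p / omega m p := by
    cases σ using Fin.cases with
    | zero => simp [dOmega, lowReg, regVec, (Fin.succ_ne_zero l).symm]; ring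
    | succ j =>
      simp only [dOmega, lowReg, regVec, Fin.succ_ne_zero, Fin.succ_inj, Fin.cons_succ, eta_succ,
        if_false]
      ring
  linarith

lemma shellDeriv_regVec (l : Fin 3) (σ μ : Fin 4) :
    shellDeriv σ (fun q => regVec m q l μ) p
      = if μ = 0 then shellDeriv σ (fun q => velVec m q l) p else 0 := by
  cases μ using Fin.cases with
  | zero => simp [regVec]
  | succ i => simpa [regVec, Fin.succ_ne_zero] using shellDeriv_const (p := p) σ _

/-- `c_{σ k} - p_σ y_k`, covariant index. -/
def lowPot (m : ℝ) (y : E3 → Fin 3 → ℝ) (p : E3) (σ : Fin 4) (k : Fin 3) : ℝ :=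
  eta σ * potVec m y p k σ

/-- Derivative of the contraction of potential and escort with respect to the second momentum. -/
def spinConn (m : ℝ) (y y' : E3 → Fin 3 → ℝ) (p : E3) (σ : Fin 4) (k l : Fin 3) : ℝ :=
  y p k * (-lowReg m p σ l + velVec m p l * lowMom m σ p / omega m p)
    + y' p l * (lowPot m y p σ k - lowPot m y p 0 k * lowMom m σ p / omega m p)

/-- Only q varies, the left factor being frozen at p. The derivative of y' enters with the
coefficient (potential · p) + m · escort, which vanishes by `mdot_potVec_onShell`; hence the result
is algebraic in y and y'. -/
lemma shellDeriv_contraction (hm : 0 ≤ m) (h : omega m p ≠ 0) (y y' : E3 → Fin 3 → ℝ)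
    (σ : Fin 4) (k l : Fin 3) (hy : DifferentiableAt ℝ (fun q => y' q l) p) :
    shellDeriv σ (fun q => -mdot (potVec m y p k) (potVec m y' q l)
      + escVec m y p k * escVec m y' q l) p = spinConn m y y' p σ k l := by
  have dc : ∀ μ, DifferentiableAt ℝ (fun q => regVec m q l μ) p := fun μ =>
    (contDiffAt_regVec hm h l μ).differentiableAt (by simp)
  have dp : ∀ μ, DifferentiableAt ℝ (fun q => onShell m q μ) p := fun μ =>
    (contDiffAt_onShell h μ).differentiableAt (by simp)
  have dv : DifferentiableAt ℝ (fun q => velVec m q l) p :=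
    (contDiffAt_velVec hm h l).differentiableAt (by simp)
  set Y := shellDeriv σ (fun q => y' q l) p with hY
  set V := shellDeriv σ (fun q => velVec m q l) p with hV
  have e1 : ∀ μ, HasFDerivAt (fun q => potVec m y' q l μ)
      (fderiv ℝ (fun q => regVec m q l μ) p - fderiv ℝ (fun q => onShell m q μ * y' q l) p) p :=
    fun μ => (dc μ).hasFDerivAt.sub ((dp μ).fun_mul hy).hasFDerivAt
  have e2 : HasFDerivAt (fun q => escVec m y' q l)
      (m • fderiv ℝ (fun q => y' q l) p + fderiv ℝ (fun q => velVec m q l) p) p :=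
    (hy.hasFDerivAt.const_mul m).add dv.hasFDerivAt
  have e3 : HasFDerivAt (fun q => -mdot (potVec m y p k) (potVec m y' q l)
      + escVec m y p k * escVec m y' q l) _ p :=
    (HasFDerivAt.fun_sum fun μ _ => (e1 μ).const_mul (eta μ * potVec m y p k μ)).neg.add
      (e2.const_mul (escVec m y p k))
  have f1 : ∀ μ, fderiv ℝ (fun q => regVec m q l μ) p (dirVec σ) = if μ = 0 then V else 0 :=
    fun μ => by rw [← shellDeriv_eq_fderiv σ (dc μ), shellDeriv_regVec]
  have f2 : ∀ μ, fderiv ℝ (fun q => onShell m q μ * y' q l) p (dirVec σ)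
      = onShell m p μ * Y + dMom m σ μ p * y' p l := fun μ => by
    rw [← shellDeriv_eq_fderiv σ ((dp μ).fun_mul hy), shellDeriv_mul σ (dp μ) hy,
      shellDeriv_onShell h]
  have f3 : fderiv ℝ (fun q => y' q l) p (dirVec σ) = Y := (shellDeriv_eq_fderiv σ hy).symm
  have f4 : fderiv ℝ (fun q => velVec m q l) p (dirVec σ) = V := (shellDeriv_eq_fderiv σ dv).symm
  rw [shellDeriv_eq_fderiv σ e3.differentiableAt, e3.fderiv]
  simp only [_root_.add_apply, _root_.neg_apply, _root_.sum_apply,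
    _root_.smul_apply, _root_.sub_apply, f1, f2, f3, f4, smul_eq_mul]
  have g0 : ∑ μ, eta μ * potVec m y p k μ * ((if μ = 0 then V else 0)
      - (onShell m p μ * Y + dMom m σ μ p * y' p l))
      = potVec m y p k 0 * V - Y * mdot (potVec m y p k) (onShell m p)
        - y' p l * ∑ μ, eta μ * potVec m y p k μ * dMom m σ μ p := by
    have : potVec m y p k 0 * V
        = ∑ μ : Fin 4, eta μ * potVec m y p k μ * (if μ = 0 then V else 0) := by simp
    rw [this, mdot, Finset.mul_sum, Finset.mul_sum, ← Finset.sum_sub_distrib,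
      ← Finset.sum_sub_distrib]
    exact Finset.sum_congr rfl fun μ _ => by ring
  have g1 : ∑ μ, eta μ * potVec m y p k μ * dMom m σ μ p
      = lowPot m y p σ k - lowPot m y p 0 k * lowMom m σ p / omega m p := by
    simp only [dMom, mul_sub, Finset.sum_sub_distrib, lowPot]
    congr 1
    · simp
    · rw [Finset.sum_eq_single 0]
      · simp
        ring
      · intro b _ hb
        simp [hb]
      · simp
  rw [g0, g1, mdot_potVec_onShell hm h, spinConn, ← shellDeriv_velVec hm h, ← hV]
  have e5 : potVec m y p k 0 = velVec m p k - omega m p * y p k := rfl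
  rw [e5]
  simp only [escVec]
  ring

lemma spinVec_eq (m : ℝ) (p : E3) (σ : Fin 4) (k : Fin 3) :
    spinVec m p σ k = -lowReg m p σ k := by
  cases σ using Fin.cases with
  | zero => simp [spinVec, lowReg, regVec, velVec, neg_div]
  | succ i =>
    simp only [spinVec, lowReg, regVec, Fin.cons_succ, Fin.cases_succ, eta_succ, eq_comm (a := k)]
    ring

/-- The infinitesimal Wigner rotation, from potentials. -/
lemma spinMat_eq (m : ℝ) (p : E3) (y y' : E3 → Fin 3 → ℝ) (σ τ : Fin 4) (k l : Fin 3) :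
    lowMom m σ p * spinConn m y y' p τ k l - lowMom m τ p * spinConn m y y' p σ k l
      - (lowPot m y p σ k * lowPot m y' p τ l - lowPot m y p τ k * lowPot m y' p σ l)
      = spinMat m p σ τ k l := by
  -- In terms of c and p, every term containing y or y' cancels under antisymmetrization in σ, τ,
  -- and so do the terms with 1/ω. What is left is c_τk c_σl - c_σk c_τl.
  have h : ∀ (z : E3 → Fin 3 → ℝ) (ρ : Fin 4) (j : Fin 3),
      lowPot m z p ρ j = lowReg m p ρ j - lowMom m ρ p * z p j := by
    intro z ρ j
    simp only [lowPot, potVec, lowReg, lowMom]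
    ring
  simp only [spinMat, spinVec_eq, spinConn, h]
  ring

end Algebra

/-! ### Symmetric tensors over `ℂ⁴ ⊕ ℂ`

A tensor index is either a Lorentz index `some μ` or the escort index `none`. -/

/-- The multi-index with `r` Lorentz indices, followed by `s - r` escort indices. -/
def escortIndex (s r : ℕ) (M : Fin r → Fin 4) (k : Fin s) : Option (Fin 4) :=
  if h : (k : ℕ) < r then some (M ⟨k, h⟩) else none

section Combinatorics

lemma escortIndex_snoc (s r : ℕ) (hr : r ≤ s) (M : Fin r → Fin 4) :
    (Fin.snoc (escortIndex s r M) none : Fin (s + 1) → Option (Fin 4))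
      = escortIndex (s + 1) r M := by
  funext k
  refine Fin.lastCases ?_ (fun i => ?_) k
  · have : ¬ s < r := by omega
    simp [escortIndex, this]
  · simp [escortIndex]

lemma escortIndex_cons (s r : ℕ) (M : Fin r → Fin 4) (μ : Fin 4) :
    (Fin.cons (some μ) (escortIndex s r M) : Fin (s + 1) → Option (Fin 4))
      = escortIndex (s + 1) (r + 1) (Fin.cons μ M) := by
  funext k
  refine Fin.cases ?_ (fun i => ?_) k
  · simp [escortIndex]
  · rw [Fin.cons_succ]
    by_cases h : (i : ℕ) < r
    · rw [escortIndex, escortIndex, dif_pos h, dif_pos (by simpa using h)]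
      rfl
    · rw [escortIndex, escortIndex, dif_neg h, dif_neg (by simpa using h)]

/-- A function of multi-indices that is invariant under permutations of the indices. -/
def PermInvariant {s : ℕ} {ι R : Type*} (f : (Fin s → ι) → R) : Prop :=
  ∀ (g : Equiv.Perm (Fin s)) (J : Fin s → ι), f (J ∘ g) = f J

lemma PermInvariant.cons {s : ℕ} {ι R : Type*} {f : (Fin (s + 1) → ι) → R}
    (hf : PermInvariant f) (i : ι) : PermInvariant (fun J : Fin s → ι => f (Fin.cons i J)) := by
  intro g J
  -- The extension of g that fixes index 0 and permutes the remaining ones.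
  let g' : Equiv.Perm (Fin (s + 1)) := Equiv.Perm.decomposeFin.symm (0, g)
  have : (Fin.cons i (J ∘ g) : Fin (s + 1) → ι) = (Fin.cons i J : Fin (s + 1) → ι) ∘ g' := by
    funext k
    refine Fin.cases ?_ (fun j => ?_) k
    · simp [g']
    · simp [g']
  change f (Fin.cons i (J ∘ g)) = f (Fin.cons i J)
  rw [this]
  exact hf g' _

lemma PermInvariant.snoc_eq_cons {s : ℕ} {ι R : Type*} {f : (Fin (s + 1) → ι) → R}
    (hf : PermInvariant f) (i : ι) (J : Fin s → ι) :
    f (Fin.snoc J i) = f (Fin.cons i J) := by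
  have : (Fin.snoc J i : Fin (s + 1) → ι) = (Fin.cons i J : Fin (s + 1) → ι) ∘ finRotate (s + 1) := by
    funext k
    refine Fin.lastCases ?_ (fun j => ?_) k
    · simp
    · have : finRotate (s + 1) j.castSucc = j.succ := by
        rw [finRotate_apply]
        exact Fin.coeSucc_eq_succ
      simp [this]
  rw [this]
  exact hf _ _

lemma sum_multiIndex_succ {s : ℕ} {ι : Type*} [Fintype ι] (f : (Fin (s + 1) → ι) → ℂ) :
    ∑ J, f J = ∑ i, ∑ J : Fin s → ι, f (Fin.cons i J) := by
  rw [← (Fin.consEquiv (fun _ => ι)).sum_comp, Fintype.sum_prod_type]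
  rfl

lemma sum_choose_succ (s : ℕ) (h : ℕ → ℂ) :
    ∑ r ∈ Finset.range (s + 2), ((s + 1).choose r : ℂ) * h r
      = ∑ r ∈ Finset.range (s + 1), (s.choose r : ℂ) * h r
        + ∑ r ∈ Finset.range (s + 1), (s.choose r : ℂ) * h (r + 1) := by
  rw [Finset.sum_range_succ' (fun r => ((s + 1).choose r : ℂ) * h r)]
  simp only [Nat.choose_succ_succ, Nat.cast_add, add_mul, Finset.sum_add_distrib]
  have e : ∑ r ∈ Finset.range (s + 1), (s.choose (r + 1) : ℂ) * h (r + 1)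
      + (s.choose 0 : ℂ) * h 0 = ∑ r ∈ Finset.range (s + 1), (s.choose r : ℂ) * h r := by
    rw [← Finset.sum_range_succ' (fun r => (s.choose r : ℂ) * h r), Finset.sum_range_succ]
    simp
  simp only [Nat.choose_zero_right] at e ⊢
  rw [← e]
  ring

/-- Induction on s by splitting off the first index. If it is an escort index, symmetry moves it to
the end and r is unchanged; if it is a Lorentz index, r rises by one. The two contributions combine
by Pascal's rule. -/
lemma sum_permInvariant {s : ℕ} {f : (Fin s → Option (Fin 4)) → ℂ} (hf : PermInvariant f) :
    ∑ J, f J = ∑ r ∈ Finset.range (s + 1), (s.choose r : ℂ) *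
      ∑ M : Fin r → Fin 4, f (escortIndex s r M) := by
  induction s with
  | zero =>
    simp only [Finset.univ_unique, Finset.sum_singleton, zero_add, Finset.range_one,
      Nat.choose_self, Nat.cast_one, one_mul]
    exact congrArg f (Subsingleton.elim _ _)
  | succ s ih =>
    rw [sum_multiIndex_succ, Fintype.sum_option, ih (hf.cons none), sum_choose_succ]
    congr 1
    · refine Finset.sum_congr rfl fun r hr => ?_
      congr 1
      refine Finset.sum_congr rfl fun M _ => ?_
      rw [← hf.snoc_eq_cons, escortIndex_snoc s r (by simpa using Nat.lt_succ_iff.1 (Finset.mem_range.1 hr))]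
    · simp only [ih (hf.cons (some _))]
      rw [Finset.sum_comm]
      refine Finset.sum_congr rfl fun r _ => ?_
      rw [← Finset.mul_sum]
      congr 1
      rw [← (Fin.consEquiv (fun _ => Fin 4)).sum_comp, Fintype.sum_prod_type]
      refine Finset.sum_congr rfl fun μ _ => Finset.sum_congr rfl fun M _ => ?_
      rw [escortIndex_cons]
      rfl

/-- Contraction of tensor powers. -/
lemma sum_tensor_contraction {s : ℕ} {κ : Type*} [Fintype κ] (g : Fin s → κ → ℂ)
    (W W' : Fin s → κ → Fin 3 → ℂ) (v v' : (Fin s → Fin 3) → ℂ) :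
    ∑ J : Fin s → κ, (∏ k, g k (J k)) * (conj (∑ I, (∏ k, W k (J k) (I k)) * v I) *
        ∑ I', (∏ k, W' k (J k) (I' k)) * v' I')
      = ∑ I, ∑ I', (∏ k, ∑ x, g k x * (conj (W k x (I k)) * W' k x (I' k))) *
        (conj (v I) * v' I') := by
  have h : ∀ I I' : Fin s → Fin 3, ∏ k, ∑ x, g k x * (conj (W k x (I k)) * W' k x (I' k))
      = ∑ J : Fin s → κ, ∏ k, g k (J k) * (conj (W k (J k) (I k)) * W' k (J k) (I' k)) :=
    fun I I' => Fintype.prod_sum _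
  have h1 : ∀ J : Fin s → κ, (∏ k, g k (J k)) * (conj (∑ I, (∏ k, W k (J k) (I k)) * v I) *
        ∑ I', (∏ k, W' k (J k) (I' k)) * v' I')
      = ∑ I, ∑ I', (∏ k, g k (J k) * (conj (W k (J k) (I k)) * W' k (J k) (I' k))) *
        (conj (v I) * v' I') := by
    intro J
    rw [map_sum, Finset.sum_mul_sum, Finset.mul_sum]
    refine Finset.sum_congr rfl fun I _ => ?_
    rw [Finset.mul_sum]
    refine Finset.sum_congr rfl fun I' _ => ?_
    simp only [Finset.prod_mul_distrib, map_mul, map_prod]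
    ring
  simp only [h1, h, Finset.sum_mul]
  rw [Finset.sum_comm]
  exact Finset.sum_congr rfl fun I _ => Finset.sum_comm

lemma prod_ite_eq_ite {s : ℕ} (I I' : Fin s → Fin 3) :
    ∏ k, (if I k = I' k then (1 : ℂ) else 0) = if I = I' then 1 else 0 := by
  rw [Finset.prod_ite_zero]
  simp [funext_iff]

lemma sum_delta {s : ℕ} (v' : (Fin s → Fin 3) → ℂ) (I : Fin s → Fin 3) :
    ∑ I', (∏ k, (if I k = I' k then (1 : ℂ) else 0)) * v' I' = v' I := by
  simp [prod_ite_eq_ite]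

/-- Action of a matrix on one tensor index. -/
def slotAction {s : ℕ} (S : Fin 3 → Fin 3 → ℂ) (a : Fin s) (v : (Fin s → Fin 3) → ℂ)
    (I : Fin s → Fin 3) : ℂ := ∑ l, S (I a) l * v (Function.update I a l)

/-- The deltas outside slot a force I' to agree with I there, so only the multi-indices obtained by
changing I at a survive. -/
lemma sum_delta_slot {s : ℕ} (S : Fin 3 → Fin 3 → ℂ) (a : Fin s) (v : (Fin s → Fin 3) → ℂ)
    (I : Fin s → Fin 3) :
    ∑ I', (S (I a) (I' a) * ∏ k ∈ Finset.univ.erase a, (if I k = I' k then (1 : ℂ) else 0)) * v I'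
      = slotAction S a v I := by
  unfold slotAction
  symm
  have hinj : Function.Injective (fun l => Function.update I a l) := Function.update_injective I a
  have himage : ∑ l, S (I a) l * v (Function.update I a l)
      = ∑ I' ∈ Finset.univ.image (fun l => Function.update I a l), S (I a) (I' a) * v I' := by
    rw [Finset.sum_image (fun x _ y _ h => hinj h)]
    simp
  rw [himage]
  refine Finset.sum_subset_zero_on_sdiff (Finset.subset_univ _) ?_ ?_
  · intro I' hI'
    have : ∃ k ∈ Finset.univ.erase a, ¬ I k = I' k := by
      by_contra! hcon
      apply (Finset.mem_sdiff.1 hI').2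
      refine Finset.mem_image.2 ⟨I' a, Finset.mem_univ _, ?_⟩
      funext k
      by_cases hk : k = a
      · subst hk; simp
      · rw [Function.update_of_ne hk]
        exact hcon k (by simp [hk])
    obtain ⟨k, hk, hk'⟩ := this
    rw [Finset.prod_eq_zero hk (by simp [hk'])]
    simp
  · intro I' hI'
    obtain ⟨l, _, rfl⟩ := Finset.mem_image.1 hI'
    rw [Finset.prod_eq_one]
    · simp
    · intro k hk
      rw [Function.update_of_ne (Finset.ne_of_mem_erase hk)]
      simp

/-- Between symmetric tensors all slots are equivalent: relabelling the summation by the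
transposition of a and b carries one slot action to the other. -/
lemma sum_slotAction_eq {s : ℕ} (S : Fin 3 → Fin 3 → ℂ) (a b : Fin s)
    {v v' : (Fin s → Fin 3) → ℂ} (hv : PermInvariant v) (hv' : PermInvariant v') :
    ∑ I, conj (v I) * slotAction S a v' I = ∑ I, conj (v I) * slotAction S b v' I := by
  rw [← (Equiv.arrowCongr (Equiv.swap a b) (Equiv.refl (Fin 3))).sum_comp]
  refine Finset.sum_congr rfl fun I _ => ?_
  have e : ((Equiv.swap a b).arrowCongr (Equiv.refl (Fin 3))) I = I ∘ Equiv.swap a b := by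
    funext k
    simp [Equiv.arrowCongr]
  rw [e, hv]
  congr 1
  unfold slotAction
  refine Finset.sum_congr rfl fun l _ => ?_
  congr 1
  · simp
  · rw [← hv' (Equiv.swap a b) (Function.update I b l)]
    congr 1
    funext k
    by_cases hk : k = a
    · subst hk; simp
    · have : Equiv.swap a b k ≠ b := by
        intro h
        exact hk ((Equiv.swap a b).injective (h.trans (Equiv.swap_apply_left a b).symm))
      simp [Function.update_of_ne hk, Function.update_of_ne this]

end Combinatorics

/-! ### Amplitudes of the tensor fields -/

/-- Metric on `ℂ⁴ ⊕ ℂ` with the overall sign that makes physical components positive. -/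
def indexMetric : Option (Fin 4) → ℂ
  | none => 1
  | some μ => -(eta μ : ℂ)

/-- The intertwiner of the potential and of its escort. -/
def intertwiner (m : ℝ) (y : E3 → Fin 3 → ℝ) (p : E3) : Option (Fin 4) → Fin 3 → ℂ
  | none, k => -Complex.I * (escVec m y p k : ℂ)
  | some μ, k => (lowPot m y p μ k : ℂ)

/-- Amplitude of the component `J` of a tensor field. -/
def tensorAmp {s : ℕ} (m : ℝ) (y : E3 → Fin 3 → ℝ) (ψ : Wave s) (J : Fin s → Option (Fin 4))
    (p : E3) : ℂ :=
  ∑ I : Fin s → Fin 3, (∏ k, intertwiner m y p (J k) (I k)) * ψ p I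

/-- Symmetric smooth compactly supported wave functions, supported in the domain of smoothness
of the energy and of the functions `y`. -/
structure IsGoodWave {s : ℕ} (m : ℝ) (y : E3 → Fin 3 → ℝ) (ψ : Wave s) : Prop where
  smooth : ContDiff ℝ ∞ ψ
  compact : HasCompactSupport ψ
  symm : ∀ p, PermInvariant (ψ p)
  omega_ne : ∀ p ∈ tsupport ψ, omega m p ≠ 0
  smooth_at : ∀ p ∈ tsupport ψ, ∀ k, ContDiffAt ℝ ∞ (fun q => y q k) p

section Amplitudes

variable {s : ℕ} {m : ℝ} {y y' : E3 → Fin 3 → ℝ} {ψ φ : Wave s} {p : E3}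

lemma tsupport_component_subset (ψ : Wave s) (I : Fin s → Fin 3) :
    tsupport (fun p => ψ p I) ⊆ tsupport ψ :=
  closure_mono fun p hp h => hp (by change ψ p I = 0; rw [h]; rfl)

lemma IsGoodWave.isAmp (hψ : IsGoodWave m y ψ) (I : Fin s → Fin 3) :
    IsAmp m (fun p => ψ p I) where
  smooth := (contDiff_pi.1 hψ.smooth) I
  compact := hψ.compact.comp_left (g := fun v : (Fin s → Fin 3) → ℂ => v I) rfl
  omega_ne := fun p hp => hψ.omega_ne p (tsupport_component_subset ψ I hp)

lemma wave_eq_zero (hp : p ∉ tsupport ψ) (I : Fin s → Fin 3) : ψ p I = 0 := by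
  rw [image_eq_zero_of_notMem_tsupport hp]
  rfl

lemma contDiffAt_intertwiner (hm : 0 ≤ m) (h : omega m p ≠ 0)
    (hy : ∀ k, ContDiffAt ℝ ∞ (fun q => y q k) p) (x : Option (Fin 4)) (k : Fin 3) :
    ContDiffAt ℝ ∞ (fun q => intertwiner m y q x k) p := by
  cases x with
  | none => exact contDiffAt_const.mul (contDiffAt_ofReal (contDiffAt_escVec hm h (hy k)))
  | some μ =>
    exact contDiffAt_ofReal (contDiffAt_const.mul (contDiffAt_potVec hm h (hy k) μ))

lemma IsGoodWave.isAmp_tensorAmp (hm : 0 ≤ m) (hψ : IsGoodWave m y ψ)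
    (J : Fin s → Option (Fin 4)) : IsAmp m (tensorAmp m y ψ J) := by
  refine IsAmp.sum _ fun I _ => (hψ.isAmp I).mul fun p hp => ?_
  have hp' := tsupport_component_subset ψ I hp
  exact contDiffAt_prod fun k _ =>
    contDiffAt_intertwiner hm (hψ.omega_ne p hp') (hψ.smooth_at p hp') _ _

lemma tensorAmp_eq_zero (hp : p ∉ tsupport ψ) (J : Fin s → Option (Fin 4)) :
    tensorAmp m y ψ J p = 0 := by
  simp [tensorAmp, wave_eq_zero hp]

lemma tensor_permInvariant {κ : Type*} (W : κ → Fin 3 → ℂ) {v : (Fin s → Fin 3) → ℂ}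
    (hv : PermInvariant v) :
    PermInvariant (fun J : Fin s → κ => ∑ I : Fin s → Fin 3, (∏ k, W (J k) (I k)) * v I) := by
  intro g J
  change ∑ I, (∏ k, W ((J ∘ g) k) (I k)) * v I = ∑ I, (∏ k, W (J k) (I k)) * v I
  rw [← (Equiv.arrowCongr g.symm (Equiv.refl (Fin 3))).sum_comp]
  refine Finset.sum_congr rfl fun I _ => ?_
  have e : (g.symm.arrowCongr (Equiv.refl (Fin 3))) I = I ∘ g := by
    funext k
    simp [Equiv.arrowCongr]
  rw [e, hv, ← Equiv.prod_comp g (fun k => W (J k) (I k))]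
  rfl

/-- The factor -i of the escort intertwiner has modulus one and disappears here. The momenta p and q
are kept independent so that the identity can be differentiated in q alone. -/
lemma sum_indexMetric (m : ℝ) (y y' : E3 → Fin 3 → ℝ) (p q : E3) (k l : Fin 3) :
    ∑ x, indexMetric x * (conj (intertwiner m y p x k) * intertwiner m y' q x l)
      = ((-mdot (potVec m y p k) (potVec m y' q l) + escVec m y p k * escVec m y' q l : ℝ) : ℂ) := by
  rw [Fintype.sum_option]
  simp only [indexMetric, intertwiner, lowPot, mdot, map_mul, map_neg, Complex.conj_I,
    Complex.conj_ofReal]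
  push_cast
  rw [← Finset.sum_neg_distrib, add_comm]
  congr 1
  · refine Finset.sum_congr rfl fun μ _ => ?_
    have := eta_mul_self μ
    have h : (eta μ : ℂ) * eta μ = 1 := by exact_mod_cast this
    linear_combination (-(eta μ : ℂ) * potVec m y p k μ * potVec m y' q l μ) * h
  · linear_combination (-(escVec m y p k : ℂ) * escVec m y' q l) * Complex.I_mul_I

lemma sum_indexMetric_self (hm : 0 ≤ m) (h : omega m p ≠ 0) (y y' : E3 → Fin 3 → ℝ)
    (k l : Fin 3) :
    ∑ x, indexMetric x * (conj (intertwiner m y p x k) * intertwiner m y' p x l)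
      = if k = l then 1 else 0 := by
  rw [sum_indexMetric, mdot_potVec_potVec hm h]
  split_ifs <;> simp

lemma tensorAmp_permInvariant (m : ℝ) (y : E3 → Fin 3 → ℝ) (hψ : PermInvariant (ψ p)) :
    PermInvariant (fun J => tensorAmp m y ψ J p) :=
  tensor_permInvariant (intertwiner m y p) hψ

/-- Each Lorentz index carries -η and each escort index carries 1, so r Lorentz indices supply the
sign (-1)^r, while `sum_permInvariant` supplies the binomial coefficient. -/
lemma sum_choose_neg_one_pow {s : ℕ} {f : (Fin s → Option (Fin 4)) → ℂ} (hf : PermInvariant f) :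
    ∑ J, (∏ k, indexMetric (J k)) * f J = ∑ r ∈ Finset.range (s + 1), (s.choose r : ℂ) * (-1) ^ r *
      ∑ M : Fin r → Fin 4, (∏ k, (eta (M k) : ℂ)) * f (escortIndex s r M) := by
  have h1 : PermInvariant (fun J : Fin s → Option (Fin 4) => (∏ k, indexMetric (J k)) * f J) := by
    intro g J
    simp only
    rw [hf g J, ← Equiv.prod_comp g (fun k => indexMetric (J k))]
    rfl
  rw [sum_permInvariant h1]
  refine Finset.sum_congr rfl fun r hr => ?_
  have hr' : r ≤ s := Nat.lt_succ_iff.1 (Finset.mem_range.1 hr)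
  rw [mul_assoc]
  congr 1
  rw [Finset.mul_sum]
  refine Finset.sum_congr rfl fun M _ => ?_
  have h2 : ∏ k, indexMetric (escortIndex s r M k) = (-1) ^ r * ∏ k, (eta (M k) : ℂ) := by
    obtain ⟨d, rfl⟩ := Nat.exists_eq_add_of_le hr'
    rw [Fin.prod_univ_add]
    simp [escortIndex, indexMetric, Finset.prod_neg]
  rw [h2]
  ring

/-- Completeness relation for the amplitudes. -/
theorem sum_conj_tensorAmp_mul_tensorAmp (hm : 0 ≤ m) (hψ : IsGoodWave m y ψ)
    (hφ : IsGoodWave m y' φ) (p : E3) :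
    ∑ r ∈ Finset.range (s + 1), (s.choose r : ℂ) * (-1) ^ r *
      ∑ M : Fin r → Fin 4, (∏ k, (eta (M k) : ℂ)) *
        (conj (tensorAmp m y ψ (escortIndex s r M) p) * tensorAmp m y' φ (escortIndex s r M) p)
      = ∑ I, conj (ψ p I) * φ p I := by
  by_cases hp : p ∈ tsupport ψ
  · have h := hψ.omega_ne p hp
    have hperm : PermInvariant (fun J => conj (tensorAmp m y ψ J p) * tensorAmp m y' φ J p) := by
      intro g J
      have h1 := tensorAmp_permInvariant m y (hψ.symm p) g J
      have h2 := tensorAmp_permInvariant m y' (hφ.symm p) g J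
      simp only at h1 h2 ⊢
      rw [h1, h2]
    rw [← sum_choose_neg_one_pow hperm]
    simp only [tensorAmp]
    rw [sum_tensor_contraction (fun _ => indexMetric) (fun _ => intertwiner m y p)
      (fun _ => intertwiner m y' p)]
    refine Finset.sum_congr rfl fun I _ => ?_
    simp only [sum_indexMetric_self hm h]
    exact sum_delta (fun I' => conj (ψ p I) * φ p I') I
  · simp [tensorAmp_eq_zero hp, wave_eq_zero hp]

lemma shellDeriv_prod {ι : Type*} [DecidableEq ι] (S : Finset ι) {f : ι → E3 → ℂ} (σ : Fin 4)
    (hf : ∀ i ∈ S, DifferentiableAt ℝ (f i) p) :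
    shellDeriv σ (fun q => ∏ i ∈ S, f i q) p
      = ∑ a ∈ S, shellDeriv σ (f a) p * ∏ k ∈ S.erase a, f k p := by
  have h := HasFDerivAt.finsetProd (u := S) (g := f) fun i hi => (hf i hi).hasFDerivAt
  rw [shellDeriv_eq_fderiv σ h.differentiableAt, h.fderiv, _root_.sum_apply]
  refine Finset.sum_congr rfl fun a ha => ?_
  rw [shellDeriv_eq_fderiv σ (hf a ha), mul_comm]
  rfl

lemma differentiableAt_prod {ι : Type*} (S : Finset ι) {f : ι → E3 → ℂ}
    (hf : ∀ i ∈ S, DifferentiableAt ℝ (f i) p) :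
    DifferentiableAt ℝ (fun q => ∏ i ∈ S, f i q) p := by
  classical
  exact (HasFDerivAt.finsetProd fun i hi => (hf i hi).hasFDerivAt).differentiableAt

/-- Leibniz rule for a tensor power of a matrix function that is the identity at p: all
undifferentiated factors are deltas, so the derivative of the product acts as a sum of one-slot
actions. -/
lemma shellDeriv_sum_prod_mul {Q : E3 → Fin 3 → Fin 3 → ℂ} {R : Fin 3 → Fin 3 → ℂ} (σ : Fin 4)
    (dQ : ∀ k l, DifferentiableAt ℝ (fun q => Q q k l) p)
    (eQ : ∀ k l, Q p k l = if k = l then 1 else 0)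
    (eR : ∀ k l, shellDeriv σ (fun q => Q q k l) p = R k l)
    (dφ : ∀ I, DifferentiableAt ℝ (fun q => φ q I) p) (v : (Fin s → Fin 3) → ℂ) :
    shellDeriv σ (fun q => ∑ I, ∑ I', (∏ k, Q q (I k) (I' k)) * (conj (v I) * φ q I')) p
      = ∑ I, conj (v I) * (shellDeriv σ (fun q => φ q I) p + ∑ a, slotAction R a (φ p) I) := by
  have dP : ∀ I I' : Fin s → Fin 3, DifferentiableAt ℝ (fun q => ∏ k, Q q (I k) (I' k)) p :=
    fun I I' => differentiableAt_prod _ fun k _ => dQ _ _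
  have dF : ∀ I I' : Fin s → Fin 3, DifferentiableAt ℝ
      (fun q => (∏ k, Q q (I k) (I' k)) * (conj (v I) * φ q I')) p := fun I I' =>
    (dP I I').fun_mul ((dφ I').const_mul _)
  rw [shellDeriv_sum σ _ fun I _ => DifferentiableAt.fun_sum fun I' _ => dF I I']
  refine Finset.sum_congr rfl fun I _ => ?_
  rw [shellDeriv_sum σ _ fun I' _ => dF I I']
  have e1 : ∀ I', shellDeriv σ (fun q => (∏ k, Q q (I k) (I' k)) * (conj (v I) * φ q I')) p
      = conj (v I) * ((∏ k, (if I k = I' k then (1 : ℂ) else 0)) *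
          shellDeriv σ (fun q => φ q I') p)
        + conj (v I) * ∑ a, (R (I a) (I' a) *
          ∏ k ∈ Finset.univ.erase a, (if I k = I' k then (1 : ℂ) else 0)) * φ p I' := by
    intro I'
    rw [shellDeriv_mul σ (dP I I') ((dφ I').const_mul _), shellDeriv_const_mul σ _ (dφ I'),
      shellDeriv_prod Finset.univ σ fun k _ => dQ _ _]
    simp only [eR, eQ]
    rw [Finset.sum_mul, Finset.mul_sum]
    congr 1
    · ring
    · exact Finset.sum_congr rfl fun a _ => by ring
  simp only [e1]
  rw [Finset.sum_add_distrib, ← Finset.mul_sum, ← Finset.mul_sum, sum_delta, ← mul_add]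
  congr 2
  rw [Finset.sum_comm]
  exact Finset.sum_congr rfl fun a _ => sum_delta_slot _ a (φ p) I

/-- The derivative of the completeness relation. -/
lemma sum_conj_tensorAmp_mul_shellDeriv (hm : 0 ≤ m) (hφ : IsGoodWave m y' φ) (ψ : Wave s)
    (y : E3 → Fin 3 → ℝ) (hp : p ∈ tsupport φ) (σ : Fin 4) :
    ∑ J : Fin s → Option (Fin 4), (∏ k, indexMetric (J k)) *
        (conj (tensorAmp m y ψ J p) * shellDeriv σ (tensorAmp m y' φ J) p)
      = ∑ I, conj (ψ p I) * (shellDeriv σ (fun q => φ q I) p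
          + ∑ a, slotAction (fun k l => (spinConn m y y' p σ k l : ℂ)) a (φ p) I) := by
  have h := hφ.omega_ne p hp
  have dQ : ∀ k l, DifferentiableAt ℝ (fun q => -mdot (potVec m y p k) (potVec m y' q l)
      + escVec m y p k * escVec m y' q l) p := fun k l =>
    ContDiffAt.differentiableAt (n := ∞) (ContDiffAt.add (ContDiffAt.neg (ContDiffAt.sum
      fun μ _ => contDiffAt_const.mul (contDiffAt_potVec hm h (hφ.smooth_at p hp l) μ)))
      (contDiffAt_const.mul (contDiffAt_escVec hm h (hφ.smooth_at p hp l)))) (by simp)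
  have dT : ∀ J, DifferentiableAt ℝ (tensorAmp m y' φ J) p := fun J =>
    (hφ.isAmp_tensorAmp hm J).differentiableAt p
  -- The left amplitude stays at p while the right one moves with q, so that the derivative falls on
  -- the right field only.
  have key : (fun q => ∑ J : Fin s → Option (Fin 4), (∏ k, indexMetric (J k)) *
        (conj (tensorAmp m y ψ J p) * tensorAmp m y' φ J q))
      = fun q => ∑ I, ∑ I', (∏ k, ((-mdot (potVec m y p (I k)) (potVec m y' q (I' k))
      + escVec m y p (I k) * escVec m y' q (I' k) : ℝ) : ℂ)) * (conj (ψ p I) * φ q I') := by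
    funext q
    simp only [tensorAmp]
    rw [sum_tensor_contraction (fun _ => indexMetric) (fun _ => intertwiner m y p)
      (fun _ => intertwiner m y' q)]
    simp only [sum_indexMetric]
  have h1 : shellDeriv σ (fun q => ∑ J : Fin s → Option (Fin 4), (∏ k, indexMetric (J k)) *
        (conj (tensorAmp m y ψ J p) * tensorAmp m y' φ J q)) p
      = ∑ J : Fin s → Option (Fin 4), (∏ k, indexMetric (J k)) *
        (conj (tensorAmp m y ψ J p) * shellDeriv σ (tensorAmp m y' φ J) p) := by
    rw [shellDeriv_sum σ _ fun J _ => ((dT J).const_mul _).const_mul _]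
    refine Finset.sum_congr rfl fun J _ => ?_
    rw [shellDeriv_const_mul σ _ ((dT J).const_mul _), shellDeriv_const_mul σ _ (dT J)]
  rw [← h1, key]
  refine shellDeriv_sum_prod_mul (Q := fun q k l => ((-mdot (potVec m y p k) (potVec m y' q l)
      + escVec m y p k * escVec m y' q l : ℝ) : ℂ)) σ
    (fun k l => (Complex.ofRealCLM.hasFDerivAt.comp p (dQ k l).hasFDerivAt).differentiableAt)
    (fun k l => ?_) (fun k l => ?_) (fun I => (hφ.isAmp I).differentiableAt p) (ψ p)
  · rw [← sum_indexMetric_self hm h y y', sum_indexMetric]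
  · rw [shellDeriv_ofReal σ (dQ k l), shellDeriv_contraction hm h y y' σ k l
      ((hφ.smooth_at p hp l).differentiableAt (by simp))]

/-- Contraction of all but the first index. -/
def spinContr : {r : ℕ} → (A B : (Fin r → Fin 4) → ℂ) → (σ τ : Fin 4) → ℂ
  | 0, _, _, _, _ => 0
  | r + 1, A, B, σ, τ => ∑ N : Fin r → Fin 4, (∏ k, (eta (N k) : ℂ)) *
      (conj (A (Fin.cons σ N)) * B (Fin.cons τ N))

/-- The first slot is held at σ on the left and τ on the right; completeness contracts all others to
deltas. The weight r is absorbed by r binom(s,r) = s binom(s-1,r-1), and the factor s becomes the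
sum over slots because all slots act alike. The minus sign comes from the uncontracted Lorentz
index, which has no factor -η. -/
lemma sum_spinContr (hm : 0 ≤ m) (hψ : IsGoodWave m y ψ) (hφ : IsGoodWave m y' φ)
    (h : omega m p ≠ 0) (σ τ : Fin 4) :
    ∑ r ∈ Finset.range (s + 1), (s.choose r : ℂ) * (-1) ^ r * ((r : ℂ) *
      spinContr (fun M : Fin r → Fin 4 => tensorAmp m y ψ (escortIndex s r M) p)
        (fun M => tensorAmp m y' φ (escortIndex s r M) p) σ τ)
      = -∑ I, conj (ψ p I) * ∑ a, slotAction
          (fun k l => ((lowPot m y p σ k * lowPot m y' p τ l : ℝ) : ℂ)) a (φ p) I := by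
  cases s with
  | zero => simp
  | succ s =>
    have hperm : PermInvariant (fun J : Fin s → Option (Fin 4) =>
        conj (tensorAmp m y ψ (Fin.cons (some σ) J) p)
          * tensorAmp m y' φ (Fin.cons (some τ) J) p) := by
      intro g J
      have h1 := (tensorAmp_permInvariant m y (hψ.symm p)).cons (some σ) g J
      have h2 := (tensorAmp_permInvariant m y' (hφ.symm p)).cons (some τ) g J
      simp only at h1 h2 ⊢
      rw [h1, h2]
    have e1 : ∑ J : Fin s → Option (Fin 4), (∏ k, indexMetric (J k)) *
        (conj (tensorAmp m y ψ (Fin.cons (some σ) J) p)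
          * tensorAmp m y' φ (Fin.cons (some τ) J) p)
        = ∑ I, conj (ψ p I) * slotAction
          (fun k l => ((lowPot m y p σ k * lowPot m y' p τ l : ℝ) : ℂ)) 0 (φ p) I := by
      -- Slot 0 gets a dummy index: its weight is 1 at `none` and 0 elsewhere, and its kernels are
      -- the constant ones at σ and τ. The general contraction formula then applies with the first
      -- slot held fixed.
      have h1 := sum_tensor_contraction (s := s + 1)
        (fun k x => if k = 0 then (if x = none then 1 else 0) else indexMetric x)
        (fun k x => if k = 0 then intertwiner m y p (some σ) else intertwiner m y p x)
        (fun k x => if k = 0 then intertwiner m y' p (some τ) else intertwiner m y' p x)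
        (ψ p) (φ p)
      rw [sum_multiIndex_succ, Fintype.sum_option] at h1
      simp only [Fin.prod_univ_succ, Fin.cons_zero, Fin.cons_succ, if_true, Fin.succ_ne_zero,
        if_false, one_mul, reduceCtorEq, zero_mul, Finset.sum_const_zero, add_zero,
        Fintype.sum_option] at h1
      simp only [tensorAmp, Fin.prod_univ_succ, Fin.cons_zero, Fin.cons_succ]
      rw [h1]
      refine Finset.sum_congr rfl fun I _ => ?_
      rw [← sum_delta_slot, Finset.mul_sum]
      refine Finset.sum_congr rfl fun I' _ => ?_
      have e2 : ∀ k l, indexMetric none * (conj (intertwiner m y p none k)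
          * intertwiner m y' p none l) + ∑ μ, indexMetric (some μ) *
          (conj (intertwiner m y p (some μ) k) * intertwiner m y' p (some μ) l)
          = if k = l then 1 else 0 := by
        intro k l
        rw [← Fintype.sum_option (fun x => indexMetric x * (conj (intertwiner m y p x k)
          * intertwiner m y' p x l)), sum_indexMetric_self hm h]
      have e3 : ∏ k ∈ Finset.univ.erase (0 : Fin (s + 1)), (if I k = I' k then (1 : ℂ) else 0)
          = ∏ k : Fin s, (if I k.succ = I' k.succ then (1 : ℂ) else 0) := by
        rw [Fin.univ_succ, Finset.erase_cons, Finset.prod_map]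
        rfl
      rw [e3]
      simp only [e2]
      simp only [intertwiner, Complex.conj_ofReal]
      push_cast
      ring
    have e4 : ∑ I, conj (ψ p I) * ∑ a, slotAction
          (fun k l => ((lowPot m y p σ k * lowPot m y' p τ l : ℝ) : ℂ)) a (φ p) I
        = (s + 1 : ℂ) * ∑ I, conj (ψ p I) * slotAction
          (fun k l => ((lowPot m y p σ k * lowPot m y' p τ l : ℝ) : ℂ)) 0 (φ p) I := by
      simp only [Finset.mul_sum (s := (Finset.univ : Finset (Fin (s + 1))))]
      rw [Finset.sum_comm]
      simp only [sum_slotAction_eq _ _ (0 : Fin (s + 1)) (hψ.symm p) (hφ.symm p)]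
      simp
    rw [e4, ← e1, sum_choose_neg_one_pow hperm, Finset.sum_range_succ', Finset.mul_sum,
      ← Finset.sum_neg_distrib]
    simp only [spinContr, Nat.cast_zero, mul_zero, add_zero]
    refine Finset.sum_congr rfl fun r _ => ?_
    have hc : ((s + 1).choose (r + 1) : ℂ) * (r + 1 : ℂ) = (s + 1 : ℂ) * s.choose r := by
      exact_mod_cast (Nat.add_one_mul_choose_eq s r).symm
    simp only [escortIndex_cons]
    push_cast
    linear_combination ((-1) ^ (r + 1) * ∑ N : Fin r → Fin 4, (∏ k, (eta (N k) : ℂ)) *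
      (conj (tensorAmp m y ψ (escortIndex (s + 1) (r + 1) (Fin.cons σ N)) p)
        * tensorAmp m y' φ (escortIndex (s + 1) (r + 1) (Fin.cons τ N)) p)) * hc

/-- The Lorentz generator on one-particle states, from the amplitudes of the fields. -/
theorem sum_lorentz_amplitude (hm : 0 ≤ m) (hψ : IsGoodWave m y ψ) (hφ : IsGoodWave m y' φ)
    (p : E3) (σ τ : Fin 4) :
    ∑ r ∈ Finset.range (s + 1), (s.choose r : ℂ) * (-1) ^ r *
      ((∑ M : Fin r → Fin 4, (∏ k, (eta (M k) : ℂ)) *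
        (conj (tensorAmp m y ψ (escortIndex s r M) p) *
          (lowMom m σ p * shellDeriv τ (tensorAmp m y' φ (escortIndex s r M)) p
            - lowMom m τ p * shellDeriv σ (tensorAmp m y' φ (escortIndex s r M)) p)))
      + ((r : ℂ) * spinContr (fun M : Fin r → Fin 4 => tensorAmp m y ψ (escortIndex s r M) p)
          (fun M => tensorAmp m y' φ (escortIndex s r M) p) σ τ
        - (r : ℂ) * spinContr (fun M : Fin r → Fin 4 => tensorAmp m y ψ (escortIndex s r M) p)
          (fun M => tensorAmp m y' φ (escortIndex s r M) p) τ σ))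
      = -Complex.I * ∑ I, conj (ψ p I) * oneM m σ τ φ p I := by
  by_cases hp : p ∈ tsupport φ
  · have h := hφ.omega_ne p hp
    have hperm : ∀ ρ, PermInvariant
        (fun J => conj (tensorAmp m y ψ J p) * shellDeriv ρ (tensorAmp m y' φ J) p) := by
      intro ρ g J
      have h1 := tensorAmp_permInvariant m y (hψ.symm p) g J
      have h2 : tensorAmp m y' φ (J ∘ g) = tensorAmp m y' φ J := by
        funext q
        exact tensorAmp_permInvariant m y' (hφ.symm q) g J
      simp only at h1
      simp only [h1, h2]
    have hd : ∀ ρ, ∑ r ∈ Finset.range (s + 1), (s.choose r : ℂ) * (-1) ^ r *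
        ∑ M : Fin r → Fin 4, (∏ k, (eta (M k) : ℂ)) *
          (conj (tensorAmp m y ψ (escortIndex s r M) p) *
            shellDeriv ρ (tensorAmp m y' φ (escortIndex s r M)) p) = _ := fun ρ =>
      (sum_choose_neg_one_pow (hperm ρ)).symm.trans
        (sum_conj_tensorAmp_mul_shellDeriv hm hφ ψ y hp ρ)
    have hs := sum_spinContr hm hψ hφ h
    calc _ = lowMom m σ p * (∑ r ∈ Finset.range (s + 1), (s.choose r : ℂ) * (-1) ^ r *
        ∑ M : Fin r → Fin 4, (∏ k, (eta (M k) : ℂ)) *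
          (conj (tensorAmp m y ψ (escortIndex s r M) p) *
            shellDeriv τ (tensorAmp m y' φ (escortIndex s r M)) p))
        - lowMom m τ p * (∑ r ∈ Finset.range (s + 1), (s.choose r : ℂ) * (-1) ^ r *
        ∑ M : Fin r → Fin 4, (∏ k, (eta (M k) : ℂ)) *
          (conj (tensorAmp m y ψ (escortIndex s r M) p) *
            shellDeriv σ (tensorAmp m y' φ (escortIndex s r M)) p))
        + (∑ r ∈ Finset.range (s + 1), (s.choose r : ℂ) * (-1) ^ r * ((r : ℂ) *
      spinContr (fun M : Fin r → Fin 4 => tensorAmp m y ψ (escortIndex s r M) p)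
        (fun M => tensorAmp m y' φ (escortIndex s r M) p) σ τ))
        - (∑ r ∈ Finset.range (s + 1), (s.choose r : ℂ) * (-1) ^ r * ((r : ℂ) *
      spinContr (fun M : Fin r → Fin 4 => tensorAmp m y ψ (escortIndex s r M) p)
        (fun M => tensorAmp m y' φ (escortIndex s r M) p) τ σ)) := by
          rw [Finset.mul_sum, Finset.mul_sum, ← Finset.sum_sub_distrib, ← Finset.sum_add_distrib,
            ← Finset.sum_sub_distrib]
          refine Finset.sum_congr rfl fun r _ => ?_
          have e : ∑ M : Fin r → Fin 4, (∏ k, (eta (M k) : ℂ)) *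
              (conj (tensorAmp m y ψ (escortIndex s r M) p) *
              (lowMom m σ p * shellDeriv τ (tensorAmp m y' φ (escortIndex s r M)) p
              - lowMom m τ p * shellDeriv σ (tensorAmp m y' φ (escortIndex s r M)) p))
              = lowMom m σ p * (∑ M : Fin r → Fin 4, (∏ k, (eta (M k) : ℂ)) *
              (conj (tensorAmp m y ψ (escortIndex s r M) p) *
              shellDeriv τ (tensorAmp m y' φ (escortIndex s r M)) p))
              - lowMom m τ p * (∑ M : Fin r → Fin 4, (∏ k, (eta (M k) : ℂ)) *
              (conj (tensorAmp m y ψ (escortIndex s r M) p) *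
              shellDeriv σ (tensorAmp m y' φ (escortIndex s r M)) p)) := by
            rw [Finset.mul_sum, Finset.mul_sum, ← Finset.sum_sub_distrib]
            exact Finset.sum_congr rfl fun M _ => by ring
          rw [e]
          ring
      _ = _ := by
          rw [hd, hd, hs, hs, Finset.mul_sum, Finset.mul_sum, Finset.mul_sum,
            ← Finset.sum_sub_distrib, ← sub_eq_add_neg, ← Finset.sum_sub_distrib, sub_neg_eq_add,
            ← Finset.sum_add_distrib]
          refine Finset.sum_congr rfl fun I _ => ?_
          have e : ∑ a : Fin s, ∑ l : Fin 3,
              (spinMat m p σ τ (I a) l : ℂ) * φ p (Function.update I a l)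
              = lowMom m σ p * (∑ a, slotAction (fun k l => (spinConn m y y' p τ k l : ℂ)) a
                  (φ p) I)
                - lowMom m τ p * (∑ a, slotAction (fun k l => (spinConn m y y' p σ k l : ℂ)) a
                  (φ p) I)
                - (∑ a, slotAction (fun k l =>
                    ((lowPot m y p σ k * lowPot m y' p τ l : ℝ) : ℂ)) a (φ p) I)
                + ∑ a, slotAction (fun k l =>
                    ((lowPot m y p τ k * lowPot m y' p σ l : ℝ) : ℂ)) a (φ p) I := by
            simp only [slotAction, Finset.mul_sum, ← Finset.sum_sub_distrib,
              ← Finset.sum_add_distrib]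
            refine Finset.sum_congr rfl fun a _ => Finset.sum_congr rfl fun l _ => ?_
            rw [← spinMat_eq m p y y' σ τ]
            push_cast
            ring
          simp only [oneM, momDeriv_eq_shellDeriv, e]
          linear_combination ((conj (ψ p I)) * (lowMom m σ p * shellDeriv τ (fun q => φ q I) p
            - lowMom m τ p * shellDeriv σ (fun q => φ q I) p
            + (lowMom m σ p * (∑ a, slotAction (fun k l => (spinConn m y y' p τ k l : ℂ)) a
                  (φ p) I)
                - lowMom m τ p * (∑ a, slotAction (fun k l => (spinConn m y y' p σ k l : ℂ)) a
                  (φ p) I)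
                - (∑ a, slotAction (fun k l =>
                    ((lowPot m y p σ k * lowPot m y' p τ l : ℝ) : ℂ)) a (φ p) I)
                + ∑ a, slotAction (fun k l =>
                    ((lowPot m y p τ k * lowPot m y' p σ l : ℝ) : ℂ)) a (φ p) I))) *
            Complex.I_mul_I
  · have h1 : ∀ J, p ∉ tsupport (tensorAmp m y' φ J) := fun J hJ => hp (by
      refine closure_mono (fun q hq => ?_) hJ
      intro h0
      refine hq ?_
      simp [tensorAmp, h0])
    have h2 : ∀ J, tensorAmp m y' φ J p = 0 := fun J => tensorAmp_eq_zero hp J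
    have h3 : ∀ (r : ℕ) (ρ ρ' : Fin 4) (A : (Fin r → Fin 4) → ℂ),
        spinContr A (fun _ => 0) ρ ρ' = 0 := by
      intro r ρ ρ' A
      cases r with
      | zero => rfl
      | succ r => simp [spinContr]
    have h4 : ∀ I, p ∉ tsupport (fun q => φ q I) := fun I hI =>
      hp (tsupport_component_subset φ I hI)
    simp [shellDeriv_of_notMem_tsupport _ (h1 _), h2, h3, oneM, momDeriv_eq_shellDeriv,
      shellDeriv_of_notMem_tsupport _ (h4 _), wave_eq_zero hp]

end Amplitudes

/-! ### Convergent integrals with their values -/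

/-- The function `f` is integrable, with integral `I`. -/
def HasInt (f : E3 → ℂ) (I : ℂ) : Prop := Integrable f ∧ ∫ x, f x = I

namespace HasInt

variable {f g : E3 → ℂ} {I J : ℂ}

lemma zero : HasInt (fun _ => 0) 0 := ⟨integrable_zero _ _ _, integral_zero _ _⟩

lemma add (hf : HasInt f I) (hg : HasInt g J) : HasInt (fun x => f x + g x) (I + J) :=
  ⟨hf.1.add hg.1, by rw [integral_add hf.1 hg.1, hf.2, hg.2]⟩

lemma sub (hf : HasInt f I) (hg : HasInt g J) : HasInt (fun x => f x - g x) (I - J) :=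
  ⟨hf.1.sub hg.1, by rw [integral_sub hf.1 hg.1, hf.2, hg.2]⟩

lemma const_mul (hf : HasInt f I) (c : ℂ) : HasInt (fun x => c * f x) (c * I) :=
  ⟨hf.1.const_mul c, by rw [integral_const_mul, hf.2]⟩

lemma conj_int (hf : HasInt f I) : HasInt (fun x => conj (f x)) (conj I) := by
  refine ⟨?_, by rw [integral_conj, hf.2]⟩
  exact (Complex.conjCLE : ℂ →L[ℝ] ℂ).integrable_comp hf.1

lemma sum {ι : Type*} (S : Finset ι) {f : ι → E3 → ℂ} {I : ι → ℂ}
    (h : ∀ i ∈ S, HasInt (f i) (I i)) : HasInt (fun x => ∑ i ∈ S, f i x) (∑ i ∈ S, I i) :=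
  ⟨integrable_finsetSum _ fun i hi => (h i hi).1, by
    rw [integral_finsetSum _ fun i hi => (h i hi).1]
    exact Finset.sum_congr rfl fun i hi => (h i hi).2⟩

lemma congr_fun (hf : HasInt f I) (h : ∀ x, g x = f x) : HasInt g I := by
  rw [funext h]
  exact hf

end HasInt

lemma IsAmp.hasInt_density {m : ℝ} {a b : E3 → ℂ} (ha : IsAmp m a) (hb : IsAmp m b)
    {g : E3 → ℂ} (hg : ∀ p, omega m p ≠ 0 → ContDiffAt ℝ ∞ g p) :
    HasInt (fun p => (shellDensity m p : ℂ) * (g p * (conj (a p) * b p)))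
      (∫ p, (shellDensity m p : ℂ) * (g p * (conj (a p) * b p))) :=
  ⟨(IsAmp.mul (a := fun p => conj (a p) * b p)
      (hb.mul fun _ _ => ha.conj_amp.smooth.contDiffAt)
      fun p hp => hg p (hb.omega_ne p (tsupport_mul_subset_right hp))).mul_density.integrable, rfl⟩

/-! ### Matrix elements of quadratic densities -/

section Quadratic

variable {s : ℕ} {m : ℝ} {S : Finset (Wave s)} {Ψ Φ : Fock s}

lemma lr2_eq_sum (hΨ : Ψ ∈ MvPolynomial.supported ℂ (S : Set (Wave s)))
    (hΦ : Φ ∈ MvPolynomial.supported ℂ (S : Set (Wave s))) (X Y : Wave s → M4 → ℂ)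
    (μ ν : Fin 4) (x : M4) :
    lr2 m X Y μ ν x Ψ Φ = ∑ ψ ∈ S, ∑ φ ∈ S,
      (fockInner m Ψ (MvPolynomial.pderiv ψ (MvPolynomial.pderiv φ Φ)) *
          diff2 μ ν (X ψ) (Y φ) x
      + fockInner m (MvPolynomial.pderiv ψ Ψ) (MvPolynomial.pderiv φ Φ) *
        (diff2 μ ν (fun z => conj (X ψ z)) (Y φ) x + diff2 μ ν (fun z => conj (Y ψ z)) (X φ) x)
      + fockInner m (MvPolynomial.pderiv ψ (MvPolynomial.pderiv φ Ψ)) Φ *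
          conj (diff2 μ ν (X ψ) (Y φ) x)) := by
  rw [lr2, wick_eq_sum m _ _ S Ψ Φ hΨ hΦ, wick_eq_sum m _ _ S Ψ Φ hΨ hΦ,
    wick_eq_sum m _ _ S Ψ Φ hΨ hΦ, wick_eq_sum m _ _ S Ψ Φ hΨ hΦ]
  simp only [← Finset.sum_sub_distrib, ← Finset.sum_add_distrib]
  refine Finset.sum_congr rfl fun ψ _ => Finset.sum_congr rfl fun φ _ => ?_
  simp only [diff2, pd_conj, map_add, map_sub, map_mul]
  ring

/-- The single arrow is antisymmetric, so the mixed term with the two fields exchanged enters with a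
minus sign, in contrast to the double arrow. -/
lemma lr1_eq_sum (hΨ : Ψ ∈ MvPolynomial.supported ℂ (S : Set (Wave s)))
    (hΦ : Φ ∈ MvPolynomial.supported ℂ (S : Set (Wave s))) (X Y : Wave s → M4 → ℂ)
    (μ : Fin 4) (x : M4) :
    lr1 m X Y μ x Ψ Φ = ∑ ψ ∈ S, ∑ φ ∈ S,
      (fockInner m Ψ (MvPolynomial.pderiv ψ (MvPolynomial.pderiv φ Φ)) * diff1 μ (X ψ) (Y φ) x
      + fockInner m (MvPolynomial.pderiv ψ Ψ) (MvPolynomial.pderiv φ Φ) *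
        (diff1 μ (fun z => conj (X ψ z)) (Y φ) x - diff1 μ (fun z => conj (Y ψ z)) (X φ) x)
      + fockInner m (MvPolynomial.pderiv ψ (MvPolynomial.pderiv φ Ψ)) Φ *
          conj (diff1 μ (X ψ) (Y φ) x)) := by
  rw [lr1, wick_eq_sum m _ _ S Ψ Φ hΨ hΦ, wick_eq_sum m _ _ S Ψ Φ hΨ hΦ]
  simp only [← Finset.sum_sub_distrib]
  refine Finset.sum_congr rfl fun ψ _ => Finset.sum_congr rfl fun φ _ => ?_
  simp only [diff1, pd_conj, map_sub, map_mul]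
  ring

variable {A B : Wave s → E3 → ℂ} {X Y : Wave s → M4 → ℂ}

lemma hasInt_lr2 (hΨ : Ψ ∈ MvPolynomial.supported ℂ (S : Set (Wave s)))
    (hΦ : Φ ∈ MvPolynomial.supported ℂ (S : Set (Wave s)))
    (hA : ∀ φ ∈ S, IsAmp m (A φ)) (hB : ∀ φ ∈ S, IsAmp m (B φ))
    (hX : ∀ φ ∈ S, X φ = field m (A φ)) (hY : ∀ φ ∈ S, Y φ = field m (B φ))
    (σ : Fin 4) (t : ℝ) :
    HasInt (fun x => lr2 m X Y 0 σ (fourVec t x) Ψ Φ)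
      (∑ ψ ∈ S, ∑ φ ∈ S, fockInner m (MvPolynomial.pderiv ψ Ψ) (MvPolynomial.pderiv φ Φ) *
        ((∫ p, (shellDensity m p : ℂ) * (-2 * lowMom m σ p * (conj (A ψ p) * B φ p)))
        + ∫ p, (shellDensity m p : ℂ) * (-2 * lowMom m σ p * (conj (B ψ p) * A φ p)))) := by
  simp only [lr2_eq_sum hΨ hΦ]
  refine HasInt.sum _ fun ψ hψ => HasInt.sum _ fun φ hφ => ?_
  rw [hX ψ hψ, hX φ hφ, hY ψ hψ, hY φ hφ]
  have h1 : HasInt _ 0 := integral_diff2_field (hA ψ hψ) (hB φ hφ) σ t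
  have h2 : HasInt _ _ := integral_diff2_conj_field (hA ψ hψ) (hB φ hφ) σ t
  have h3 : HasInt _ _ := integral_diff2_conj_field (hB ψ hψ) (hA φ hφ) σ t
  have h := ((h1.const_mul (fockInner m Ψ
    (MvPolynomial.pderiv ψ (MvPolynomial.pderiv φ Φ)))).add ((h2.add h3).const_mul
      (fockInner m (MvPolynomial.pderiv ψ Ψ) (MvPolynomial.pderiv φ Φ)))).add
      (h1.conj_int.const_mul
        (fockInner m (MvPolynomial.pderiv ψ (MvPolynomial.pderiv φ Ψ)) Φ))
  simpa using h

/-- Contribution to `∫ x_σ (f ∂_0↔ ∂_τ↔ g)` from one creation and one annihilation operator. -/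
def lorentzPairing (m t : ℝ) (σ τ : Fin 4) (a b : E3 → ℂ) : ℂ :=
  ∫ p : E3, (shellDensity m p : ℂ) * (conj (a p) *
    (2 * Complex.I * lowMom m τ p * shellDeriv σ b p + symCoeff m t σ τ p * b p))

/-- Contribution to `∫ x_σ (f ∂_0↔ ∂_τ↔ g)` from two annihilation operators. -/
def reflectPairing (m t : ℝ) (σ τ : Fin 4) (a b : E3 → ℂ) : ℂ :=
  ∫ p : E3, (shellDensity m p : ℂ) * (-Complex.I * dOmega m σ p * dOmega m τ p *
    (Complex.exp (-2 * Complex.I * (t * omega m p : ℝ)) * a (-p) * b p))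

lemma reflectPairing_symm (m t : ℝ) (σ τ : Fin 4) (a b : E3 → ℂ) :
    reflectPairing m t σ τ a b = reflectPairing m t τ σ a b := by
  unfold reflectPairing
  congr 1
  funext p
  ring

lemma hasInt_pos_mul_lr2 (hΨ : Ψ ∈ MvPolynomial.supported ℂ (S : Set (Wave s)))
    (hΦ : Φ ∈ MvPolynomial.supported ℂ (S : Set (Wave s)))
    (hA : ∀ φ ∈ S, IsAmp m (A φ)) (hB : ∀ φ ∈ S, IsAmp m (B φ))
    (hX : ∀ φ ∈ S, X φ = field m (A φ)) (hY : ∀ φ ∈ S, Y φ = field m (B φ))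
    (σ τ : Fin 4) (t : ℝ) :
    HasInt (fun x => (lowPos σ (fourVec t x) : ℂ) * lr2 m X Y 0 τ (fourVec t x) Ψ Φ)
      (∑ ψ ∈ S, ∑ φ ∈ S,
        (fockInner m Ψ (MvPolynomial.pderiv ψ (MvPolynomial.pderiv φ Φ)) *
          reflectPairing m t σ τ (A ψ) (B φ)
        + fockInner m (MvPolynomial.pderiv ψ Ψ) (MvPolynomial.pderiv φ Φ) *
          (lorentzPairing m t σ τ (A ψ) (B φ) + lorentzPairing m t σ τ (B ψ) (A φ))
        + fockInner m (MvPolynomial.pderiv ψ (MvPolynomial.pderiv φ Ψ)) Φ *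
          conj (reflectPairing m t σ τ (A ψ) (B φ)))) := by
  simp only [lr2_eq_sum hΨ hΦ, Finset.mul_sum]
  refine HasInt.sum _ fun ψ hψ => HasInt.sum _ fun φ hφ => ?_
  rw [hX ψ hψ, hX φ hφ, hY ψ hψ, hY φ hφ]
  have h1 : HasInt _ (reflectPairing m t σ τ (A ψ) (B φ)) :=
    integral_pos_mul_diff2_field (hA ψ hψ) (hB φ hφ) σ τ t
  have h2 : HasInt _ (lorentzPairing m t σ τ (A ψ) (B φ)) :=
    integral_pos_mul_diff2_conj_field (hA ψ hψ) (hB φ hφ) σ τ t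
  have h3 : HasInt _ (lorentzPairing m t σ τ (B ψ) (A φ)) :=
    integral_pos_mul_diff2_conj_field (hB ψ hψ) (hA φ hφ) σ τ t
  have h := ((h1.const_mul (fockInner m Ψ
    (MvPolynomial.pderiv ψ (MvPolynomial.pderiv φ Φ)))).add ((h2.add h3).const_mul
      (fockInner m (MvPolynomial.pderiv ψ Ψ) (MvPolynomial.pderiv φ Φ)))).add
      (h1.conj_int.const_mul
        (fockInner m (MvPolynomial.pderiv ψ (MvPolynomial.pderiv φ Ψ)) Φ))
  refine h.congr_fun fun x => ?_
  simp only [map_mul, Complex.conj_ofReal]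
  ring

lemma hasInt_lr1 (hΨ : Ψ ∈ MvPolynomial.supported ℂ (S : Set (Wave s)))
    (hΦ : Φ ∈ MvPolynomial.supported ℂ (S : Set (Wave s)))
    (hA : ∀ φ ∈ S, IsAmp m (A φ)) (hB : ∀ φ ∈ S, IsAmp m (B φ))
    (hX : ∀ φ ∈ S, X φ = field m (A φ)) (hY : ∀ φ ∈ S, Y φ = field m (B φ)) (t : ℝ) :
    HasInt (fun x => lr1 m X Y 0 (fourVec t x) Ψ Φ)
      (∑ ψ ∈ S, ∑ φ ∈ S, fockInner m (MvPolynomial.pderiv ψ Ψ) (MvPolynomial.pderiv φ Φ) *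
        ((∫ p, (shellDensity m p : ℂ) * (-Complex.I * (conj (A ψ p) * B φ p)))
        - ∫ p, (shellDensity m p : ℂ) * (-Complex.I * (conj (B ψ p) * A φ p)))) := by
  simp only [lr1_eq_sum hΨ hΦ]
  refine HasInt.sum _ fun ψ hψ => HasInt.sum _ fun φ hφ => ?_
  rw [hX ψ hψ, hX φ hφ, hY ψ hψ, hY φ hφ]
  have h1 : HasInt _ 0 := integral_diff1_field (hA ψ hψ) (hB φ hφ) t
  have h2 : HasInt _ _ := integral_diff1_conj_field (hA ψ hψ) (hB φ hφ) t
  have h3 : HasInt _ _ := integral_diff1_conj_field (hB ψ hψ) (hA φ hφ) t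
  have h := ((h1.const_mul (fockInner m Ψ
    (MvPolynomial.pderiv ψ (MvPolynomial.pderiv φ Φ)))).add ((h2.sub h3).const_mul
      (fockInner m (MvPolynomial.pderiv ψ Ψ) (MvPolynomial.pderiv φ Φ)))).add
      (h1.conj_int.const_mul
        (fockInner m (MvPolynomial.pderiv ψ (MvPolynomial.pderiv φ Ψ)) Φ))
  simpa using h

end Quadratic

/-! ### Generators from fields with given amplitudes -/

section Generators

variable {s : ℕ} {m : ℝ} {y y' : E3 → Fin 3 → ℝ} {ψ φ : Wave s}

/-- Contribution of the rank `r` fields to the matrix elements of the momentum. -/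
def momPairing (m : ℝ) (y y' : E3 → Fin 3 → ℝ) (r : ℕ) (σ : Fin 4) (ψ φ : Wave s) : ℂ :=
  ∑ M : Fin r → Fin 4, (∏ k, (eta (M k) : ℂ)) * ∫ p, (shellDensity m p : ℂ) *
    (-2 * lowMom m σ p * (conj (tensorAmp m y ψ (escortIndex s r M) p)
      * tensorAmp m y' φ (escortIndex s r M) p))

/-- Contribution of the rank `r` fields to the orbital part of the Lorentz generators. -/
def orbitalPairing (m : ℝ) (y y' : E3 → Fin 3 → ℝ) (t : ℝ) (r : ℕ) (σ τ : Fin 4) (ψ φ : Wave s) :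
    ℂ :=
  ∑ M : Fin r → Fin 4, (∏ k, (eta (M k) : ℂ)) *
    lorentzPairing m t σ τ (tensorAmp m y ψ (escortIndex s r M))
      (tensorAmp m y' φ (escortIndex s r M))

/-- Contribution of the rank `r` fields to the spin part of the Lorentz generators. -/
def spinPairing (m : ℝ) (y y' : E3 → Fin 3 → ℝ) (r : ℕ) (σ τ : Fin 4) (ψ φ : Wave s) : ℂ :=
  ∫ p, (shellDensity m p : ℂ) * (-Complex.I *
    spinContr (fun M : Fin r → Fin 4 => tensorAmp m y ψ (escortIndex s r M) p)
      (fun M => tensorAmp m y' φ (escortIndex s r M) p) σ τ)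

lemma waveInner_eq (m : ℝ) (ψ φ : Wave s) :
    waveInner m ψ φ = ∫ p : E3, (shellDensity m p : ℂ) * ∑ I, conj (ψ p I) * φ p I := rfl

/-- The prefactors give (-1/4)(-2) = 1/2. The other half of the generator comes from the mixed Wick
term in which y and y' are exchanged. -/
theorem sum_momPairing (hm : 0 ≤ m) (hψ : IsGoodWave m y ψ) (hφ : IsGoodWave m y' φ)
    (σ : Fin 4) :
    ∑ r ∈ Finset.range (s + 1), (s.choose r : ℂ) * (-1) ^ r * (-(1 / 4) *
      momPairing m y y' r σ ψ φ) = 1 / 2 * waveInner m ψ (oneP m σ φ) := by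
  have h1 : ∀ r, HasInt _ (momPairing m y y' r σ ψ φ) := fun r =>
    HasInt.sum _ fun M _ => (IsAmp.hasInt_density (hψ.isAmp_tensorAmp hm _)
      (hφ.isAmp_tensorAmp hm _) fun p hp => contDiffAt_const.mul
        (contDiffAt_ofReal (contDiffAt_lowMom hp σ))).const_mul _
  have h2 := HasInt.sum (Finset.range (s + 1)) fun r _ =>
    ((h1 r).const_mul (-(1 / 4))).const_mul ((s.choose r : ℂ) * (-1) ^ r)
  rw [← h2.2, waveInner_eq, ← integral_const_mul]
  congr 1
  funext p
  have h3 := sum_conj_tensorAmp_mul_tensorAmp hm hψ hφ p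
  have h4 : ∑ I, conj (ψ p I) * oneP m σ φ p I
      = lowMom m σ p * ∑ I, conj (ψ p I) * φ p I := by
    rw [Finset.mul_sum]
    exact Finset.sum_congr rfl fun I _ => by simp only [oneP]; ring
  rw [h4, ← h3]
  simp only [Finset.mul_sum]
  refine Finset.sum_congr rfl fun r _ => Finset.sum_congr rfl fun M _ => ?_
  ring

lemma hasInt_spinPairing (hm : 0 ≤ m) (hψ : IsGoodWave m y ψ) (hφ : IsGoodWave m y' φ)
    (r : ℕ) (σ τ : Fin 4) :
    HasInt (fun p => (shellDensity m p : ℂ) * (-Complex.I *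
      spinContr (fun M : Fin r → Fin 4 => tensorAmp m y ψ (escortIndex s r M) p)
        (fun M => tensorAmp m y' φ (escortIndex s r M) p) σ τ))
      (spinPairing m y y' r σ τ ψ φ) := by
  refine ⟨?_, rfl⟩
  cases r with
  | zero => simp [spinContr]
  | succ r =>
    have h := HasInt.sum Finset.univ fun (N : Fin r → Fin 4) _ =>
      (IsAmp.hasInt_density (m := m) (hψ.isAmp_tensorAmp hm
        (escortIndex s (r + 1) (Fin.cons σ N))) (hφ.isAmp_tensorAmp hm
        (escortIndex s (r + 1) (Fin.cons τ N))) (g := fun _ => -Complex.I)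
        fun p _ => contDiffAt_const).const_mul (∏ k, (eta (N k) : ℂ))
    refine (h.congr_fun fun p => ?_).1
    simp only [spinContr, Finset.mul_sum]
    exact Finset.sum_congr rfl fun N _ => by ring

/-- Antisymmetrization removes `symCoeff`. The orbital prefactor (-1/4)(-2i) and the spin prefactor
-(r/2)(-i) are i/2 and ir/2, precisely the combination evaluated in `sum_lorentz_amplitude`. -/
theorem sum_lorentzPairing (hm : 0 ≤ m) (hψ : IsGoodWave m y ψ) (hφ : IsGoodWave m y' φ)
    (t : ℝ) (σ τ : Fin 4) :
    ∑ r ∈ Finset.range (s + 1), (s.choose r : ℂ) * (-1) ^ r *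
      (-(1 / 4) * (orbitalPairing m y y' t r σ τ ψ φ - orbitalPairing m y y' t r τ σ ψ φ)
        - (r / 2 : ℂ) * (spinPairing m y y' r σ τ ψ φ - spinPairing m y y' r τ σ ψ φ))
      = 1 / 2 * waveInner m ψ (oneM m σ τ φ) := by
  have hsym : ∀ ρ ρ' : Fin 4, ∀ p, omega m p ≠ 0 → ContDiffAt ℝ ∞ (symCoeff m t ρ ρ') p := by
    intro ρ ρ' p hp
    have hd : ContDiffAt ℝ ∞ (dMom m ρ ρ') p := contDiffAt_const.sub
      ((contDiffAt_const.mul (contDiffAt_lowMom hp ρ)).div (contDiffAt_omega hp) hp)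
    exact (contDiffAt_const.mul (contDiffAt_ofReal ((contDiffAt_const.mul hd).sub
      (((contDiffAt_lowMom hp ρ').mul (contDiffAt_dOmega hp ρ)).div
        (contDiffAt_omega hp) hp)))).sub (contDiffAt_ofReal
      (((contDiffAt_const.mul (contDiffAt_lowMom hp ρ')).mul (contDiffAt_lowMom hp ρ)).div
        (contDiffAt_omega hp) hp))
  have hpair : ∀ (a b : E3 → ℂ), IsAmp m a → IsAmp m b → ∀ ρ ρ', HasInt
      (fun p => (shellDensity m p : ℂ) * (conj (a p) * (2 * Complex.I * lowMom m ρ' p *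
        shellDeriv ρ b p + symCoeff m t ρ ρ' p * b p))) (lorentzPairing m t ρ ρ' a b) := by
    intro a b ha hb ρ ρ'
    refine ⟨?_, rfl⟩
    have h1 := (IsAmp.hasInt_density ha (hb.shellDeriv ρ) (g := fun p => 2 * Complex.I *
      lowMom m ρ' p) fun p hp => contDiffAt_const.mul
        (contDiffAt_ofReal (contDiffAt_lowMom hp ρ'))).add
      (IsAmp.hasInt_density ha hb (hsym ρ ρ'))
    exact (h1.congr_fun fun p => by ring).1
  have horb : ∀ r ρ ρ', HasInt _ (orbitalPairing m y y' t r ρ ρ' ψ φ) := fun r ρ ρ' =>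
    HasInt.sum _ fun M _ => (hpair _ _ (hψ.isAmp_tensorAmp hm _) (hφ.isAmp_tensorAmp hm _)
      ρ ρ').const_mul _
  have h2 := HasInt.sum (Finset.range (s + 1)) fun r _ =>
    ((((horb r σ τ).sub (horb r τ σ)).const_mul (-(1 / 4))).sub
      (((hasInt_spinPairing hm hψ hφ r σ τ).sub
        (hasInt_spinPairing hm hψ hφ r τ σ)).const_mul (r / 2 : ℂ))).const_mul
      ((s.choose r : ℂ) * (-1) ^ r)
  rw [← h2.2, waveInner_eq, ← integral_const_mul]
  congr 1
  funext p
  have h3 := sum_lorentz_amplitude hm hψ hφ p σ τ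
  have h4 : ∑ I, conj (ψ p I) * oneM m σ τ φ p I
      = Complex.I * (-Complex.I * ∑ I, conj (ψ p I) * oneM m σ τ φ p I) := by
    linear_combination (∑ I, conj (ψ p I) * oneM m σ τ φ p I) * Complex.I_mul_I
  rw [h4, ← h3, Finset.mul_sum, Finset.mul_sum, Finset.mul_sum]
  refine Finset.sum_congr rfl fun r _ => ?_
  have h5 : ∀ M : Fin r → Fin 4, (∏ k, (eta (M k) : ℂ)) * ((shellDensity m p : ℂ) *
      (conj (tensorAmp m y ψ (escortIndex s r M) p) *
        (2 * Complex.I * lowMom m τ p * shellDeriv σ (tensorAmp m y' φ (escortIndex s r M)) p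
          + symCoeff m t σ τ p * tensorAmp m y' φ (escortIndex s r M) p)))
      - (∏ k, (eta (M k) : ℂ)) * ((shellDensity m p : ℂ) *
      (conj (tensorAmp m y ψ (escortIndex s r M) p) *
        (2 * Complex.I * lowMom m σ p * shellDeriv τ (tensorAmp m y' φ (escortIndex s r M)) p
          + symCoeff m t τ σ p * tensorAmp m y' φ (escortIndex s r M) p)))
      = -2 * Complex.I * shellDensity m p * ((∏ k, (eta (M k) : ℂ)) *
        (conj (tensorAmp m y ψ (escortIndex s r M) p) *
          (lowMom m σ p * shellDeriv τ (tensorAmp m y' φ (escortIndex s r M)) p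
            - lowMom m τ p * shellDeriv σ (tensorAmp m y' φ (escortIndex s r M)) p))) := by
    intro M
    -- The symmetry of `symCoeff` needs ω ≠ 0; at ω = 0 the density is zero and both sides vanish.
    by_cases h0 : omega m p = 0
    · simp [shellDensity, h0]
    · rw [symCoeff_symm h0 t σ τ]
      ring
  rw [← Finset.sum_sub_distrib, Finset.sum_congr rfl fun M _ => h5 M, ← Finset.mul_sum]
  ring

variable {S : Finset (Wave s)} {Ψ Φ : Fock s}

/-- The fields of rank `r` have the amplitudes given by `y`. -/
def HasAmplitudes {s r : ℕ} (m : ℝ) (y : E3 → Fin 3 → ℝ) (S : Finset (Wave s)) (X : QTen s r) :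
    Prop :=
  ∀ φ ∈ S, IsGoodWave m y φ ∧
    ∀ M : Fin r → Fin 4, (fun x => X φ x M) = field m (tensorAmp m y φ (escortIndex s r M))

theorem hasInt_momDensity {r : ℕ} {X Y : QTen s r} (hm : 0 ≤ m)
    (hΨ : Ψ ∈ MvPolynomial.supported ℂ (S : Set (Wave s)))
    (hΦ : Φ ∈ MvPolynomial.supported ℂ (S : Set (Wave s)))
    (hX : HasAmplitudes m y S X) (hY : HasAmplitudes m y' S Y) (σ : Fin 4) (t : ℝ) :
    HasInt (fun x => momDensity m X Y σ (fourVec t x) Ψ Φ)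
      (∑ ψ ∈ S, ∑ φ ∈ S, fockInner m (MvPolynomial.pderiv ψ Ψ) (MvPolynomial.pderiv φ Φ) *
        (-(1 / 4) * momPairing m y y' r σ ψ φ + -(1 / 4) * momPairing m y' y r σ ψ φ)) := by
  have h := HasInt.const_mul (HasInt.sum Finset.univ fun (M : Fin r → Fin 4) _ =>
    (hasInt_lr2 hΨ hΦ (A := fun φ => tensorAmp m y φ (escortIndex s r M))
      (B := fun φ => tensorAmp m y' φ (escortIndex s r M))
      (X := fun φ x => X φ x M) (Y := fun φ x => Y φ x M)
      (fun φ hφ => (hX φ hφ).1.isAmp_tensorAmp hm _) (fun φ hφ => (hY φ hφ).1.isAmp_tensorAmp hm _)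
      (fun φ hφ => (hX φ hφ).2 M) (fun φ hφ => (hY φ hφ).2 M) σ t).const_mul
      (∏ k, (eta (M k) : ℂ))) (-(1 / 4))
  refine ⟨h.1, h.2.trans ?_⟩
  simp only [Finset.mul_sum (s := S)]
  rw [Finset.sum_comm, Finset.mul_sum]
  refine Finset.sum_congr rfl fun ψ _ => ?_
  rw [Finset.sum_comm, Finset.mul_sum]
  refine Finset.sum_congr rfl fun φ _ => ?_
  simp only [momPairing, Finset.mul_sum, ← Finset.sum_add_distrib]
  exact Finset.sum_congr rfl fun M _ => by ring

lemma hasInt_pos_mul_contrDensity {r : ℕ} {X Y : QTen s r} (hm : 0 ≤ m)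
    (hΨ : Ψ ∈ MvPolynomial.supported ℂ (S : Set (Wave s)))
    (hΦ : Φ ∈ MvPolynomial.supported ℂ (S : Set (Wave s)))
    (hX : HasAmplitudes m y S X) (hY : HasAmplitudes m y' S Y) (σ τ : Fin 4) (t : ℝ) :
    HasInt (fun x => (lowPos σ (fourVec t x) : ℂ) * contrDensity m X Y τ (fourVec t x) Ψ Φ)
      (∑ ψ ∈ S, ∑ φ ∈ S, (∑ M : Fin r → Fin 4, (∏ k, (eta (M k) : ℂ)) *
        (fockInner m Ψ (MvPolynomial.pderiv ψ (MvPolynomial.pderiv φ Φ)) *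
          reflectPairing m t σ τ (tensorAmp m y ψ (escortIndex s r M))
            (tensorAmp m y' φ (escortIndex s r M))
        + fockInner m (MvPolynomial.pderiv ψ (MvPolynomial.pderiv φ Ψ)) Φ *
          conj (reflectPairing m t σ τ (tensorAmp m y ψ (escortIndex s r M))
            (tensorAmp m y' φ (escortIndex s r M))))
        + fockInner m (MvPolynomial.pderiv ψ Ψ) (MvPolynomial.pderiv φ Φ) *
          (orbitalPairing m y y' t r σ τ ψ φ + orbitalPairing m y' y t r σ τ ψ φ))) := by
  have h := HasInt.sum Finset.univ fun (M : Fin r → Fin 4) _ =>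
    (hasInt_pos_mul_lr2 hΨ hΦ (A := fun φ => tensorAmp m y φ (escortIndex s r M))
      (B := fun φ => tensorAmp m y' φ (escortIndex s r M))
      (X := fun φ x => X φ x M) (Y := fun φ x => Y φ x M)
      (fun φ hφ => (hX φ hφ).1.isAmp_tensorAmp hm _) (fun φ hφ => (hY φ hφ).1.isAmp_tensorAmp hm _)
      (fun φ hφ => (hX φ hφ).2 M) (fun φ hφ => (hY φ hφ).2 M) σ τ t).const_mul
      (∏ k, (eta (M k) : ℂ))
  have h' := h.congr_fun (g := fun x => (lowPos σ (fourVec t x) : ℂ) *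
    contrDensity m X Y τ (fourVec t x) Ψ Φ) fun x => by
      rw [contrDensity, Finset.mul_sum]
      exact Finset.sum_congr rfl fun M _ => by ring
  refine ⟨h'.1, h'.2.trans ?_⟩
  simp only [Finset.mul_sum (s := S)]
  rw [Finset.sum_comm]
  refine Finset.sum_congr rfl fun ψ _ => ?_
  rw [Finset.sum_comm]
  refine Finset.sum_congr rfl fun φ _ => ?_
  simp only [orbitalPairing, Finset.mul_sum, ← Finset.sum_add_distrib]
  exact Finset.sum_congr rfl fun M _ => by ring

/-- In the exchanged term the indices σ, τ are exchanged along with y, y', with a minus sign. After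
antisymmetrization in σ, τ both orders therefore contribute with the same sign. -/
lemma hasInt_spinDensity {r : ℕ} {X Y : QTen s r} (hm : 0 ≤ m)
    (hΨ : Ψ ∈ MvPolynomial.supported ℂ (S : Set (Wave s)))
    (hΦ : Φ ∈ MvPolynomial.supported ℂ (S : Set (Wave s)))
    (hX : HasAmplitudes m y S X) (hY : HasAmplitudes m y' S Y) (σ τ : Fin 4) (t : ℝ) :
    HasInt (fun x => spinDensity m X Y σ τ (fourVec t x) Ψ Φ)
      (∑ ψ ∈ S, ∑ φ ∈ S, fockInner m (MvPolynomial.pderiv ψ Ψ) (MvPolynomial.pderiv φ Φ) *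
        (spinPairing m y y' r σ τ ψ φ - spinPairing m y' y r τ σ ψ φ)) := by
  cases r with
  | zero => simpa [spinDensity, spinPairing, spinContr] using HasInt.zero
  | succ r =>
    have h := HasInt.sum Finset.univ fun (N : Fin r → Fin 4) _ =>
      (hasInt_lr1 hΨ hΦ (A := fun φ => tensorAmp m y φ (escortIndex s (r + 1) (Fin.cons σ N)))
        (B := fun φ => tensorAmp m y' φ (escortIndex s (r + 1) (Fin.cons τ N)))
        (X := fun φ x => X φ x (Fin.cons σ N)) (Y := fun φ x => Y φ x (Fin.cons τ N))
        (fun φ hφ => (hX φ hφ).1.isAmp_tensorAmp hm _)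
        (fun φ hφ => (hY φ hφ).1.isAmp_tensorAmp hm _)
        (fun φ hφ => (hX φ hφ).2 _) (fun φ hφ => (hY φ hφ).2 _) t).const_mul
        (∏ k, (eta (N k) : ℂ))
    refine ⟨h.1, h.2.trans ?_⟩
    have hs : ∀ {y₁ y₂ : E3 → Fin 3 → ℝ} {ψ φ : Wave s} (ρ ρ' : Fin 4), IsGoodWave m y₁ ψ →
        IsGoodWave m y₂ φ → spinPairing m y₁ y₂ (r + 1) ρ ρ' ψ φ
        = ∑ N : Fin r → Fin 4, (∏ k, (eta (N k) : ℂ)) * ∫ p, (shellDensity m p : ℂ) *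
          (-Complex.I * (conj (tensorAmp m y₁ ψ (escortIndex s (r + 1) (Fin.cons ρ N)) p)
            * tensorAmp m y₂ φ (escortIndex s (r + 1) (Fin.cons ρ' N)) p)) := by
      intro y₁ y₂ ψ φ ρ ρ' hψ hφ
      have h := HasInt.sum Finset.univ fun (N : Fin r → Fin 4) _ =>
        (IsAmp.hasInt_density (m := m) (hψ.isAmp_tensorAmp hm
          (escortIndex s (r + 1) (Fin.cons ρ N))) (hφ.isAmp_tensorAmp hm
          (escortIndex s (r + 1) (Fin.cons ρ' N))) (g := fun _ => -Complex.I)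
          fun p _ => contDiffAt_const).const_mul (∏ k, (eta (N k) : ℂ))
      rw [← h.2, spinPairing]
      congr 1
      funext p
      simp only [spinContr, Finset.mul_sum]
      exact Finset.sum_congr rfl fun N _ => by ring
    simp only [Finset.mul_sum (s := S)]
    rw [Finset.sum_comm]
    refine Finset.sum_congr rfl fun ψ hψ => ?_
    rw [Finset.sum_comm]
    refine Finset.sum_congr rfl fun φ hφ => ?_
    rw [hs σ τ (hX ψ hψ).1 (hY φ hφ).1, hs τ σ (hY ψ hψ).1 (hX φ hφ).1,
      ← Finset.sum_sub_distrib, Finset.mul_sum]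
    exact Finset.sum_congr rfl fun M _ => by ring

theorem integrable_lorDensity {r : ℕ} {X Y : QTen s r} (hm : 0 ≤ m)
    (hΨ : Ψ ∈ MvPolynomial.supported ℂ (S : Set (Wave s)))
    (hΦ : Φ ∈ MvPolynomial.supported ℂ (S : Set (Wave s)))
    (hX : HasAmplitudes m y S X) (hY : HasAmplitudes m y' S Y) (σ τ : Fin 4) (t : ℝ) :
    Integrable (fun x : E3 => lorDensity m X Y σ τ (fourVec t x) Ψ Φ) := by
  refine ((((hasInt_pos_mul_contrDensity hm hΨ hΦ hX hY σ τ t).const_mul (-(1 / 4))).sub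
    ((hasInt_spinDensity hm hΨ hΦ hX hY σ τ t).const_mul (r / 2 : ℂ))).congr_fun fun x => ?_).1
  rw [lorDensity, mul_assoc]

/-- The contributions of two annihilation or two creation operators are symmetric in σ, τ by
`reflectPairing_symm` and cancel in the difference. -/
theorem hasInt_lorDensity_sub {r : ℕ} {X Y : QTen s r} (hm : 0 ≤ m)
    (hΨ : Ψ ∈ MvPolynomial.supported ℂ (S : Set (Wave s)))
    (hΦ : Φ ∈ MvPolynomial.supported ℂ (S : Set (Wave s)))
    (hX : HasAmplitudes m y S X) (hY : HasAmplitudes m y' S Y) (σ τ : Fin 4) (t : ℝ) :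
    HasInt (fun x => lorDensity m X Y σ τ (fourVec t x) Ψ Φ
        - lorDensity m X Y τ σ (fourVec t x) Ψ Φ)
      (∑ ψ ∈ S, ∑ φ ∈ S, fockInner m (MvPolynomial.pderiv ψ Ψ) (MvPolynomial.pderiv φ Φ) *
        ((-(1 / 4) * (orbitalPairing m y y' t r σ τ ψ φ - orbitalPairing m y y' t r τ σ ψ φ)
          - (r / 2 : ℂ) * (spinPairing m y y' r σ τ ψ φ - spinPairing m y y' r τ σ ψ φ))
        + (-(1 / 4) * (orbitalPairing m y' y t r σ τ ψ φ - orbitalPairing m y' y t r τ σ ψ φ)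
          - (r / 2 : ℂ) * (spinPairing m y' y r σ τ ψ φ - spinPairing m y' y r τ σ ψ φ)))) := by
  have h1 := fun ρ ρ' => (((hasInt_pos_mul_contrDensity hm hΨ hΦ hX hY ρ ρ' t).const_mul
    (-(1 / 4))).sub ((hasInt_spinDensity hm hΨ hΦ hX hY ρ ρ' t).const_mul
      (r / 2 : ℂ))).congr_fun (g := fun x => lorDensity m X Y ρ ρ' (fourVec t x) Ψ Φ) fun x => by
      rw [lorDensity, mul_assoc]
  have h := (h1 σ τ).sub (h1 τ σ)
  refine ⟨h.1, h.2.trans ?_⟩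
  simp only [Finset.mul_sum (s := S), ← Finset.sum_sub_distrib]
  refine Finset.sum_congr rfl fun ψ _ => Finset.sum_congr rfl fun φ _ => ?_
  simp only [reflectPairing_symm m t τ σ]
  ring

end Generators

/-! ### String integration of free fields -/

section StringIntegration

variable {m : ℝ} {a : E3 → ℂ} {e : M4}

lemma mdot_add_smul (p x e : M4) (u : ℝ) : mdot p (x + u • e) = mdot p x + u * mdot p e := by
  simp only [mdot, Pi.add_apply, Pi.smul_apply, smul_eq_mul, Finset.mul_sum,
    ← Finset.sum_add_distrib]
  exact Finset.sum_congr rfl fun _ _ => by ring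

lemma planeWave_add_smul (m : ℝ) (x e : M4) (u : ℝ) (p : E3) :
    planeWave m (x + u • e) p
      = Complex.exp (-Complex.I * (u * mdot (onShell m p) e : ℝ)) * planeWave m x p := by
  rw [planeWave, planeWave, mdot_add_smul, ← Complex.exp_add]
  congr 1
  push_cast
  ring

lemma continuous_omega_uncurry : Continuous fun z : ℝ × E3 => omega z.1 z.2 := by
  unfold omega
  fun_prop

lemma continuous_onShell_uncurry (μ : Fin 4) : Continuous fun z : ℝ × E3 => onShell z.1 z.2 μ := by
  cases μ using Fin.cases with
  | zero => exact continuous_omega_uncurry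
  | succ i => exact (EuclideanSpace.proj i : E3 →L[ℝ] ℝ).continuous.comp continuous_snd

lemma continuous_mdot_onShell_uncurry (x : M4) :
    Continuous fun z : ℝ × E3 => mdot (onShell z.1 z.2) x := by
  unfold mdot
  exact continuous_finsetSum _ fun μ _ =>
    (continuous_const.mul (continuous_onShell_uncurry μ)).mul continuous_const

lemma continuous_mdot_onShell (m : ℝ) (x : M4) :
    Continuous fun p : E3 => mdot (onShell m p) x :=
  Continuous.comp (g := fun z : ℝ × E3 => mdot (onShell z.1 z.2) x) (f := fun p => (m, p))
    (continuous_mdot_onShell_uncurry x) (Continuous.prodMk_right m)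

lemma integral_exp_damped {ε : ℝ} (hε : 0 < ε) (c : ℝ) :
    ∫ u in Ioi (0 : ℝ), (rexp (-ε * u) : ℂ) * Complex.exp (-Complex.I * (u * c : ℝ))
      = 1 / (ε + Complex.I * c) := by
  have h := integral_exp_mul_complex_Ioi (a := -(ε + Complex.I * c)) (by simpa using hε) 0
  rw [← neg_div_neg_eq] at h
  simp only [neg_neg, Complex.ofReal_zero, mul_zero, Complex.exp_zero] at h
  rw [← h]
  refine integral_congr_ae (Eventually.of_forall fun u => ?_)
  simp only
  rw [Complex.ofReal_exp, ← Complex.exp_add]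
  congr 1
  push_cast
  ring

/-- Fubini: for ε > 0 the integrand is jointly integrable along the string and over the mass shell,
and the string integral of each plane wave is elementary. -/
lemma integral_damped_field (ha : IsAmp m a) (x : M4) {ε : ℝ} (hε : 0 < ε) :
    ∫ u in Ioi (0 : ℝ), (rexp (-ε * u) : ℂ) * field m a (x + u • e)
      = ∫ p, 1 / (ε + Complex.I * (mdot (onShell m p) e : ℝ)) *
          ((shellDensity m p : ℂ) * planeWave m x p * a p) := by
  have h1 : Integrable (fun u : ℝ => (rexp (-ε * u) : ℂ)) (volume.restrict (Ioi 0)) :=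
    (integrableOn_exp_mul_Ioi (neg_lt_zero.2 hε) 0).ofReal
  have h2 := h1.mul_prod (ha.integrable_field x)
  have hc : Continuous fun z : ℝ × E3 =>
      Complex.exp (-Complex.I * ((z.1 * mdot (onShell m z.2) e : ℝ) : ℂ)) :=
    (continuous_const.mul (Complex.continuous_ofReal.comp
      (continuous_fst.mul ((continuous_mdot_onShell m e).comp continuous_snd)))).cexp
  have h3 := h2.bdd_mul (c := 1) hc.aestronglyMeasurable
    (Eventually.of_forall fun z => by simp [Complex.norm_exp])
  have h4 : ∀ u : ℝ, (rexp (-ε * u) : ℂ) * field m a (x + u • e) = ∫ p,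
      Complex.exp (-Complex.I * ((u * mdot (onShell m p) e : ℝ) : ℂ)) *
        ((rexp (-ε * u) : ℂ) * ((shellDensity m p : ℂ) * planeWave m x p * a p)) := by
    intro u
    rw [field_eq, ← integral_const_mul]
    refine integral_congr_ae (Eventually.of_forall fun p => ?_)
    simp only [planeWave_add_smul]
    ring
  simp only [h4]
  rw [integral_integral_swap h3]
  refine integral_congr_ae (Eventually.of_forall fun p => ?_)
  simp only
  rw [← integral_exp_damped hε, ← integral_mul_const]
  refine integral_congr_ae (Eventually.of_forall fun u => ?_)
  simp only
  ring

lemma IsAmp.div_mdot (ha : IsAmp m a) (he : ∀ p ∈ tsupport a, mdot (onShell m p) e ≠ 0) :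
    IsAmp m (fun p => 1 / (Complex.I * (mdot (onShell m p) e : ℝ)) * a p) :=
  ha.mul fun p hp => by
    simp only [one_div]
    exact (contDiffAt_const.mul (contDiffAt_ofReal
      (contDiffAt_mdot_onShell (ha.omega_ne p hp) e))).inv
      (mul_ne_zero Complex.I_ne_zero (Complex.ofReal_ne_zero.2 (he p hp)))

/-- String integration multiplies the amplitude by `1 / (i pe)`. -/
lemma stringInt_field (ha : IsAmp m a) (he : ∀ p ∈ tsupport a, mdot (onShell m p) e ≠ 0) :
    stringInt e (field m a)
      = field m (fun p => 1 / (Complex.I * (mdot (onShell m p) e : ℝ)) * a p) := by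
  funext x
  refine Tendsto.limUnder_eq ?_
  have hlim : Tendsto (fun ε : ℝ => ∫ p, 1 / (ε + Complex.I * (mdot (onShell m p) e : ℝ)) *
      ((shellDensity m p : ℂ) * planeWave m x p * a p)) (𝓝[>] 0)
      (𝓝 (∫ p, 1 / (Complex.I * (mdot (onShell m p) e : ℝ)) *
        ((shellDensity m p : ℂ) * planeWave m x p * a p))) := by
    have hb := ((ha.div_mdot he).integrable_field x).norm
    refine tendsto_integral_filter_of_dominated_convergence _ ?_ ?_ hb ?_
    · refine Eventually.of_forall fun ε => AEStronglyMeasurable.mul ?_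
        (ha.integrable_field x).aestronglyMeasurable
      refine Measurable.aestronglyMeasurable (Measurable.const_div ?_ _)
      exact (continuous_const.add (continuous_const.mul (Complex.continuous_ofReal.comp
        (continuous_mdot_onShell m e)))).measurable
    · refine Eventually.of_forall fun ε => Eventually.of_forall fun p => ?_
      by_cases hp : p ∈ tsupport a
      · have h0 := he p hp
        rw [show (shellDensity m p : ℂ) * planeWave m x p *
          (1 / (Complex.I * (mdot (onShell m p) e : ℝ)) * a p)
          = 1 / (Complex.I * (mdot (onShell m p) e : ℝ)) *
            ((shellDensity m p : ℂ) * planeWave m x p * a p) by ring]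
        -- Since |ε + i(pe)| ≥ |pe|, the limiting integrand dominates all the damped ones. It is
        -- integrable because the support avoids the zeros of pe.
        have h1 : ‖1 / ((ε : ℂ) + Complex.I * (mdot (onShell m p) e : ℝ))‖
            ≤ ‖1 / (Complex.I * (mdot (onShell m p) e : ℝ) : ℂ)‖ := by
          rw [norm_div, norm_div]
          refine div_le_div_of_nonneg_left (norm_nonneg (1 : ℂ)) ?_ ?_
          · simpa using h0
          · have := Complex.abs_im_le_norm (ε + Complex.I * (mdot (onShell m p) e : ℝ))
            simpa using this
        have h2 := mul_le_mul_of_nonneg_right h1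
          (norm_nonneg ((shellDensity m p : ℂ) * planeWave m x p * a p))
        rwa [← norm_mul, ← norm_mul] at h2
      · simp [image_eq_zero_of_notMem_tsupport hp]
    · refine Eventually.of_forall fun p => ?_
      by_cases hp : p ∈ tsupport a
      · have h0 := he p hp
        refine Tendsto.mul_const _ (Tendsto.div tendsto_const_nhds ?_ (mul_ne_zero
          Complex.I_ne_zero (Complex.ofReal_ne_zero.2 h0)))
        refine tendsto_nhdsWithin_of_tendsto_nhds ?_
        have : Continuous fun ε : ℝ => (ε : ℂ) + Complex.I * (mdot (onShell m p) e : ℝ) := by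
          fun_prop
        simpa using this.tendsto 0
      · simp [image_eq_zero_of_notMem_tsupport hp]
  have hval : field m (fun p => 1 / (Complex.I * (mdot (onShell m p) e : ℝ)) * a p) x
      = ∫ p, 1 / (Complex.I * (mdot (onShell m p) e : ℝ)) *
        ((shellDensity m p : ℂ) * planeWave m x p * a p) := by
    rw [field_eq]
    exact integral_congr_ae (Eventually.of_forall fun p => by ring)
  rw [hval]
  refine hlim.congr' ?_
  filter_upwards [self_mem_nhdsWithin] with ε hε
  exact (integral_damped_field ha x hε).symm

lemma iterate_stringInt_field (ha : IsAmp m a)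
    (he : ∀ p ∈ tsupport a, mdot (onShell m p) e ≠ 0) (n : ℕ) :
    (stringInt e)^[n] (field m a)
      = field m (fun p => (1 / (Complex.I * (mdot (onShell m p) e : ℝ))) ^ n * a p) := by
  induction n generalizing a with
  | zero => simp
  | succ n ih =>
    rw [Function.iterate_succ_apply, stringInt_field ha he,
      ih (ha.div_mdot he) fun p hp => he p (tsupport_mul_subset_right hp)]
    congr 1
    funext p
    ring

lemma pdList_field (ha : IsAmp m a) (L : List (Fin 4)) :
    pdList L (field m a)
      = field m (fun p => (L.map fun μ => -Complex.I * (lowMom m μ p : ℂ)).prod * a p) ∧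
    IsAmp m (fun p => (L.map fun μ => -Complex.I * (lowMom m μ p : ℂ)).prod * a p) := by
  induction L with
  | nil => simpa [pdList] using ha
  | cons μ L ih =>
    simp only [List.map_cons, List.prod_cons, mul_assoc (-Complex.I * _)]
    refine ⟨?_, ih.2.mul_lowMom μ⟩
    rw [← pd_field ih.2, ← ih.1]
    rfl

end StringIntegration

/-! ### Amplitudes of product form -/

section ProductAmplitude

variable {s : ℕ} {m : ℝ} {ψ : Wave s} {y : E3 → Fin 3 → ℝ}

/-- The wave function contracted with a product of one-index kernels. -/
def prodAmp (W : E3 → Fin s → Fin 3 → ℂ) (ψ : Wave s) (p : E3) : ℂ :=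
  ∑ I : Fin s → Fin 3, (∏ k, W p k (I k)) * ψ p I

lemma IsGoodWave.isAmp_prodAmp (hψ : IsGoodWave m y ψ) {W : E3 → Fin s → Fin 3 → ℂ}
    (hW : ∀ p ∈ tsupport ψ, ∀ k i, ContDiffAt ℝ ∞ (fun q => W q k i) p) :
    IsAmp m (prodAmp W ψ) :=
  IsAmp.sum _ fun I _ => (hψ.isAmp I).mul fun p hp =>
    contDiffAt_prod fun k _ => hW p (tsupport_component_subset ψ I hp) k (I k)

lemma tsupport_prodAmp_subset (W : E3 → Fin s → Fin 3 → ℂ) (ψ : Wave s) :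
    tsupport (prodAmp W ψ) ⊆ tsupport ψ := by
  refine closure_mono fun p hp h => hp ?_
  have h0 : ψ p = 0 := h
  simp [prodAmp, h0]

/-- The s string integrations multiply the amplitude by an s-th power, which is distributed with one
factor for each tensor index. -/
lemma pow_mul_prodAmp (c : E3 → ℂ) (W : E3 → Fin s → Fin 3 → ℂ) (ψ : Wave s) (p : E3) :
    c p ^ s * prodAmp W ψ p = prodAmp (fun p k i => c p * W p k i) ψ p := by
  simp [prodAmp, Finset.mul_sum, Finset.prod_mul_distrib, mul_assoc]

lemma sum_prod_mul_prodAmp {κ : Type*} [Fintype κ] (c : κ → ℂ)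
    (W : E3 → Fin s → κ → Fin 3 → ℂ) (ψ : Wave s) (p : E3) :
    ∑ N : Fin s → κ, (∏ k, c (N k)) * prodAmp (fun p k => W p k (N k)) ψ p
      = prodAmp (fun p k i => ∑ ν, c ν * W p k ν i) ψ p := by
  classical
  simp only [prodAmp, Finset.mul_sum, Finset.prod_univ_sum, Fintype.piFinset_univ,
    Finset.sum_mul]
  rw [Finset.sum_comm]
  refine Finset.sum_congr rfl fun I _ => Finset.sum_congr rfl fun N _ => ?_
  rw [Finset.prod_mul_distrib, mul_assoc]

/-- Expanding the product of the differences f_M w_N - f_N w_M over the set S of slots in which the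
second term is chosen gives the alternating sum that defines the full curl. -/
lemma sum_prodAmp_exchange {κ : Type*} (f : E3 → κ → ℂ) (w : E3 → κ → Fin 3 → ℂ)
    (M N : Fin s → κ) (ψ : Wave s) (p : E3) :
    ∑ S : Finset (Fin s), (-1 : ℂ) ^ S.card * ((∏ k, f p (if k ∈ S then N k else M k)) *
        prodAmp (fun p k => w p (if k ∈ S then M k else N k)) ψ p)
      = prodAmp (fun p k i => f p (M k) * w p (N k) i - f p (N k) * w p (M k) i) ψ p := by
  classical
  have h : ∀ I : Fin s → Fin 3,
      ∏ k, (f p (M k) * w p (N k) (I k) - f p (N k) * w p (M k) (I k))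
      = ∑ S : Finset (Fin s), (-1 : ℂ) ^ S.card * ((∏ k, f p (if k ∈ S then N k else M k)) *
        ∏ k, w p (if k ∈ S then M k else N k) (I k)) := by
    intro I
    have h1 := Finset.prod_add (fun k => -(f p (N k) * w p (M k) (I k)))
      (fun k => f p (M k) * w p (N k) (I k)) Finset.univ
    simp only [neg_add_eq_sub, Finset.powerset_univ] at h1
    rw [h1]
    refine Finset.sum_congr rfl fun S _ => ?_
    rw [Finset.prod_neg, mul_assoc, ← Finset.prod_mul_distrib]
    congr 1
    rw [← Finset.prod_mul_prod_compl S fun k => f p (if k ∈ S then N k else M k) *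
      w p (if k ∈ S then M k else N k) (I k), Finset.compl_eq_univ_sdiff]
    congr 1
    · exact Finset.prod_congr rfl fun k hk => by simp [hk]
    · refine Finset.prod_congr rfl fun k hk => ?_
      have : k ∉ S := (Finset.mem_sdiff.1 hk).2
      simp [this]
  simp only [prodAmp, h, Finset.mul_sum, Finset.sum_mul]
  rw [Finset.sum_comm]
  exact Finset.sum_congr rfl fun I _ => Finset.sum_congr rfl fun S _ => by ring

end ProductAmplitude

/-! ### Amplitudes of the massive fields -/

/-- The function `y` of the Proca field. -/
def yProca (m : ℝ) (p : E3) (k : Fin 3) : ℝ := -(velVec m p k / m)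

/-- The function `y` of string-localized fields. -/
def yString (m : ℝ) (e : M4) (p : E3) (k : Fin 3) : ℝ :=
  mdot (regVec m p k) e / mdot (onShell m p) e

section MassiveFields

variable {s : ℕ} {m : ℝ} {e : M4} {ψ : Wave s} {p : E3}

lemma escortIndex_self (M : Fin s → Fin 4) : escortIndex s s M = fun k => some (M k) := by
  funext k
  simp [escortIndex]

lemma lowPot_yProca (hm : 0 < m) (p : E3) (μ : Fin 4) (k : Fin 3) :
    lowPot m (yProca m) p μ k = eta μ * stdBoost m p μ k := by
  have h1 : omega m p + m ≠ 0 := (add_pos_of_nonneg_of_pos (omega_nonneg m p) hm).ne'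
  rw [lowPot]
  congr 1
  cases μ using Fin.cases with
  | zero =>
    simp only [potVec, regVec, yProca, stdBoost, velVec, Fin.cons_zero, Fin.cases_zero,
      onShell_zero]
    field_simp
    ring
  | succ i =>
    simp only [potVec, regVec, yProca, stdBoost, velVec, Fin.cons_succ, Fin.cases_succ,
      onShell_succ]
    field_simp
    ring

lemma escVec_yProca (hm : 0 < m) (p : E3) (k : Fin 3) : escVec m (yProca m) p k = 0 := by
  simp only [escVec, yProca]
  field_simp
  ring

lemma proca_eq_field (hm : 0 < m) (ψ : Wave s) (M : Fin s → Fin 4) :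
    (fun x => proca s m ψ x M) = field m (tensorAmp m (yProca m) ψ (escortIndex s s M)) := by
  funext x
  simp only [escortIndex_self, proca, field, tensorAmp, intertwiner, lowPot_yProca hm]

lemma omega_pos (hm : 0 < m) (p : E3) : 0 < omega m p :=
  Real.sqrt_pos.2 (by positivity)

lemma contDiffAt_yString (hm : 0 ≤ m) (h : omega m p ≠ 0) (he : mdot (onShell m p) e ≠ 0)
    (k : Fin 3) : ContDiffAt ℝ ∞ (fun q => yString m e q k) p :=
  ContDiffAt.div (ContDiffAt.sum fun μ _ => (contDiffAt_const.mul
    (contDiffAt_regVec hm h k μ)).mul contDiffAt_const) (contDiffAt_mdot_onShell h e) he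

lemma contDiffAt_yProca (hm : 0 ≤ m) (h : omega m p ≠ 0) (k : Fin 3) :
    ContDiffAt ℝ ∞ (fun q => yProca m q k) p :=
  ((contDiffAt_velVec hm h k).div_const m).neg

lemma isGoodWave_yProca (hm : 0 < m) (hψ : ContDiff ℝ ∞ ψ) (hc : HasCompactSupport ψ)
    (hs : ∀ p, PermInvariant (ψ p)) : IsGoodWave m (yProca m) ψ where
  smooth := hψ
  compact := hc
  symm := hs
  omega_ne := fun p _ => (omega_pos hm p).ne'
  smooth_at := fun p _ => contDiffAt_yProca hm.le (omega_pos hm p).ne'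

lemma fieldStrength_proca (hm : 0 < m) (hψ : IsGoodWave m (yProca m) ψ) (M N : Fin s → Fin 4) :
    fieldStrength (proca s m ψ) M N = field m (prodAmp (fun p k i =>
      -Complex.I * (lowMom m (M k) p : ℂ) * (lowPot m (yProca m) p (N k) i : ℂ)
        - -Complex.I * (lowMom m (N k) p : ℂ) * (lowPot m (yProca m) p (M k) i : ℂ)) ψ) := by
  funext x
  have h1 : ∀ M : Fin s → Fin 4, IsAmp m (prodAmp (fun p k i =>
      (lowPot m (yProca m) p (M k) i : ℂ)) ψ) := fun M => by
    have := hψ.isAmp_tensorAmp hm.le (escortIndex s s M)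
    rwa [escortIndex_self] at this
  have h2 : ∀ S : Finset (Fin s), pdList (List.ofFn fun k => if k ∈ S then N k else M k)
      (fun z => proca s m ψ z (fun k => if k ∈ S then M k else N k))
      = field m (fun p => (∏ k, (-Complex.I * (lowMom m (if k ∈ S then N k else M k) p : ℂ))) *
        prodAmp (fun p k i => (lowPot m (yProca m) p (if k ∈ S then M k else N k) i : ℂ)) ψ p) ∧
      IsAmp m (fun p => (∏ k, (-Complex.I * (lowMom m (if k ∈ S then N k else M k) p : ℂ))) *
        prodAmp (fun p k i => (lowPot m (yProca m) p (if k ∈ S then M k else N k) i : ℂ)) ψ p) := by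
    intro S
    rw [proca_eq_field hm, escortIndex_self]
    have h3 := pdList_field (h1 fun k => if k ∈ S then M k else N k)
      (List.ofFn fun k => if k ∈ S then N k else M k)
    simp only [List.map_ofFn, List.prod_ofFn, Function.comp_def] at h3
    exact h3
  have h4 := fun p => sum_prodAmp_exchange (fun p (μ : Fin 4) => -Complex.I * (lowMom m μ p : ℂ))
    (fun p μ i => (lowPot m (yProca m) p μ i : ℂ)) M N ψ p
  rw [← funext h4, field_sum m _ fun S _ => (h2 S).2.const_mul _, fieldStrength]
  exact Finset.sum_congr rfl fun S _ => by rw [(h2 S).1, field_const_mul]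

lemma mdot_onShell_eq_sum_lowMom (m : ℝ) (p : E3) (e : M4) :
    mdot (onShell m p) e = ∑ ν, e ν * lowMom m ν p := by
  simp only [mdot, lowMom]
  exact Finset.sum_congr rfl fun _ _ => by ring

lemma sum_mul_lowPot (m : ℝ) (y : E3 → Fin 3 → ℝ) (p : E3) (k : Fin 3) (e : M4) :
    ∑ ν, e ν * lowPot m y p ν k = mdot (regVec m p k) e - y p k * mdot (onShell m p) e := by
  rw [← mdot_sub_mul_left]
  simp only [mdot, lowPot, potVec]
  exact Finset.sum_congr rfl fun _ _ => by ring

/-- With A = c - p y, the curl contracted with e and divided by i(pe) is A_μ - p_μ (Ae)/(pe). Any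
multiple of p in A cancels, so y drops out and is replaced by `yString`; in particular the 1/m of
the Proca field is gone. -/
lemma sum_string_contraction (y : E3 → Fin 3 → ℝ) (he : mdot (onShell m p) e ≠ 0) (μ : Fin 4)
    (k : Fin 3) :
    ∑ ν, (e ν : ℂ) * (1 / (Complex.I * (mdot (onShell m p) e : ℝ)) *
      (-Complex.I * (lowMom m μ p : ℂ) * (lowPot m y p ν k : ℂ)
        - -Complex.I * (lowMom m ν p : ℂ) * (lowPot m y p μ k : ℂ)))
      = (lowPot m (yString m e) p μ k : ℂ) := by
  have h1 : ((∑ ν, e ν * lowPot m y p ν k : ℝ) : ℂ)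
      = ((mdot (regVec m p k) e - y p k * mdot (onShell m p) e : ℝ) : ℂ) := by
    rw [sum_mul_lowPot]
  have h2 : ((∑ ν, e ν * lowMom m ν p : ℝ) : ℂ) = (mdot (onShell m p) e : ℝ) := by
    rw [mdot_onShell_eq_sum_lowMom]
  have he' : ((mdot (onShell m p) e : ℝ) : ℂ) ≠ 0 := Complex.ofReal_ne_zero.2 he
  push_cast at h1 h2
  have h3 : ∀ ν, (e ν : ℂ) * (1 / (Complex.I * (mdot (onShell m p) e : ℝ)) *
      (-Complex.I * (lowMom m μ p : ℂ) * (lowPot m y p ν k : ℂ)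
        - -Complex.I * (lowMom m ν p : ℂ) * (lowPot m y p μ k : ℂ)))
      = (mdot (onShell m p) e : ℂ)⁻¹ * ((e ν * lowMom m ν p : ℂ) * lowPot m y p μ k
        - lowMom m μ p * (e ν * lowPot m y p ν k : ℂ)) := by
    intro ν
    field_simp [Complex.I_ne_zero]
    ring
  simp only [h3]
  rw [← Finset.mul_sum, Finset.sum_sub_distrib, ← Finset.sum_mul, ← Finset.mul_sum, h1, h2]
  simp only [lowPot, potVec, yString, lowMom]
  push_cast
  field_simp
  ring

lemma contDiffAt_lowPot (hm : 0 ≤ m) (h : omega m p ≠ 0) {y : E3 → Fin 3 → ℝ} {k : Fin 3}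
    (hy : ContDiffAt ℝ ∞ (fun q => y q k) p) (μ : Fin 4) :
    ContDiffAt ℝ ∞ (fun q => (lowPot m y q μ k : ℂ)) p :=
  contDiffAt_ofReal (contDiffAt_const.mul (contDiffAt_potVec hm h hy μ))

lemma stringPot_eq_field (hm : 0 < m) (hψ : IsGoodWave m (yProca m) ψ)
    (he : ∀ p ∈ tsupport ψ, mdot (onShell m p) e ≠ 0) (M : Fin s → Fin 4) :
    (fun x => stringPot s m e ψ x M)
      = field m (tensorAmp m (yString m e) ψ (escortIndex s s M)) := by
  funext x
  have hF : ∀ N : Fin s → Fin 4, IsAmp m (prodAmp (fun p k i =>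
      -Complex.I * (lowMom m (M k) p : ℂ) * (lowPot m (yProca m) p (N k) i : ℂ)
        - -Complex.I * (lowMom m (N k) p : ℂ) * (lowPot m (yProca m) p (M k) i : ℂ)) ψ) := by
    refine fun N => hψ.isAmp_prodAmp fun p hp k i => ?_
    have h := hψ.omega_ne p hp
    have hl := fun μ => contDiffAt_const (c := -Complex.I).mul
      (contDiffAt_ofReal (contDiffAt_lowMom h μ))
    have hp := fun μ => contDiffAt_lowPot hm.le h (hψ.smooth_at p hp i) μ
    exact ((hl _).mul (hp _)).sub ((hl _).mul (hp _))
  have hs : ∀ N : Fin s → Fin 4, ((stringInt e)^[s] (fieldStrength (proca s m ψ) M N))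
      = field m (prodAmp (fun p k i => 1 / (Complex.I * (mdot (onShell m p) e : ℝ)) *
        (-Complex.I * (lowMom m (M k) p : ℂ) * (lowPot m (yProca m) p (N k) i : ℂ)
        - -Complex.I * (lowMom m (N k) p : ℂ) * (lowPot m (yProca m) p (M k) i : ℂ))) ψ) ∧
      IsAmp m (prodAmp (fun p k i => 1 / (Complex.I * (mdot (onShell m p) e : ℝ)) *
        (-Complex.I * (lowMom m (M k) p : ℂ) * (lowPot m (yProca m) p (N k) i : ℂ)
        - -Complex.I * (lowMom m (N k) p : ℂ) * (lowPot m (yProca m) p (M k) i : ℂ))) ψ) := by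
    intro N
    have h1 := iterate_stringInt_field (hF N)
      (fun p hp => he p (tsupport_prodAmp_subset _ _ hp)) s
    have h2 := fun p => pow_mul_prodAmp (fun p => 1 / (Complex.I * (mdot (onShell m p) e : ℝ)))
      (fun p k i => -Complex.I * (lowMom m (M k) p : ℂ) * (lowPot m (yProca m) p (N k) i : ℂ)
        - -Complex.I * (lowMom m (N k) p : ℂ) * (lowPot m (yProca m) p (M k) i : ℂ)) ψ p
    rw [fieldStrength_proca hm hψ, h1, ← funext h2]
    refine ⟨rfl, (hF N).mul fun p hp => ?_⟩
    have hp' := tsupport_prodAmp_subset _ _ hp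
    simp only [one_div]
    exact ((contDiffAt_const.mul (contDiffAt_ofReal
      (contDiffAt_mdot_onShell (hψ.omega_ne p hp') e))).inv
      (mul_ne_zero Complex.I_ne_zero (Complex.ofReal_ne_zero.2 (he p hp')))).pow s
  have h3 : ∀ p, tensorAmp m (yString m e) ψ (escortIndex s s M) p
      = prodAmp (fun p k i => ∑ ν, (e ν : ℂ) * (1 / (Complex.I * (mdot (onShell m p) e : ℝ)) *
        (-Complex.I * (lowMom m (M k) p : ℂ) * (lowPot m (yProca m) p ν i : ℂ)
        - -Complex.I * (lowMom m ν p : ℂ) * (lowPot m (yProca m) p (M k) i : ℂ)))) ψ p := by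
    intro p
    by_cases hp : p ∈ tsupport ψ
    · simp only [prodAmp, sum_string_contraction (yProca m) (he p hp), escortIndex_self]
      rfl
    · simp [tensorAmp_eq_zero hp, prodAmp, wave_eq_zero hp]
  rw [funext h3, ← funext (sum_prod_mul_prodAmp (fun ν => (e ν : ℂ)) (fun p k ν i =>
    1 / (Complex.I * (mdot (onShell m p) e : ℝ)) *
        (-Complex.I * (lowMom m (M k) p : ℂ) * (lowPot m (yProca m) p ν i : ℂ)
        - -Complex.I * (lowMom m ν p : ℂ) * (lowPot m (yProca m) p (M k) i : ℂ))) ψ),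
    field_sum m _ fun N _ => (hs N).2.const_mul _, stringPot]
  exact Finset.sum_congr rfl fun N _ => by rw [(hs N).1, field_const_mul]

lemma escortIndex_snoc_eq_update {r : ℕ} (h : r < s) (M : Fin r → Fin 4) (μ : Fin 4) :
    escortIndex s (r + 1) (Fin.snoc M μ : Fin (r + 1) → Fin 4)
      = Function.update (escortIndex s r M) ⟨r, h⟩ (some μ) := by
  funext k
  rcases lt_trichotomy (k : ℕ) r with hk | hk | hk
  · have h1 : k ≠ ⟨r, h⟩ := fun h2 => by simp [h2] at hk
    rw [Function.update_of_ne h1, escortIndex, escortIndex, dif_pos hk, dif_pos (by omega)]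
    congr 1
    exact Fin.snoc_castSucc (α := fun _ => Fin 4) μ M ⟨k, hk⟩
  · have h1 : k = ⟨r, h⟩ := Fin.ext hk
    subst h1
    rw [Function.update_self, escortIndex, dif_pos (by simp)]
    congr 1
    exact Fin.snoc_last (α := fun _ => Fin 4) μ M
  · have h1 : k ≠ ⟨r, h⟩ := fun h2 => by simp [h2] at hk
    rw [Function.update_of_ne h1, escortIndex, escortIndex, dif_neg (by omega),
      dif_neg (by omega)]

/-- On amplitudes -m⁻¹∂^μ contracts a Lorentz slot with i m⁻¹ p. By `mdot_potVec_onShell` this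
yields -i times the escort vector, which fixes the phase in `intertwiner`. -/
lemma sum_intertwiner (hm : 0 < m) (y : E3 → Fin 3 → ℝ) (p : E3) (k : Fin 3) :
    ∑ μ, -(m⁻¹ : ℂ) * (eta μ * (-Complex.I * (lowMom m μ p : ℂ))) * intertwiner m y p (some μ) k
      = intertwiner m y p none k := by
  have h1 := mdot_potVec_onShell hm.le (omega_pos hm p).ne' y k
  have h2 : ∑ μ, lowMom m μ p * potVec m y p k μ = -(m * escVec m y p k) := by
    rw [← h1]
    simp only [mdot, lowMom]
    exact Finset.sum_congr rfl fun _ _ => by ring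
  have h3 : ((∑ μ, lowMom m μ p * potVec m y p k μ : ℝ) : ℂ) = -(m * escVec m y p k) := by
    rw [h2]
    push_cast
    ring
  push_cast at h3
  have h4 : ∀ μ, -(m⁻¹ : ℂ) * (eta μ * (-Complex.I * (lowMom m μ p : ℂ))) *
      intertwiner m y p (some μ) k
      = (m⁻¹ : ℂ) * Complex.I * (lowMom m μ p * potVec m y p k μ : ℂ) := by
    intro μ
    have h5 : (eta μ : ℂ) * eta μ = 1 := by exact_mod_cast eta_mul_self μ
    simp only [intertwiner, lowPot]
    push_cast
    linear_combination (m⁻¹ : ℂ) * Complex.I * lowMom m μ p * potVec m y p k μ * h5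
  simp only [h4]
  rw [← Finset.mul_sum, h3, intertwiner]
  have : (m : ℂ) ≠ 0 := Complex.ofReal_ne_zero.2 hm.ne'
  field_simp

lemma tensorAmp_update (m : ℝ) (y : E3 → Fin 3 → ℝ) (ψ : Wave s) (J : Fin s → Option (Fin 4))
    (a : Fin s) (x : Option (Fin 4)) (p : E3) :
    tensorAmp m y ψ (Function.update J a x) p = ∑ I : Fin s → Fin 3, intertwiner m y p x (I a) *
      ((∏ k ∈ Finset.univ.erase a, intertwiner m y p (J k) (I k)) * ψ p I) := by
  refine Finset.sum_congr rfl fun I _ => ?_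
  rw [← Finset.mul_prod_erase Finset.univ _ (Finset.mem_univ a), Function.update_self, mul_assoc]
  congr 2
  exact Finset.prod_congr rfl fun k hk => by
    rw [Function.update_of_ne (Finset.ne_of_mem_erase hk)]

lemma sum_tensorAmp_snoc (hm : 0 < m) (y : E3 → Fin 3 → ℝ) (ψ : Wave s) {r : ℕ} (h : r < s)
    (M : Fin r → Fin 4) (p : E3) :
    ∑ μ, -(m⁻¹ : ℂ) * (eta μ * (-Complex.I * (lowMom m μ p : ℂ))) *
        tensorAmp m y ψ (escortIndex s (r + 1) (Fin.snoc M μ : Fin (r + 1) → Fin 4)) p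
      = tensorAmp m y ψ (escortIndex s r M) p := by
  -- Slot r, counted from zero, is the first escort slot of a rank r field and the last Lorentz slot
  -- of a rank r + 1 field.
  have h1 : escortIndex s r M = Function.update (escortIndex s r M) ⟨r, h⟩ none := by
    rw [eq_comm, Function.update_eq_self_iff]
    simp [escortIndex]
  conv_rhs => rw [h1, tensorAmp_update]
  simp only [escortIndex_snoc_eq_update h, tensorAmp_update, Finset.mul_sum]
  rw [Finset.sum_comm]
  refine Finset.sum_congr rfl fun I _ => ?_
  rw [← sum_intertwiner hm, Finset.sum_mul]
  exact Finset.sum_congr rfl fun μ _ => by ring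

lemma descend_eq_field (hm : 0 < m) {y : E3 → Fin 3 → ℝ} (hψ : IsGoodWave m y ψ) {T : Ten s}
    (hT : ∀ M, (fun x => T x M) = field m (tensorAmp m y ψ (escortIndex s s M)))
    (k r : ℕ) (h : r + k = s) (M : Fin r → Fin 4) :
    (fun x => descend m T k r h x M) = field m (tensorAmp m y ψ (escortIndex s r M)) := by
  induction k generalizing r with
  | zero =>
    obtain rfl : r = s := h
    exact hT M
  | succ k ih =>
    funext x
    have hamp := fun M => hψ.isAmp_tensorAmp hm.le (escortIndex s (r + 1) M)
    have h1 : ∀ μ, pd μ (fun z => descend m T k (r + 1) (by omega) z (Fin.snoc M μ))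
        = field m (fun p => -Complex.I * (lowMom m μ p : ℂ) *
          tensorAmp m y ψ (escortIndex s (r + 1) (Fin.snoc M μ : Fin (r + 1) → Fin 4)) p) := by
      intro μ
      rw [ih, pd_field (hamp _)]
    simp only [descend, divergence, h1]
    rw [← funext (sum_tensorAmp_snoc hm y ψ (by omega : r < s) M), field_sum, Finset.mul_sum]
    · refine Finset.sum_congr rfl fun μ _ => ?_
      rw [← field_const_mul, ← field_const_mul]
      congr 1
      funext p
      ring
    · intro μ _
      have := ((hamp (Fin.snoc M μ)).mul_lowMom μ).const_mul (-(m⁻¹ : ℂ) * eta μ)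
      convert this using 2
      ring

end MassiveFields

/-! ### String-localized fields of all masses -/

/-- Symmetric smooth compactly supported wave functions, supported away from the zeros of `pe`. -/
structure IsStringWave {s : ℕ} (m : ℝ) (e : M4) (ψ : Wave s) : Prop where
  smooth : ContDiff ℝ ∞ ψ
  compact : HasCompactSupport ψ
  symm : ∀ p, PermInvariant (ψ p)
  mdot_ne : ∀ p ∈ tsupport ψ, mdot (onShell m p) e ≠ 0

section StringFields

variable {s : ℕ} {m : ℝ} {e : M4} {ψ : Wave s} {p : E3}

/-- If ω = 0 then p = 0 and the whole on-shell vector vanishes. Avoiding the zeros of pe thus also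
avoids the singular point p = 0 of the massless shell. -/
lemma omega_ne_of_mdot_ne (h : mdot (onShell m p) e ≠ 0) : omega m p ≠ 0 := by
  intro h0
  have h1 := omega_sq m p
  rw [h0] at h1
  have h2 : ‖p‖ = 0 := by nlinarith [sq_nonneg ‖p‖, sq_nonneg m]
  rw [norm_eq_zero] at h2
  subst h2
  refine h ?_
  rw [mdot_eq]
  simp [h0]

lemma IsStringWave.isGoodWave (hm : 0 ≤ m) (hψ : IsStringWave m e ψ) :
    IsGoodWave m (yString m e) ψ where
  smooth := hψ.smooth
  compact := hψ.compact
  symm := hψ.symm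
  omega_ne := fun p hp => omega_ne_of_mdot_ne (hψ.mdot_ne p hp)
  smooth_at := fun p hp k => contDiffAt_yString hm (omega_ne_of_mdot_ne (hψ.mdot_ne p hp))
    (hψ.mdot_ne p hp) k

lemma massiveEscort_eq_field (hm : 0 < m) (hψ : IsStringWave m e ψ) {r : ℕ} (hr : r ≤ s)
    (M : Fin r → Fin 4) :
    (fun x => massiveEscort s m e r ψ x M)
      = field m (tensorAmp m (yString m e) ψ (escortIndex s r M)) := by
  simp only [massiveEscort, dif_pos hr]
  exact descend_eq_field hm (hψ.isGoodWave hm.le) (stringPot_eq_field hm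
    (isGoodWave_yProca hm hψ.smooth hψ.compact hψ.symm) hψ.mdot_ne) _ _ _ _

lemma escort_of_pos (hm : 0 < m) (r : ℕ) : escort s m e r = massiveEscort s m e r := by
  funext ψ x M
  simp [escort, hm]

/-- By compactness of the support and joint continuity of pe in mass and momentum, pe stays nonzero
on the support for all sufficiently small masses. -/
lemma IsStringWave.eventually (hψ : IsStringWave 0 e ψ) :
    ∀ᶠ m in 𝓝[>] (0 : ℝ), IsStringWave m e ψ := by
  have h : ∀ᶠ m in 𝓝 (0 : ℝ), ∀ p ∈ tsupport ψ, mdot (onShell m p) e ≠ 0 :=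
    IsCompact.eventually_forall_of_forall_eventually hψ.compact fun p hp =>
      ((continuous_mdot_onShell_uncurry e).tendsto (0, p)).eventually_ne (hψ.mdot_ne p hp)
  filter_upwards [nhdsWithin_le_nhds h] with m hm
  exact ⟨hψ.smooth, hψ.compact, hψ.symm, hm⟩

lemma continuousAt_velVec_uncurry {z : ℝ × E3} (h : omega z.1 z.2 + z.1 ≠ 0) (k : Fin 3) :
    ContinuousAt (fun z : ℝ × E3 => velVec z.1 z.2 k) z :=
  ((EuclideanSpace.proj k : E3 →L[ℝ] ℝ).continuous.comp continuous_snd).continuousAt.div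
    (continuous_omega_uncurry.add continuous_fst).continuousAt h

lemma continuousAt_regVec_uncurry {z : ℝ × E3} (h : omega z.1 z.2 + z.1 ≠ 0) (k : Fin 3)
    (μ : Fin 4) : ContinuousAt (fun z : ℝ × E3 => regVec z.1 z.2 k μ) z := by
  cases μ using Fin.cases with
  | zero => exact continuousAt_velVec_uncurry h k
  | succ i => exact continuousAt_const

lemma continuousAt_yString_uncurry {z : ℝ × E3} (h : omega z.1 z.2 + z.1 ≠ 0)
    (he : mdot (onShell z.1 z.2) e ≠ 0) (k : Fin 3) :
    ContinuousAt (fun z : ℝ × E3 => yString z.1 e z.2 k) z :=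
  ContinuousAt.div (tendsto_finsetSum _ fun μ _ => (continuousAt_const.mul
    (continuousAt_regVec_uncurry h k μ)).mul continuousAt_const)
    (continuous_mdot_onShell_uncurry e).continuousAt he

lemma continuousAt_intertwiner_uncurry {z : ℝ × E3} (h : omega z.1 z.2 + z.1 ≠ 0)
    (he : mdot (onShell z.1 z.2) e ≠ 0) (x : Option (Fin 4)) (k : Fin 3) :
    ContinuousAt (fun z : ℝ × E3 => intertwiner z.1 (yString z.1 e) z.2 x k) z := by
  have hy := continuousAt_yString_uncurry h he k
  cases x with
  | none =>
    exact continuousAt_const.mul (Complex.continuous_ofReal.continuousAt.comp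
      ((continuousAt_fst.mul hy).add (continuousAt_velVec_uncurry h k)))
  | some μ =>
    exact Complex.continuous_ofReal.continuousAt.comp (continuousAt_const.mul
      ((continuousAt_regVec_uncurry h k μ).sub
        ((continuous_onShell_uncurry μ).continuousAt.mul hy)))

/-- The integrand of a string-localized field. -/
def stringIntegrand (e : M4) (ψ : Wave s) (J : Fin s → Option (Fin 4)) (x : M4)
    (z : ℝ × E3) : ℂ :=
  (shellDensity z.1 z.2 : ℂ) * planeWave z.1 x z.2 * tensorAmp z.1 (yString z.1 e) ψ J z.2

/-- Joint continuity extends to mass zero because the only denominators are ω, ω + m and pe, all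
nonzero at the points considered. -/
lemma continuousAt_stringIntegrand (hψ : Continuous ψ) {z : ℝ × E3} (hz : 0 ≤ z.1)
    (he : mdot (onShell z.1 z.2) e ≠ 0) (J : Fin s → Option (Fin 4)) (x : M4) :
    ContinuousAt (stringIntegrand e ψ J x) z := by
  have h0 := omega_ne_of_mdot_ne he
  have h := (omega_add_pos hz h0).ne'
  refine ((Complex.continuous_ofReal.continuousAt.comp (continuousAt_const.div
    (continuousAt_const.mul (continuousAt_const.mul continuous_omega_uncurry.continuousAt))
    ?_)).mul (Continuous.continuousAt ?_)).mul (tendsto_finsetSum _ fun I _ => ?_)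
  · exact mul_ne_zero (by positivity) (mul_ne_zero two_ne_zero h0)
  · exact (continuous_const.mul (Complex.continuous_ofReal.comp
      (continuous_mdot_onShell_uncurry x))).cexp
  · exact (tendsto_finsetProd _ fun k _ => continuousAt_intertwiner_uncurry h he (J k) (I k)).mul
      ((continuous_apply I).comp (hψ.comp continuous_snd)).continuousAt

/-- Pointwise joint continuity over a compact set gives closeness uniform in p, which provides both
the pointwise limit and the dominating function for small masses. -/
lemma eventually_forall_norm_sub_lt {F : ℝ × E3 → ℂ} {K : Set E3} (hK : IsCompact K)
    (hF : ∀ p ∈ K, ContinuousAt F (0, p)) (δ : ℝ) (hδ : 0 < δ) :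
    ∀ᶠ m in 𝓝 (0 : ℝ), ∀ p ∈ K, ‖F (m, p) - F (0, p)‖ < δ := by
  refine IsCompact.eventually_forall_of_forall_eventually hK fun p hp => ?_
  have h2 : ContinuousAt (fun z : ℝ × E3 => F (0, z.2)) (0, p) :=
    ContinuousAt.comp (g := F) (f := fun z : ℝ × E3 => ((0 : ℝ), z.2)) (hF p hp)
      (continuous_const.prodMk continuous_snd).continuousAt
  have h3 := ((hF p hp).sub h2).norm
  have h4 : ‖F (0, p) - F (0, p)‖ < δ := by simpa using hδ
  exact h3.tendsto.eventually_lt tendsto_const_nhds h4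

/-- The string-localized fields have a massless limit. -/
lemma tendsto_field_yString (hψ : IsStringWave 0 e ψ) (J : Fin s → Option (Fin 4)) (x : M4) :
    Tendsto (fun m => field m (tensorAmp m (yString m e) ψ J) x) (𝓝[>] 0)
      (𝓝 (field 0 (tensorAmp 0 (yString 0 e) ψ J) x)) := by
  have hclose := eventually_forall_norm_sub_lt (F := stringIntegrand e ψ J x) hψ.compact fun p hp =>
    continuousAt_stringIntegrand (z := (0, p)) hψ.smooth.continuous le_rfl (hψ.mdot_ne p hp) J x
  have hzero : ∀ m, ∀ p ∉ tsupport ψ, stringIntegrand e ψ J x (m, p) = 0 := by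
    intro m p hp
    simp [stringIntegrand, tensorAmp_eq_zero hp]
  have hint : ∀ m, 0 ≤ m → IsStringWave m e ψ →
      Integrable (fun p => stringIntegrand e ψ J x (m, p)) := fun m hm h =>
    ((h.isGoodWave hm).isAmp_tensorAmp hm J).integrable_field x
  have hb : Integrable ((tsupport ψ).indicator fun _ : E3 => (1 : ℝ)) :=
    (integrable_indicator_iff (isClosed_tsupport ψ).measurableSet).2
      (integrableOn_const hψ.compact.measure_lt_top.ne)
  -- The dominating function is the norm of the massless integrand plus the indicator of the
  -- support; the choice δ = 1 in the uniform estimate yields it.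
  refine tendsto_integral_filter_of_dominated_convergence _ ?_ ?_
    ((hint 0 le_rfl hψ).norm.add hb) ?_
  · filter_upwards [hψ.eventually, self_mem_nhdsWithin] with m hm hm0
    exact (hint m (le_of_lt hm0) hm).aestronglyMeasurable
  · filter_upwards [nhdsWithin_le_nhds (hclose 1 one_pos)] with m hm
    refine Eventually.of_forall fun p => ?_
    change ‖stringIntegrand e ψ J x (m, p)‖ ≤ ‖stringIntegrand e ψ J x (0, p)‖ + _
    by_cases hp : p ∈ tsupport ψ
    · rw [indicator_of_mem hp]
      have h1 := norm_sub_norm_le (stringIntegrand e ψ J x (m, p)) (stringIntegrand e ψ J x (0, p))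
      have h2 := hm p hp
      linarith
    · simp [hzero _ p hp, hp]
  · refine Eventually.of_forall fun p => tendsto_nhdsWithin_of_tendsto_nhds ?_
    change Tendsto (fun m => stringIntegrand e ψ J x (m, p)) (𝓝 0)
      (𝓝 (stringIntegrand e ψ J x (0, p)))
    by_cases hp : p ∈ tsupport ψ
    · rw [tendsto_iff_norm_sub_tendsto_zero, Metric.tendsto_nhds]
      intro δ hδ
      filter_upwards [hclose δ hδ] with m hm
      simpa using hm p hp
    · simp [hzero _ p hp]

lemma tendsto_massiveEscort (hψ : IsStringWave 0 e ψ) {r : ℕ} (hr : r ≤ s) (x : M4)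
    (M : Fin r → Fin 4) :
    Tendsto (fun m => massiveEscort s m e r ψ x M) (𝓝[>] 0)
      (𝓝 (field 0 (tensorAmp 0 (yString 0 e) ψ (escortIndex s r M)) x)) := by
  refine (tendsto_field_yString hψ (escortIndex s r M) x).congr' ?_
  filter_upwards [hψ.eventually, self_mem_nhdsWithin] with m hm hm0
  exact (congrFun (massiveEscort_eq_field hm0 hm hr M) x).symm

/-- Amplitudes of the string-localized fields, for all masses. -/
lemma escort_eq_field (hm : 0 ≤ m) (hψ : IsStringWave m e ψ) {r : ℕ} (hr : r ≤ s)
    (M : Fin r → Fin 4) :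
    (fun x => escort s m e r ψ x M)
      = field m (tensorAmp m (yString m e) ψ (escortIndex s r M)) := by
  rcases hm.eq_or_lt with rfl | hm
  · funext x
    simp only [escort, lt_irrefl, if_false]
    exact (tendsto_massiveEscort hψ hr x M).limUnder_eq
  · rw [escort_of_pos hm]
    exact massiveEscort_eq_field hm hψ hr M

lemma tendsto_escort (hψ : IsStringWave 0 e ψ) {r : ℕ} (hr : r ≤ s) (x : M4)
    (M : Fin r → Fin 4) :
    Tendsto (fun m => escort s m e r ψ x M) (𝓝[>] 0) (𝓝 (escort s 0 e r ψ x M)) := by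
  have h := tendsto_massiveEscort hψ hr x M
  rw [← escort_eq_field le_rfl hψ hr M] at h
  refine h.congr' ?_
  filter_upwards [self_mem_nhdsWithin] with m hm
  rw [escort_of_pos hm]

variable {e' : M4}

lemma isStringWave_of_admissible (h : ψ ∈ admissible s m e e') :
    IsStringWave m e ψ ∧ IsStringWave m e' ψ :=
  ⟨⟨h.1, h.2.1, fun p => (h.2.2.1 p).1, fun p hp => (h.2.2.2 p hp).1⟩,
    ⟨h.1, h.2.1, fun p => (h.2.2.1 p).1, fun p hp => (h.2.2.2 p hp).2⟩⟩

lemma hasAmplitudes_escort (hm : 0 ≤ m) {S : Finset (Wave s)}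
    (hS : ∀ φ ∈ S, IsStringWave m e φ) {r : ℕ} (hr : r ≤ s) :
    HasAmplitudes m (yString m e) S (escort s m e r) := fun φ hφ =>
  ⟨(hS φ hφ).isGoodWave hm, escort_eq_field hm (hS φ hφ) hr⟩

lemma hasAmplitudes_proca (hm : 0 < m) {S : Finset (Wave s)}
    (hS : ∀ φ ∈ S, IsStringWave m e φ) :
    HasAmplitudes m (yProca m) S (proca s m) := fun φ hφ =>
  ⟨isGoodWave_yProca hm (hS φ hφ).smooth (hS φ hφ).compact (hS φ hφ).symm,
    proca_eq_field hm φ⟩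

end StringFields

/-! ### The generators -/

section Generators

variable {s : ℕ} {m : ℝ} {S : Finset (Wave s)} {Ψ Φ : Fock s} {y y' : E3 → Fin 3 → ℝ}

/-- Each order of the two fields contributes half of the one-particle matrix element by
`sum_momPairing`, once for (y, y') and once for (y', y). -/
theorem fockInner_dGamma_oneP (hm : 0 ≤ m)
    (hΨ : Ψ ∈ MvPolynomial.supported ℂ (S : Set (Wave s)))
    (hΦ : Φ ∈ MvPolynomial.supported ℂ (S : Set (Wave s)))
    (hy : ∀ φ ∈ S, IsGoodWave m y φ) (hy' : ∀ φ ∈ S, IsGoodWave m y' φ) (σ : Fin 4) :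
    fockInner m Ψ (dGamma (oneP m σ) Φ) = ∑ r ∈ Finset.range (s + 1), (s.choose r : ℂ) * (-1) ^ r *
      ∑ ψ ∈ S, ∑ φ ∈ S, fockInner m (MvPolynomial.pderiv ψ Ψ) (MvPolynomial.pderiv φ Φ) *
        (-(1 / 4) * momPairing m y y' r σ ψ φ + -(1 / 4) * momPairing m y' y r σ ψ φ) := by
  rw [fockInner_dGamma m _ S Ψ Φ hΨ hΦ]
  simp only [Finset.mul_sum]
  conv_rhs => rw [Finset.sum_comm]
  refine Finset.sum_congr rfl fun ψ hψ => ?_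
  conv_rhs => rw [Finset.sum_comm]
  refine Finset.sum_congr rfl fun φ hφ => ?_
  have h1 := sum_momPairing hm (hy ψ hψ) (hy' φ hφ) σ
  have h2 := sum_momPairing hm (hy' ψ hψ) (hy φ hφ) σ
  have h3 : waveInner m ψ (oneP m σ φ) = ∑ r ∈ Finset.range (s + 1), (s.choose r : ℂ) * (-1) ^ r *
      (-(1 / 4) * momPairing m y y' r σ ψ φ + -(1 / 4) * momPairing m y' y r σ ψ φ) := by
    simp only [mul_add, Finset.sum_add_distrib]
    rw [h1, h2]
    ring
  rw [h3, Finset.sum_mul]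
  exact Finset.sum_congr rfl fun r _ => by ring

/-- The contribution of the rank `r` fields to the Lorentz generators. -/
def lorPairing (m : ℝ) (y y' : E3 → Fin 3 → ℝ) (t : ℝ) (r : ℕ) (σ τ : Fin 4) (ψ φ : Wave s) :
    ℂ :=
  -(1 / 4) * (orbitalPairing m y y' t r σ τ ψ φ - orbitalPairing m y y' t r τ σ ψ φ)
    - (r / 2 : ℂ) * (spinPairing m y y' r σ τ ψ φ - spinPairing m y y' r τ σ ψ φ)

theorem fockInner_dGamma_oneM (hm : 0 ≤ m)
    (hΨ : Ψ ∈ MvPolynomial.supported ℂ (S : Set (Wave s)))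
    (hΦ : Φ ∈ MvPolynomial.supported ℂ (S : Set (Wave s)))
    (hy : ∀ φ ∈ S, IsGoodWave m y φ) (hy' : ∀ φ ∈ S, IsGoodWave m y' φ) (t : ℝ) (σ τ : Fin 4) :
    fockInner m Ψ (dGamma (oneM m σ τ) Φ) = ∑ r ∈ Finset.range (s + 1),
      (s.choose r : ℂ) * (-1) ^ r * ∑ ψ ∈ S, ∑ φ ∈ S,
        fockInner m (MvPolynomial.pderiv ψ Ψ) (MvPolynomial.pderiv φ Φ) *
          (lorPairing m y y' t r σ τ ψ φ + lorPairing m y' y t r σ τ ψ φ) := by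
  rw [fockInner_dGamma m _ S Ψ Φ hΨ hΦ]
  simp only [Finset.mul_sum]
  conv_rhs => rw [Finset.sum_comm]
  refine Finset.sum_congr rfl fun ψ hψ => ?_
  conv_rhs => rw [Finset.sum_comm]
  refine Finset.sum_congr rfl fun φ hφ => ?_
  have h1 : ∑ r ∈ Finset.range (s + 1), (s.choose r : ℂ) * (-1) ^ r *
      lorPairing m y y' t r σ τ ψ φ = _ := sum_lorentzPairing hm (hy ψ hψ) (hy' φ hφ) t σ τ
  have h2 : ∑ r ∈ Finset.range (s + 1), (s.choose r : ℂ) * (-1) ^ r *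
      lorPairing m y' y t r σ τ ψ φ = _ := sum_lorentzPairing hm (hy' ψ hψ) (hy φ hφ) t σ τ
  have h3 : waveInner m ψ (oneM m σ τ φ) = ∑ r ∈ Finset.range (s + 1),
      (s.choose r : ℂ) * (-1) ^ r *
      (lorPairing m y y' t r σ τ ψ φ + lorPairing m y' y t r σ τ ψ φ) := by
    simp only [mul_add, Finset.sum_add_distrib]
    rw [h1, h2]
    ring
  rw [h3, Finset.sum_mul]
  exact Finset.sum_congr rfl fun r _ => by ring

/-- The Proca field has no escort. -/
lemma tensorAmp_yProca_eq_zero (hm : 0 < m) {r : ℕ} (hr : r < s) (M : Fin r → Fin 4)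
    (ψ : Wave s) : tensorAmp m (yProca m) ψ (escortIndex s r M) = fun _ => 0 := by
  funext p
  refine Finset.sum_eq_zero fun I _ => ?_
  rw [Finset.prod_eq_zero (Finset.mem_univ (⟨r, hr⟩ : Fin s)), zero_mul]
  simp [escortIndex, intertwiner, escVec_yProca hm]

lemma momPairing_yProca_eq_zero (hm : 0 < m) {r : ℕ} (hr : r < s) (σ : Fin 4) (ψ φ : Wave s) :
    momPairing m (yProca m) (yProca m) r σ ψ φ = 0 := by
  simp [momPairing, tensorAmp_yProca_eq_zero hm hr]

lemma lorPairing_yProca_eq_zero (hm : 0 < m) {r : ℕ} (hr : r < s) (t : ℝ) (σ τ : Fin 4)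
    (ψ φ : Wave s) : lorPairing m (yProca m) (yProca m) t r σ τ ψ φ = 0 := by
  have h1 : ∀ ρ ρ', orbitalPairing m (yProca m) (yProca m) t r ρ ρ' ψ φ = 0 := by
    intro ρ ρ'
    simp [orbitalPairing, lorentzPairing, tensorAmp_yProca_eq_zero hm hr]
  have h2 : ∀ ρ ρ', spinPairing m (yProca m) (yProca m) r ρ ρ' ψ φ = 0 := by
    intro ρ ρ'
    cases r <;> simp [spinPairing, spinContr, tensorAmp_yProca_eq_zero hm hr]
  simp [lorPairing, h1, h2]

lemma sum_choose_eq_last {f : ℕ → ℂ} (hf : ∀ r < s, f r = 0) :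
    ∑ r ∈ Finset.range (s + 1), (s.choose r : ℂ) * (-1) ^ r * f r = (-1) ^ s * f s := by
  rw [Finset.sum_range_succ, Finset.sum_eq_zero fun r hr => by
    rw [hf r (Finset.mem_range.1 hr), mul_zero]]
  simp

/-- The Wick product is symmetric in its two fields while the single arrow is antisymmetric; for
equal fields, exchanging them amounts to exchanging σ and τ. -/
lemma spinDensity_self_antisymm {r : ℕ} (X : QTen s r) (σ τ : Fin 4) (x : M4) (Ψ Φ : Fock s) :
    spinDensity m X X σ τ x Ψ Φ = -spinDensity m X X τ σ x Ψ Φ := by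
  cases r with
  | zero => simp [spinDensity]
  | succ r =>
    simp only [spinDensity, ← Finset.sum_neg_distrib]
    refine Finset.sum_congr rfl fun N _ => ?_
    rw [lr1, lr1, wick_comm m _ (fun φ => pd 0 (fun y => X φ y (Fin.cons τ N)) x),
      wick_comm m _ (fun φ => X φ x (Fin.cons τ N))]
    ring

/-- The coefficient s of the Proca spin density is twice the s/2 in `lorDensity`, because
antisymmetrizing an already antisymmetric term doubles it. -/
lemma procaLorDensity_eq (s : ℕ) (m : ℝ) (σ τ : Fin 4) (x : M4) (Ψ Φ : Fock s) :
    procaLorDensity s m σ τ x Ψ Φ = lorDensity m (proca s m) (proca s m) σ τ x Ψ Φ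
      - lorDensity m (proca s m) (proca s m) τ σ x Ψ Φ := by
  have h := spinDensity_self_antisymm (m := m) (proca s m) τ σ x Ψ Φ
  rw [procaLorDensity, lorDensity, lorDensity, h]
  ring

theorem proca_generators {e : M4} (hm : 0 < m)
    (hΨ : Ψ ∈ MvPolynomial.supported ℂ (S : Set (Wave s)))
    (hΦ : Φ ∈ MvPolynomial.supported ℂ (S : Set (Wave s)))
    (hS : ∀ φ ∈ S, IsStringWave m e φ) (t : ℝ) :
    (∀ σ : Fin 4,
      Integrable (fun x : E3 => momDensity m (proca s m) (proca s m) σ (fourVec t x) Ψ Φ) ∧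
      fockInner m Ψ (dGamma (oneP m σ) Φ) = (-1) ^ s * ∫ x : E3,
        momDensity m (proca s m) (proca s m) σ (fourVec t x) Ψ Φ) ∧
    (∀ σ τ : Fin 4,
      Integrable (fun x : E3 => procaLorDensity s m σ τ (fourVec t x) Ψ Φ) ∧
      fockInner m Ψ (dGamma (oneM m σ τ) Φ) = (-1) ^ s * ∫ x : E3,
        procaLorDensity s m σ τ (fourVec t x) Ψ Φ) := by
  have hX := hasAmplitudes_proca hm hS
  have hy : ∀ φ ∈ S, IsGoodWave m (yProca m) φ := fun φ hφ => (hX φ hφ).1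
  refine ⟨fun σ => ?_, fun σ τ => ?_⟩
  · have h := hasInt_momDensity hm.le hΨ hΦ hX hX σ t
    refine ⟨h.1, ?_⟩
    rw [h.2, fockInner_dGamma_oneP hm.le hΨ hΦ hy hy, sum_choose_eq_last]
    intro r hr
    simp [momPairing_yProca_eq_zero hm hr]
  · have h := (hasInt_lorDensity_sub hm.le hΨ hΦ hX hX σ τ t).congr_fun
      fun x => procaLorDensity_eq s m σ τ (fourVec t x) Ψ Φ
    refine ⟨h.1, ?_⟩
    rw [h.2, fockInner_dGamma_oneM hm.le hΨ hΦ hy hy t, sum_choose_eq_last]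
    · rfl
    · intro r hr
      simp [lorPairing_yProca_eq_zero hm hr]

end Generators

end StringQFT

end

/-! ### Proof of the proposition. -/

theorem propositionp (s : ℕ) (m : ℝ) (hm : 0 ≤ m) (e e' : Fin 4 → ℝ)
    (he : StringQFT.mdot e e = -1) (he' : StringQFT.mdot e' e' = -1) :
    -- at any time `t`, for any finite particle vectors `Ψ`, `Φ`
    (∀ (t : ℝ) (Ψ Φ : StringQFT.Fock s),
      Ψ ∈ MvPolynomial.supported ℂ (StringQFT.admissible s m e e') →
      Φ ∈ MvPolynomial.supported ℂ (StringQFT.admissible s m e e') →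
      -- the spatial integrals converge
      (∀ r ≤ s, ∀ σ : Fin 4, Integrable (fun x : StringQFT.E3 =>
        StringQFT.momDensity m (StringQFT.escort s m e r) (StringQFT.escort s m e' r) σ
          (StringQFT.fourVec t x) Ψ Φ)) ∧
      (∀ r ≤ s, ∀ σ τ : Fin 4, Integrable (fun x : StringQFT.E3 =>
        StringQFT.lorDensity m (StringQFT.escort s m e r) (StringQFT.escort s m e' r) σ τ
          (StringQFT.fourVec t x) Ψ Φ)) ∧
      -- momenta
      (∀ σ : Fin 4,
        StringQFT.fockInner m Ψ (StringQFT.dGamma (StringQFT.oneP m σ) Φ) =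
          ∑ r ∈ Finset.range (s + 1), (s.choose r : ℂ) * (-1) ^ r *
            ∫ x : StringQFT.E3, StringQFT.momDensity m (StringQFT.escort s m e r)
              (StringQFT.escort s m e' r) σ (StringQFT.fourVec t x) Ψ Φ) ∧
      -- Lorentz generators
      (∀ σ τ : Fin 4,
        StringQFT.fockInner m Ψ (StringQFT.dGamma (StringQFT.oneM m σ τ) Φ) =
          ∑ r ∈ Finset.range (s + 1), (s.choose r : ℂ) * (-1) ^ r *
            ∫ x : StringQFT.E3,
              (StringQFT.lorDensity m (StringQFT.escort s m e r) (StringQFT.escort s m e' r)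
                  σ τ (StringQFT.fourVec t x) Ψ Φ
                - StringQFT.lorDensity m (StringQFT.escort s m e r) (StringQFT.escort s m e' r)
                  τ σ (StringQFT.fourVec t x) Ψ Φ)) ∧
      -- for positive mass these are the generators written in terms of the Proca field
      (0 < m →
        (∀ σ : Fin 4,
          Integrable (fun x : StringQFT.E3 =>
            StringQFT.momDensity m (StringQFT.proca s m) (StringQFT.proca s m) σ
              (StringQFT.fourVec t x) Ψ Φ) ∧
          StringQFT.fockInner m Ψ (StringQFT.dGamma (StringQFT.oneP m σ) Φ) =
            (-1) ^ s * ∫ x : StringQFT.E3,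
              StringQFT.momDensity m (StringQFT.proca s m) (StringQFT.proca s m) σ
                (StringQFT.fourVec t x) Ψ Φ) ∧
        (∀ σ τ : Fin 4,
          Integrable (fun x : StringQFT.E3 =>
            StringQFT.procaLorDensity s m σ τ (StringQFT.fourVec t x) Ψ Φ) ∧
          StringQFT.fockInner m Ψ (StringQFT.dGamma (StringQFT.oneM m σ τ) Φ) =
            (-1) ^ s * ∫ x : StringQFT.E3,
              StringQFT.procaLorDensity s m σ τ (StringQFT.fourVec t x) Ψ Φ))) ∧
    -- at mass zero the fields are regular: they are the limits of the massive ones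
    (m = 0 → ∀ ψ ∈ StringQFT.admissible s 0 e e', ∀ r ≤ s,
      ∀ (x : Fin 4 → ℝ) (M : Fin r → Fin 4),
        Tendsto (fun m' : ℝ => StringQFT.escort s m' e r ψ x M) (𝓝[>] 0)
          (𝓝 (StringQFT.escort s 0 e r ψ x M)) ∧
        Tendsto (fun m' : ℝ => StringQFT.escort s m' e' r ψ x M) (𝓝[>] 0)
          (𝓝 (StringQFT.escort s 0 e' r ψ x M))) := by
  -- Two polynomials involve only finitely many variables, all of them admissible wave functions;
  -- this finite set indexes the double sums.
  have hset : ∀ Ψ Φ : StringQFT.Fock s, Ψ ∈ MvPolynomial.supported ℂ (StringQFT.admissible s m e e') →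
      Φ ∈ MvPolynomial.supported ℂ (StringQFT.admissible s m e e') → ∃ S : Finset (StringQFT.Wave s),
      Ψ ∈ MvPolynomial.supported ℂ (S : Set (StringQFT.Wave s)) ∧
      Φ ∈ MvPolynomial.supported ℂ (S : Set (StringQFT.Wave s)) ∧
      ∀ φ ∈ S, φ ∈ StringQFT.admissible s m e e' := by
    classical
    intro Ψ Φ hΨ hΦ
    rw [MvPolynomial.mem_supported] at hΨ hΦ
    refine ⟨Ψ.vars ∪ Φ.vars, ?_, ?_, fun φ hφ => ?_⟩
    · rw [MvPolynomial.mem_supported]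
      simp
    · rw [MvPolynomial.mem_supported]
      simp
    · rcases Finset.mem_union.1 hφ with h | h
      · exact hΨ h
      · exact hΦ h
  refine ⟨fun t Ψ Φ hΨ' hΦ' => ?_, ?_⟩
  · obtain ⟨S, hΨ, hΦ, hS⟩ := hset Ψ Φ hΨ' hΦ'
    have hw := fun φ hφ => StringQFT.isStringWave_of_admissible (hS φ hφ)
    have hX := fun r (hr : r ≤ s) =>
      StringQFT.hasAmplitudes_escort hm (fun φ hφ => (hw φ hφ).1) hr
    have hY := fun r (hr : r ≤ s) =>
      StringQFT.hasAmplitudes_escort hm (fun φ hφ => (hw φ hφ).2) hr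
    have hy := fun φ hφ => (hw φ hφ).1.isGoodWave hm
    have hy' := fun φ hφ => (hw φ hφ).2.isGoodWave hm
    refine ⟨fun r hr σ => (StringQFT.hasInt_momDensity hm hΨ hΦ (hX r hr) (hY r hr) σ t).1,
      fun r hr σ τ => StringQFT.integrable_lorDensity hm hΨ hΦ (hX r hr) (hY r hr) σ τ t,
      fun σ => ?_, fun σ τ => ?_, fun hm' => ?_⟩
    · rw [StringQFT.fockInner_dGamma_oneP hm hΨ hΦ hy hy']
      refine Finset.sum_congr rfl fun r hr => ?_
      have hr' := Nat.lt_succ_iff.1 (Finset.mem_range.1 hr)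
      rw [(StringQFT.hasInt_momDensity hm hΨ hΦ (hX r hr') (hY r hr') σ t).2]
    · rw [StringQFT.fockInner_dGamma_oneM hm hΨ hΦ hy hy' t]
      refine Finset.sum_congr rfl fun r hr => ?_
      have hr' := Nat.lt_succ_iff.1 (Finset.mem_range.1 hr)
      rw [(StringQFT.hasInt_lorDensity_sub hm hΨ hΦ (hX r hr') (hY r hr') σ τ t).2]
      rfl
    · exact StringQFT.proca_generators hm' hΨ hΦ (fun φ hφ => (hw φ hφ).1) t
  · rintro rfl ψ hψ r hr x M
    have hw := StringQFT.isStringWave_of_admissible hψ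
    exact ⟨StringQFT.tendsto_escort hw.1 hr x M, StringQFT.tendsto_escort hw.2 hr x M⟩
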